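/- **Definitions.** A *Sturm–Liouville orthogonal polynomial system* (SL-OPS) consists of a finite set $E\subset\mathbb N$ and real polynomials $y_k$, $\deg y_k=k$, $k\in\mathbb N\setminus E$, such that: (i) there is an operator $T=p\,D^2+q\,D+r$ ($D=d/dz$) with $p,q,r\in\mathbb R(z)$, $p\neq 0$, such that each $y_k$, $k\notin E$, satisfies $T[y_k]=\lambda_k y_k$ for some constant $\lambda_k$, and $T$ has no polynomial eigenfunction whose degree lies in $E$; (ii) there is a non-empty open interval $I=(a,b)$, $-\infty\le a<b\le\infty$, on which the weight $W=\frac1p\exp\left(\int^z \frac{q}{p}\,dx\right)$ has a single-valued, continuous, positive branch, with $\int_I |z|^j\,W(z)\,dz<\infty$ for all $j\in\mathbb N$, and $u(z)p(z)W(z)\to 0$ at both endpoints of $I$ for every polynomial $u$; (iii) the span of $\{y_k : k\notin E\}$ is dense in $L^2(I,W\,dz)$. (The case $E=\emptyset$ is allowed. $T$ is called an operator of the system.) A *rational Darboux transformation* is a passage $T=BA+\lambda\ \mapsto\ \hat T=AB+\lambda$, where $T,\hat T$ are second-order and $A,B$ are first-order linear differential operators with coefficients in $\mathbb C(z)$,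 and $\lambda\in\mathbb C$. A *classical orthogonal polynomial system* is the system of polynomials $P_n(z)=Q_n(sz+t)$, $n\in\mathbb N$ ($s,t\in\mathbb R$, $s\ne0$), where $Q_n$ has degree $n$ and the $Q_n$ are, up to normalization, the polynomial eigenfunctions of one of the operators in $x=sz+t$ $$\frac{d^2}{dx^2}-2x\frac{d}{dx}\ \text{(Hermite)},\qquad x\frac{d^2}{dx^2}+(1+\alpha-x)\frac{d}{dx}\ \text{(Laguerre, }\alpha>-1),$$ $$(1-x^2)\frac{d^2}{dx^2}+\big(\beta-\alpha-(2+\alpha+\beta)x\big)\frac{d}{dx}\ \text{(Jacobi, }\alpha,\beta>-1).$$ Its operator is this operator written in the variable $z$; it is considered up to a non-zero real multiplicative constant and an additive real constant (a spectral shift). **Theorem.** Every SL-OPS can be obtained from a classical orthogonal polynomial system by a finite sequence of rational Darboux transformations. That is: if $T$ is an operator of an SL-OPS, then there are a classical orthogonal polynomial system with operator $T_0$ (for some choice of the multiplicative constant and of the spectral shift), and second-order operators $T_0,T_1,\dots,T_n=T$, $n\ge 0$, with coefficients in $\mathbb C(z)$, such that each $T_i\mapsto T_{i+1}$, $0\le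 i<n$, is a rational Darboux transformation. -/

import Mathlib

open Polynomial MeasureTheory Filter Topology

noncomputable section

/-- The derivative `d/dz` on the field `K(z)` of rational functions, by the quotient rule applied
to the reduced fraction. -/
def ratDeriv {K : Type*} [Field K] (f : RatFunc K) : RatFunc K :=
  (algebraMap K[X] (RatFunc K) (derivative f.num) * algebraMap K[X] (RatFunc K) f.denom
    - algebraMap K[X] (RatFunc K) f.num * algebraMap K[X] (RatFunc K) (derivative f.denom))
    / algebraMap K[X] (RatFunc K) f.denom ^ 2

/-- A differential operator `a D + b` of order exactly one with coefficients in `K(z)`. -/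
structure DiffOp1 (K : Type*) [Field K] where
  a : RatFunc K
  b : RatFunc K
  a_ne_zero : a ≠ 0

/-- The action of `a D + b` on rational functions. (A differential operator with rational
coefficients over a field of characteristic zero is determined by this action.) -/
def DiffOp1.apply {K : Type*} [Field K] (A : DiffOp1 K) (f : RatFunc K) : RatFunc K :=
  A.a * ratDeriv f + A.b * f

/-- A differential operator `p D² + q D + r` of order exactly two with coefficients in `K(z)`. -/
structure DiffOp2 (K : Type*) [Field K] where
  p : RatFunc K
  q : RatFunc K
  r : RatFunc K
  p_ne_zero : p ≠ 0

/-- The action of `p D² + q D + r` on rational functions. -/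
def DiffOp2.apply {K : Type*} [Field K] (T : DiffOp2 K) (f : RatFunc K) : RatFunc K :=
  T.p * ratDeriv (ratDeriv f) + T.q * ratDeriv f + T.r * f

/-- The inclusion `ℝ(z) → ℂ(z)`. -/
def ratComplexify : RatFunc ℝ →+* RatFunc ℂ :=
  RatFunc.mapRingHom (Polynomial.mapRingHom (algebraMap ℝ ℂ))
    (nonZeroDivisors_le_comap_nonZeroDivisors_of_injective _
      (Polynomial.map_injective _ (algebraMap ℝ ℂ).injective))

/-- A real operator regarded as an operator with coefficients in `ℂ(z)`. -/
def DiffOp2.complexify (T : DiffOp2 ℝ) : DiffOp2 ℂ where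
  p := ratComplexify T.p
  q := ratComplexify T.q
  r := ratComplexify T.r
  p_ne_zero := (map_ne_zero ratComplexify).2 T.p_ne_zero

/-- `T ↦ T'` is a rational Darboux transformation: `T = B A + l` and `T' = A B + l` for first-order
operators `A`, `B` with coefficients in `ℂ(z)` and a constant `l`. -/
def IsRationalDarboux (T T' : DiffOp2 ℂ) : Prop :=
  ∃ (A B : DiffOp1 ℂ) (l : ℂ),
    (∀ f : RatFunc ℂ, T.apply f = B.apply (A.apply f) + RatFunc.C l * f) ∧
    (∀ f : RatFunc ℂ, T'.apply f = A.apply (B.apply f) + RatFunc.C l * f)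

/-- `T'` is obtained from `T` by a finite sequence of rational Darboux transformations
(a factorization chain from `T` to `T'`). -/
def FactorizationChain (T T' : DiffOp2 ℂ) : Prop :=
  Relation.ReflTransGen IsRationalDarboux T T'

/-- The polynomial `y` satisfies `T y = c y` for some constant `c`. -/
def DiffOp2.HasEigenpoly {K : Type*} [Field K] (T : DiffOp2 K) (y : K[X]) : Prop :=
  ∃ c : K, T.apply (algebraMap K[X] (RatFunc K) y) = RatFunc.C c * algebraMap K[X] (RatFunc K) y

/-- The value of a real rational function at a real point (used away from the poles). -/
def ratEval (f : RatFunc ℝ) (x : ℝ) : ℝ := f.eval (RingHom.id ℝ) x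

/-- The open interval `(a, b)` of the real line with endpoints in `[-∞, ∞]`. -/
def openInterval (a b : EReal) : Set ℝ := {x : ℝ | a < (x : EReal) ∧ (x : EReal) < b}

/-- `W` is a single-valued positive branch on `I` of the weight `W = P / p`,
`P = exp (∫ q / p)`, of `T = p D² + q D + r`: it is positive and continuous on `I`, and
`P = p W` satisfies `P' = (q / p) P` at each point of `I` that is not a zero of `p` or a pole of
`p` or `q`. -/
structure IsWeightOn (T : DiffOp2 ℝ) (I : Set ℝ) (W : ℝ → ℝ) : Prop where
  pos : ∀ x ∈ I, 0 < W x
  cont : ContinuousOn W I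
  deriv : ∀ x ∈ I, T.p.denom.eval x ≠ 0 → T.q.denom.eval x ≠ 0 → ratEval T.p x ≠ 0 →
    HasDerivAt (fun t => ratEval T.p t * W t)
      (ratEval T.q x / ratEval T.p x * (ratEval T.p x * W x)) x

/-- The measure `W(z) dz` on `I`. -/
def weightMeasure (I : Set ℝ) (W : ℝ → ℝ) : Measure ℝ :=
  (volume.restrict I).withDensity (fun x => ENNReal.ofReal (W x))

/-- The real polynomials `y k`, `k ∉ E`, form a Sturm-Liouville orthogonal polynomial system with
operator `T`, interval `(a, b)` and weight `W`. (The values `y k` for `k ∈ E` play no role.) -/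
structure IsSLOPS (T : DiffOp2 ℝ) (a b : EReal) (W : ℝ → ℝ) (E : Finset ℕ) (y : ℕ → ℝ[X]) :
    Prop where
  degree_eq : ∀ k ∉ E, (y k).degree = k
  eigen : ∀ k ∉ E, T.HasEigenpoly (y k)
  /-- There is no eigenpolynomial whose degree is one of the exceptional degrees. -/
  exceptional : ∀ k ∈ E, ∀ u : ℝ[X], u.degree = k → ¬ T.HasEigenpoly u
  lt : a < b
  weight : IsWeightOn T (openInterval a b) W
  integrable : IntegrableOn W (openInterval a b)
  moments : ∀ j : ℕ, IntegrableOn (fun x => x ^ j * W x) (openInterval a b)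
  /-- `u p W → 0` at the left endpoint (the filter is `x → a⁺`, or `x → -∞` if `a = -∞`). -/
  boundary_left : ∀ u : ℝ[X], Tendsto (fun x : ℝ => u.eval x * ratEval T.p x * W x)
    (comap Real.toEReal (𝓝[>] a)) (𝓝 0)
  /-- `u p W → 0` at the right endpoint. -/
  boundary_right : ∀ u : ℝ[X], Tendsto (fun x : ℝ => u.eval x * ratEval T.p x * W x)
    (comap Real.toEReal (𝓝[<] b)) (𝓝 0)
  /-- The span of the `y k`, `k ∉ E`, is dense in `L²(W dz, (a, b))`. -/
  dense : ∀ f : ℝ → ℝ, MemLp f 2 (weightMeasure (openInterval a b) W) →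
    ∀ ε : ENNReal, 0 < ε → ∃ u ∈ Submodule.span ℝ {v : ℝ[X] | ∃ k ∉ E, v = y k},
      eLpNorm (fun x => f x - u.eval x) 2 (weightMeasure (openInterval a b) W) < ε

/-- The coefficients `(p, q)` of the classical operators `p D² + q D` of Hermite, Laguerre and
Jacobi, with the parameters for which the weights `e^{-z²}` on `ℝ`, `z^α e^{-z}` on `(0, ∞)` and
`(1-z)^α (1+z)^β` on `(-1, 1)` are integrable. -/
inductive IsClassicalPair : ℝ[X] → ℝ[X] → Prop
  | hermite : IsClassicalPair 1 (-(2 * X))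
  | laguerre (α : ℝ) (hα : -1 < α) : IsClassicalPair X (C (1 + α) - X)
  | jacobi (α β : ℝ) (hα : -1 < α) (hβ : -1 < β) :
      IsClassicalPair (1 - X ^ 2) (C (β - α) - C (2 + α + β) * X)

/-- `P 0, P 1, P 2, …` is a classical orthogonal polynomial system with operator `T`: there are
Hermite, Laguerre or Jacobi polynomials `Q n` (polynomials of degree `n` solving the corresponding
classical equation; this determines them up to normalization) such that, for a real affine change
of variable `x = s z + t`, one has `P n (z) = Q n (s z + t)`, and `T` is the classical operator
written in the variable `z` (so `d/dx = s⁻¹ d/dz`), up to a nonzero multiplicative constant `c` and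
a spectral shift `m`. -/
def IsClassicalOPS (T : DiffOp2 ℝ) (P : ℕ → ℝ[X]) : Prop :=
  ∃ (p q : ℝ[X]) (Q : ℕ → ℝ[X]) (s t c m : ℝ), IsClassicalPair p q ∧ s ≠ 0 ∧ c ≠ 0 ∧
    (∀ n, (Q n).degree = n ∧
      ∃ l : ℝ, p * derivative (derivative (Q n)) + q * derivative (Q n) = C l * Q n) ∧
    (∀ n, P n = (Q n).comp (C s * X + C t)) ∧
    T.p = algebraMap ℝ[X] (RatFunc ℝ) (C (c / s ^ 2) * p.comp (C s * X + C t)) ∧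
    T.q = algebraMap ℝ[X] (RatFunc ℝ) (C (c / s) * q.comp (C s * X + C t)) ∧
    T.r = RatFunc.C m

end

/-!
Why every exceptional system comes from a classical one.

*Structure of `T`.* The span of the `y k` has finite codimension in the polynomials and is invariant
under `T`. Hence every large order of vanishing at a complex point `ξ` occurs in it, and comparing
orders of vanishing of `v` and `T v` (`exists_indicial_root_modEq`) shows that `p` is a polynomial,
that the poles of `q` are simple, and that the residues of `q / p` there are negative even integers.
Collecting these integers in a polynomial `η` gives `q = Q - 2 p η' / η` with `deg p ≤ 2` and
`deg Q ≤ 1` (`exists_normalForm`). So `p D² + Q D` is an operator of classical shape, the weight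
`η² W` satisfies its Pearson equation, and the eigenvalue of `y k` is, up to a fixed constant `c`,
that of `p D² + Q D` in degree `n = k - deg η`.

*Comparison of eigenpolynomials.* The operator `T` is symmetric with respect to `W`. For a suitable
polynomial `g`, all products `g f` lie in an invariant space, so symmetry makes `g y k` orthogonal
with respect to `η² W` to all polynomials of degree less than `n - M`, with `M` independent of `k`.
The polynomials of degree at most `n + M` with this property form a space of dimension at most
`2 M + 1`. The polynomials `A H + B p H'` with `deg A ≤ M`, `deg B < M`, where `H` is the
eigenpolynomial of `p D² + Q D` of degree `n`, belong to it and fill it for reasons of dimension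
(`IsPearson.exists_eq_mul_add`), because `A H + B H' = 0` with `B ≠ 0` of low degree contradicts
positivity (`IsPearson.eq_zero_of_mul_add_mul_derivative`). Hence `y k = a H + b H'`, where the pairs
`(a, b)` of rational functions range over a finite-dimensional space.

*An intertwiner.* The operator `a + b D` maps the eigenfunction `H` of `T₀ = p D² + Q D + c` to an
eigenfunction of `T`. For large `k` this forces the identity `(T - λ) (a + b D) = 0` modulo
`T₀ - λ` at `λ = λ_k`. As the pairs lie in a finite-dimensional space, finitely many of them satisfy
a linear relation, and Lagrange interpolation in `λ` produces a nonzero operator `a + b D` with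
coefficients polynomial in `λ` for which the identity holds for all `λ` (`exists_intertwines`).

*Factorization.* The determinant of `(f, f') ↦ (g, g')`, `g = a f + b f'`, is a factor in `ℂ(z)`
times a polynomial in `λ` with constant coefficients (`exists_eq_C_mul_map_of_coeffDeriv_eq`). At a
root `λ₀` of the latter either `a + b D` is divisible by `λ - λ₀`, or it shares a right factor
`D - u` with `T₀ - λ₀`; splitting off these factors one at a time is a sequence of rational Darboux
transformations from `T₀` to `T`, up to a final gauge transformation which is also such a sequence
(`Intertwines.factorizationChain`).

*Identification.* The Darboux transformation with `A = D` replaces `Q` by `Q + p'`, which raises the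
Laguerre and Jacobi parameters by one, so `T₀` may be taken classical with integrable weight. The
decay of the weight at the endpoints excludes the operators with constant `p` that are not of
Hermite type, and the quadratic `p` without two distinct real zeros.
-/

/-! ### The derivation `d/dz` on rational functions -/

section RatDeriv

variable {K : Type*} [Field K]

local notation "ι" => algebraMap K[X] (RatFunc K)

theorem algebraMap_ratFunc_ne_zero {Q : K[X]} (hQ : Q ≠ 0) : ι Q ≠ 0 := by
  simpa using hQ

/-- The quotient rule holds for every representation as a fraction, reduced or not. -/
theorem ratDeriv_div (P : K[X]) {Q : K[X]} (hQ : Q ≠ 0) :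
    ratDeriv (ι P / ι Q) = (ι (derivative P) * ι Q - ι P * ι (derivative Q)) / ι Q ^ 2 := by
  set f := ι P / ι Q with hf
  have hd : f.denom ≠ 0 := f.denom_ne_zero
  have hQ' := algebraMap_ratFunc_ne_zero hQ
  have hd' := algebraMap_ratFunc_ne_zero hd
  have h1 : P * f.denom = f.num * Q := by
    have : ι P / ι Q = ι f.num / ι f.denom := by rw [RatFunc.num_div_denom]
    rw [div_eq_div_iff hQ' hd', ← map_mul, ← map_mul] at this
    exact RatFunc.algebraMap_injective K this
  have h2 : derivative P * f.denom + P * derivative f.denom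
      = derivative f.num * Q + f.num * derivative Q := by
    rw [← derivative_mul, ← derivative_mul, h1]
  have h1' : ι P * ι f.denom = ι f.num * ι Q := by rw [← map_mul, ← map_mul, h1]
  have h2' : ι (derivative P) * ι f.denom + ι P * ι (derivative f.denom)
      = ι (derivative f.num) * ι Q + ι f.num * ι (derivative Q) := by
    simpa only [map_mul, map_add] using congrArg ι h2
  rw [ratDeriv, div_eq_div_iff (pow_ne_zero 2 hd') (pow_ne_zero 2 hQ')]
  linear_combination (-ι Q * ι f.denom) * h2'
    + (ι f.denom * ι (derivative Q) + ι Q * ι (derivative f.denom)) * h1'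

@[simp] theorem ratDeriv_algebraMap (P : K[X]) : ratDeriv (ι P) = ι (derivative P) := by
  have := ratDeriv_div P (Q := 1) one_ne_zero
  simpa using this

theorem exists_eq_div (f : RatFunc K) : ∃ P Q : K[X], Q ≠ 0 ∧ f = ι P / ι Q :=
  ⟨f.num, f.denom, f.denom_ne_zero, (RatFunc.num_div_denom f).symm⟩

theorem ratDeriv_add (f g : RatFunc K) : ratDeriv (f + g) = ratDeriv f + ratDeriv g := by
  obtain ⟨P, Q, hQ, rfl⟩ := exists_eq_div f
  obtain ⟨R, S, hS, rfl⟩ := exists_eq_div g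
  have hQ' := algebraMap_ratFunc_ne_zero hQ
  have hS' := algebraMap_ratFunc_ne_zero hS
  have : ι P / ι Q + ι R / ι S = ι (P * S + R * Q) / ι (Q * S) := by
    simp only [map_add, map_mul]; field_simp
  rw [this, ratDeriv_div _ (mul_ne_zero hQ hS), ratDeriv_div _ hQ, ratDeriv_div _ hS]
  simp only [map_add, map_mul, derivative_mul]
  field_simp
  ring

theorem ratDeriv_mul (f g : RatFunc K) :
    ratDeriv (f * g) = ratDeriv f * g + f * ratDeriv g := by
  obtain ⟨P, Q, hQ, rfl⟩ := exists_eq_div f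
  obtain ⟨R, S, hS, rfl⟩ := exists_eq_div g
  have hQ' := algebraMap_ratFunc_ne_zero hQ
  have hS' := algebraMap_ratFunc_ne_zero hS
  have : ι P / ι Q * (ι R / ι S) = ι (P * R) / ι (Q * S) := by
    simp only [map_mul]; field_simp
  rw [this, ratDeriv_div _ (mul_ne_zero hQ hS), ratDeriv_div _ hQ, ratDeriv_div _ hS]
  simp only [map_add, map_mul, derivative_mul]
  field_simp
  ring

@[simp] theorem ratDeriv_C (c : K) : ratDeriv (RatFunc.C c) = 0 := by
  rw [← RatFunc.algebraMap_C, ratDeriv_algebraMap]; simp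

@[simp] theorem ratDeriv_zero : ratDeriv (0 : RatFunc K) = 0 := by
  simpa using ratDeriv_C (0 : K)

@[simp] theorem ratDeriv_one : ratDeriv (1 : RatFunc K) = 0 := by
  simpa using ratDeriv_C (1 : K)

/-- `d/dz` as an additive map. -/
noncomputable def ratDerivHom (K : Type*) [Field K] : RatFunc K →+ RatFunc K :=
  AddMonoidHom.mk' ratDeriv ratDeriv_add

theorem ratDeriv_neg (f : RatFunc K) : ratDeriv (-f) = -ratDeriv f := map_neg (ratDerivHom K) f

theorem ratDeriv_sub (f g : RatFunc K) : ratDeriv (f - g) = ratDeriv f - ratDeriv g :=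
  map_sub (ratDerivHom K) f g

theorem ratDeriv_sum {α : Type*} (s : Finset α) (f : α → RatFunc K) :
    ratDeriv (∑ i ∈ s, f i) = ∑ i ∈ s, ratDeriv (f i) := map_sum (ratDerivHom K) f s

theorem ratDeriv_inv {f : RatFunc K} (hf : f ≠ 0) : ratDeriv f⁻¹ = -ratDeriv f / f ^ 2 := by
  have h : ratDeriv (f * f⁻¹) = 0 := by rw [mul_inv_cancel₀ hf, ratDeriv_one]
  rw [ratDeriv_mul] at h
  field_simp at h ⊢
  linear_combination h

theorem ratDeriv_div' (f : RatFunc K) {g : RatFunc K} (hg : g ≠ 0) :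
    ratDeriv (f / g) = (ratDeriv f * g - f * ratDeriv g) / g ^ 2 := by
  rw [div_eq_mul_inv, ratDeriv_mul, ratDeriv_inv hg]
  field_simp
  ring

/-- In characteristic zero the only rational functions with zero derivative are the constants. -/
theorem eq_C_of_ratDeriv_eq_zero [CharZero K] {f : RatFunc K} (hf : ratDeriv f = 0) :
    ∃ c : K, f = RatFunc.C c := by
  have hd := f.denom_ne_zero
  have hd' := algebraMap_ratFunc_ne_zero hd
  have h : derivative f.num * f.denom = f.num * derivative f.denom := by
    rw [ratDeriv, div_eq_zero_iff, or_iff_left (pow_ne_zero 2 hd'), sub_eq_zero, ← map_mul,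
      ← map_mul] at hf
    exact RatFunc.algebraMap_injective K hf
  -- the reduced denominator divides its own derivative, hence is constant
  have h1 : f.denom ∣ derivative f.denom :=
    (f.isCoprime_num_denom.symm).dvd_of_dvd_mul_left ⟨derivative f.num, by rw [← h]; ring⟩
  have h2 : derivative f.denom = 0 := by
    by_contra hne
    have := degree_le_of_dvd h1 hne
    exact absurd (degree_derivative_lt hd) (not_lt.2 this)
  have h3 : derivative f.num = 0 := by
    rw [h2, mul_zero] at h
    exact (mul_eq_zero.1 h).resolve_right hd
  refine ⟨f.num.coeff 0 / f.denom.coeff 0, ?_⟩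
  have e1 := eq_C_of_derivative_eq_zero h2
  have e2 := eq_C_of_derivative_eq_zero h3
  conv_lhs => rw [← RatFunc.num_div_denom f, e1, e2]
  simp [RatFunc.algebraMap_C]

end RatDeriv

theorem ratComplexify_algebraMap (P : ℝ[X]) :
    ratComplexify (algebraMap ℝ[X] (RatFunc ℝ) P)
      = algebraMap ℂ[X] (RatFunc ℂ) (P.map (algebraMap ℝ ℂ)) := by
  rw [ratComplexify, RatFunc.coe_mapRingHom_eq_coe_map]
  simpa using RatFunc.map_apply_div (φ := Polynomial.mapRingHom (algebraMap ℝ ℂ))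
    (nonZeroDivisors_le_comap_nonZeroDivisors_of_injective _
      (Polynomial.map_injective _ (algebraMap ℝ ℂ).injective)) P 1

theorem ratComplexify_C (c : ℝ) : ratComplexify (RatFunc.C c) = RatFunc.C (c : ℂ) := by
  rw [← RatFunc.algebraMap_C, ratComplexify_algebraMap]
  simp

theorem ratDeriv_ratComplexify (f : RatFunc ℝ) :
    ratDeriv (ratComplexify f) = ratComplexify (ratDeriv f) := by
  obtain ⟨P, Q, hQ, rfl⟩ := exists_eq_div f
  have hQ' : Q.map (algebraMap ℝ ℂ) ≠ 0 :=
    (Polynomial.map_ne_zero_iff (algebraMap ℝ ℂ).injective).2 hQ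
  rw [ratDeriv_div P hQ]
  simp only [map_div₀, map_sub, map_mul, map_pow, ratComplexify_algebraMap]
  rw [ratDeriv_div _ hQ', derivative_map, derivative_map]

/-! ### Polynomials in a spectral parameter over `K(z)` -/

section CoeffDeriv

variable {K : Type*} [Field K]

/-- The derivation of `K(z)[λ]` that acts as `d/dz` on coefficients and kills `λ` (here `X`). -/
noncomputable def coeffDeriv (a : (RatFunc K)[X]) : (RatFunc K)[X] :=
  ∑ n ∈ a.support, monomial n (ratDeriv (a.coeff n))

@[simp] theorem coeff_coeffDeriv (a : (RatFunc K)[X]) (n : ℕ) :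
    (coeffDeriv a).coeff n = ratDeriv (a.coeff n) := by
  simp only [coeffDeriv, finsetSum_coeff, coeff_monomial, Finset.sum_ite_eq', mem_support_iff]
  split_ifs with h
  · rfl
  · rw [notMem_support_iff.1 h, ratDeriv_zero]

theorem coeffDeriv_add (a b : (RatFunc K)[X]) :
    coeffDeriv (a + b) = coeffDeriv a + coeffDeriv b := by
  ext n; simp [ratDeriv_add]

theorem coeffDeriv_sub (a b : (RatFunc K)[X]) :
    coeffDeriv (a - b) = coeffDeriv a - coeffDeriv b := by
  ext n; simp [ratDeriv_sub]

@[simp] theorem coeffDeriv_zero : coeffDeriv (0 : (RatFunc K)[X]) = 0 := by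
  ext n; simp

@[simp] theorem coeffDeriv_C (f : RatFunc K) : coeffDeriv (C f) = C (ratDeriv f) := by
  ext n
  rw [coeff_coeffDeriv, coeff_C, coeff_C]
  split_ifs <;> simp

@[simp] theorem coeffDeriv_X : coeffDeriv (X : (RatFunc K)[X]) = 0 := by
  ext n
  rw [coeff_coeffDeriv, coeff_X]
  split_ifs <;> simp

theorem coeffDeriv_mul (a b : (RatFunc K)[X]) :
    coeffDeriv (a * b) = coeffDeriv a * b + a * coeffDeriv b := by
  ext n
  simp only [coeff_coeffDeriv, coeff_mul, coeff_add, ratDeriv_sum, ratDeriv_mul,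
    Finset.sum_add_distrib]

theorem coeffDeriv_map_C (m : K[X]) : coeffDeriv (m.map RatFunc.C) = 0 := by
  ext n; simp

theorem natDegree_coeffDeriv_le (a : (RatFunc K)[X]) : (coeffDeriv a).natDegree ≤ a.natDegree := by
  rw [natDegree_le_iff_coeff_eq_zero]
  intro n hn
  rw [coeff_coeffDeriv, coeff_eq_zero_of_natDegree_lt hn, ratDeriv_zero]

theorem eval_coeffDeriv (c : K) (a : (RatFunc K)[X]) :
    (coeffDeriv a).eval (RatFunc.C c) = ratDeriv (a.eval (RatFunc.C c)) := by
  rw [eval_eq_sum_range' (Nat.lt_succ_of_le (natDegree_coeffDeriv_le a)),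
    eval_eq_sum_range' (Nat.lt_succ_self a.natDegree), ratDeriv_sum]
  refine Finset.sum_congr rfl fun n _ => ?_
  rw [coeff_coeffDeriv, ratDeriv_mul, ← map_pow, ratDeriv_C, mul_zero, add_zero]

/-- A solution in `K(z)[λ]` of a first-order linear equation over `K(z)` splits as a function of
`z` times a polynomial in `λ`: the ratios of its coefficients have zero derivative. -/
theorem exists_eq_C_mul_map_of_coeffDeriv_eq [CharZero K] {d : (RatFunc K)[X]} {k : RatFunc K}
    (hd : d ≠ 0) (h : coeffDeriv d = C k * d) :
    ∃ m : K[X], d = C d.leadingCoeff * m.map RatFunc.C := by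
  set g := d.leadingCoeff with hg
  have hg0 : g ≠ 0 := leadingCoeff_ne_zero.2 hd
  have hc : ∀ n, ratDeriv (d.coeff n) = k * d.coeff n := fun n => by
    rw [← coeff_coeffDeriv, h, coeff_C_mul]
  have hconst : ∀ n, ∃ c : K, d.coeff n / g = RatFunc.C c := fun n => by
    apply eq_C_of_ratDeriv_eq_zero
    rw [ratDeriv_div' _ hg0, hc, hg, leadingCoeff, hc]
    ring
  choose c hc' using hconst
  refine ⟨∑ n ∈ Finset.range (d.natDegree + 1), monomial n (c n), ?_⟩
  ext n
  rw [coeff_C_mul, coeff_map, finsetSum_coeff]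
  simp only [coeff_monomial, Finset.sum_ite_eq', Finset.mem_range]
  split_ifs with hn
  · rw [← hc', mul_div_cancel₀ _ hg0]
  · rw [map_zero, mul_zero, coeff_eq_zero_of_natDegree_lt (by omega)]

end CoeffDeriv

/-! ### Intertwiners modulo the eigenvalue equation -/

section Intertwiner

variable {K : Type*} [Field K]

/-- The coefficient `α = (λ - r) / p` of `f` in `f'' = α f + β f'`, the equation `T f = λ f`
solved for `f''`. -/
noncomputable def DiffOp2.alpha (T : DiffOp2 K) : (RatFunc K)[X] := C T.p⁻¹ * (X - C T.r)

/-- The coefficient `β = - q / p` of `f'` in `f'' = α f + β f'`. -/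
noncomputable def DiffOp2.beta (T : DiffOp2 K) : RatFunc K := -T.q / T.p

/-- The pair `(a, b)` stands for the operator `a + b D` acting on solutions of `T f = λ f`; its
composition with `D` on the left, reduced modulo that equation, is `T.nabla (a, b)`. -/
noncomputable def DiffOp2.nabla (T : DiffOp2 K) (v : (RatFunc K)[X] × (RatFunc K)[X]) :
    (RatFunc K)[X] × (RatFunc K)[X] :=
  (coeffDeriv v.1 + v.2 * T.alpha, v.1 + coeffDeriv v.2 + C T.beta * v.2)

/-- The operator `a + b D`, polynomial in `λ`, maps solutions of `T₀ f = λ f` to solutions of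
`T g = λ g`: the reduction of `(T - λ) (a + b D)` modulo `T₀ - λ` vanishes. -/
def Intertwines (T₀ T : DiffOp2 K) (v : (RatFunc K)[X] × (RatFunc K)[X]) : Prop :=
  C T.p * (T₀.nabla (T₀.nabla v)).1 + C T.q * (T₀.nabla v).1 + (C T.r - X) * v.1 = 0 ∧
  C T.p * (T₀.nabla (T₀.nabla v)).2 + C T.q * (T₀.nabla v).2 + (C T.r - X) * v.2 = 0

/-- The determinant of the linear map `(f, f') ↦ (g, g')`, `g = a f + b f'`. -/
noncomputable def DiffOp2.wronskian (T : DiffOp2 K) (v : (RatFunc K)[X] × (RatFunc K)[X]) :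
    (RatFunc K)[X] :=
  v.1 * (T.nabla v).2 - v.2 * (T.nabla v).1

/-- Abel's identity: Wronskians of solutions of either equation satisfy a first-order equation, so
the determinant relating them does too. -/
theorem Intertwines.coeffDeriv_wronskian {T₀ T : DiffOp2 K} (hp : T.p = T₀.p)
    {v : (RatFunc K)[X] × (RatFunc K)[X]} (h : Intertwines T₀ T v) :
    coeffDeriv (T₀.wronskian v) = C ((T₀.q - T.q) / T₀.p) * T₀.wronskian v := by
  obtain ⟨h1, h2⟩ := h
  have hp0 : (C T₀.p : (RatFunc K)[X]) ≠ 0 := C_ne_zero.2 T₀.p_ne_zero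
  have hb : (C T₀.p : (RatFunc K)[X]) * C T₀.beta = - C T₀.q := by
    rw [← C_mul, ← C_neg]; congr 1; rw [DiffOp2.beta]; field_simp [T₀.p_ne_zero]
  have hk : (C T₀.p : (RatFunc K)[X]) * C ((T₀.q - T.q) / T₀.p) = C T₀.q - C T.q := by
    rw [← C_mul, ← C_sub]; congr 1; field_simp [T₀.p_ne_zero]
  rw [hp] at h1 h2
  set w := T₀.nabla v with hw
  have e1 : (T₀.nabla w).1 = coeffDeriv w.1 + w.2 * T₀.alpha := rfl
  have e2 : (T₀.nabla w).2 = w.1 + coeffDeriv w.2 + C T₀.beta * w.2 := rfl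
  have f1 : coeffDeriv v.1 = w.1 - v.2 * T₀.alpha := by rw [hw, DiffOp2.nabla]; ring
  have f2 : coeffDeriv v.2 = w.2 - v.1 - C T₀.beta * v.2 := by rw [hw, DiffOp2.nabla]; ring
  rw [DiffOp2.wronskian, ← hw, coeffDeriv_sub, coeffDeriv_mul, coeffDeriv_mul, f1, f2]
  rw [e1] at h1
  rw [e2] at h2
  apply mul_left_cancel₀ hp0
  linear_combination v.1 * h2 - v.2 * h1 - (v.1 * w.2 - v.2 * w.1) * hb
    - (v.1 * w.2 - v.2 * w.1) * hk

theorem DiffOp2.wronskian_eq (T : DiffOp2 K) (v : (RatFunc K)[X] × (RatFunc K)[X]) :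
    T.wronskian v = v.1 ^ 2 + v.1 * coeffDeriv v.2 - v.2 * coeffDeriv v.1
      + C T.beta * (v.1 * v.2) - C T.p⁻¹ * (v.2 ^ 2 * (X - C T.r)) := by
  rw [DiffOp2.wronskian, DiffOp2.nabla, DiffOp2.alpha]; ring

/-- In `λ`, the determinant has the degree one expects from its terms `a²` and `-b² λ / p`, which
cannot cancel since their degrees differ in parity. -/
theorem DiffOp2.one_le_natDegree_wronskian (T : DiffOp2 K)
    {v : (RatFunc K)[X] × (RatFunc K)[X]} (h : v.2 ≠ 0 ∨ v.1.natDegree ≠ 0) :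
    1 ≤ (T.wronskian v).natDegree := by
  obtain ⟨a, b⟩ := v
  have ha' := natDegree_coeffDeriv_le a
  have hb' := natDegree_coeffDeriv_le b
  rw [DiffOp2.wronskian_eq]
  simp only at h ⊢
  have hlin : (X - C T.r : (RatFunc K)[X]).natDegree = 1 := natDegree_X_sub_C _
  rcases lt_or_ge b.natDegree a.natDegree with hlt | hge
  · have hc : (a ^ 2 + a * coeffDeriv b - b * coeffDeriv a + C T.beta * (a * b)
        - C T.p⁻¹ * (b ^ 2 * (X - C T.r))).coeff (a.natDegree + a.natDegree)
        = a.leadingCoeff * a.leadingCoeff := by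
      have z1 : (a * coeffDeriv b).coeff (a.natDegree + a.natDegree) = 0 :=
        coeff_eq_zero_of_natDegree_lt (natDegree_mul_le.trans_lt (by omega))
      have z2 : (b * coeffDeriv a).coeff (a.natDegree + a.natDegree) = 0 :=
        coeff_eq_zero_of_natDegree_lt (natDegree_mul_le.trans_lt (by omega))
      have z3 : (a * b).coeff (a.natDegree + a.natDegree) = 0 :=
        coeff_eq_zero_of_natDegree_lt (natDegree_mul_le.trans_lt (by omega))
      have z4 : (b ^ 2 * (X - C T.r)).coeff (a.natDegree + a.natDegree) = 0 := by
        refine coeff_eq_zero_of_natDegree_lt (natDegree_mul_le.trans_lt ?_)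
        have := natDegree_pow_le (p := b) (n := 2)
        omega
      simp only [coeff_add, coeff_sub, coeff_C_mul, z1, z2, z3, z4, pow_two a, leadingCoeff]
      rw [coeff_mul_add_eq_of_natDegree_le le_rfl le_rfl]
      ring
    have ha0 : a ≠ 0 := by rintro rfl; simp at hlt
    have := le_natDegree_of_ne_zero (hc ▸ mul_ne_zero (leadingCoeff_ne_zero.2 ha0)
      (leadingCoeff_ne_zero.2 ha0))
    omega
  · have hb0 : b ≠ 0 := by
      rcases h with h | h
      · exact h
      · rintro rfl; simp at hge; exact h hge
    have hc : (a ^ 2 + a * coeffDeriv b - b * coeffDeriv a + C T.beta * (a * b)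
        - C T.p⁻¹ * (b ^ 2 * (X - C T.r))).coeff (b.natDegree + b.natDegree + 1)
        = -(T.p⁻¹ * (b.leadingCoeff * b.leadingCoeff)) := by
      have z0 : (a ^ 2).coeff (b.natDegree + b.natDegree + 1) = 0 := by
        refine coeff_eq_zero_of_natDegree_lt ?_
        have := natDegree_pow_le (p := a) (n := 2)
        omega
      have z1 : (a * coeffDeriv b).coeff (b.natDegree + b.natDegree + 1) = 0 :=
        coeff_eq_zero_of_natDegree_lt (natDegree_mul_le.trans_lt (by omega))
      have z2 : (b * coeffDeriv a).coeff (b.natDegree + b.natDegree + 1) = 0 :=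
        coeff_eq_zero_of_natDegree_lt (natDegree_mul_le.trans_lt (by omega))
      have z3 : (a * b).coeff (b.natDegree + b.natDegree + 1) = 0 :=
        coeff_eq_zero_of_natDegree_lt (natDegree_mul_le.trans_lt (by omega))
      simp only [coeff_add, coeff_sub, coeff_C_mul, z0, z1, z2, z3, pow_two b]
      rw [coeff_mul_add_eq_of_natDegree_le natDegree_mul_le hlin.le,
        coeff_mul_add_eq_of_natDegree_le le_rfl le_rfl]
      simp
    have := le_natDegree_of_ne_zero (hc ▸ neg_ne_zero.2 (mul_ne_zero (inv_ne_zero T.p_ne_zero)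
      (mul_ne_zero (leadingCoeff_ne_zero.2 hb0) (leadingCoeff_ne_zero.2 hb0))))
    omega

end Intertwiner

/-! ### Factorizations and gauge transformations -/

section Factor

variable {K : Type*} [Field K]

/-- The operator `A B + l`. -/
noncomputable def DiffOp1.comp (A B : DiffOp1 K) (l : K) : DiffOp2 K where
  p := A.a * B.a
  q := A.a * ratDeriv B.a + A.a * B.b + A.b * B.a
  r := A.a * ratDeriv B.b + A.b * B.b + RatFunc.C l
  p_ne_zero := mul_ne_zero A.a_ne_zero B.a_ne_zero

theorem DiffOp1.apply_comp (A B : DiffOp1 K) (l : K) (f : RatFunc K) :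
    (A.comp B l).apply f = A.apply (B.apply f) + RatFunc.C l * f := by
  simp only [DiffOp2.apply, DiffOp1.apply, DiffOp1.comp, ratDeriv_add, ratDeriv_mul]
  ring

/-- `T - l` is a product of two first-order operators with rational coefficients, for some `l`. -/
def DiffOp2.Factorable (T : DiffOp2 K) : Prop :=
  ∃ (A B : DiffOp1 K) (l : K), ∀ f, T.apply f = B.apply (A.apply f) + RatFunc.C l * f

theorem isRationalDarboux_comp {T : DiffOp2 ℂ} {A B : DiffOp1 ℂ} {l : ℂ}
    (h : ∀ f, T.apply f = B.apply (A.apply f) + RatFunc.C l * f) :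
    IsRationalDarboux T (A.comp B l) :=
  ⟨A, B, l, h, fun f => A.apply_comp B l f⟩

theorem DiffOp1.factorable_comp (A B : DiffOp1 K) (l : K) : (A.comp B l).Factorable :=
  ⟨B, A, l, fun f => A.apply_comp B l f⟩

/-- Conjugation by a rational function is a composition of two rational Darboux transformations as
soon as the operator has a rational factorization: `B A ↦ A B = (A g⁻¹)(g B) ↦ g B A g⁻¹`. -/
theorem factorizationChain_of_gauge {T₀ T : DiffOp2 ℂ} (hT₀ : T₀.Factorable) {g : RatFunc ℂ}
    (hg : g ≠ 0) (h : ∀ f, T.apply f = g * T₀.apply (g⁻¹ * f)) : FactorizationChain T₀ T := by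
  obtain ⟨A, B, l, hAB⟩ := hT₀
  refine (Relation.ReflTransGen.single (isRationalDarboux_comp hAB)).tail ?_
  refine ⟨⟨g * B.a, g * B.b, mul_ne_zero hg B.a_ne_zero⟩,
    ⟨A.a * g⁻¹, A.a * ratDeriv g⁻¹ + A.b * g⁻¹, mul_ne_zero A.a_ne_zero (inv_ne_zero hg)⟩, l,
    fun f => ?_, fun f => ?_⟩
  · rw [DiffOp1.apply_comp]
    have : ∀ f, DiffOp1.apply ⟨A.a * g⁻¹, A.a * ratDeriv g⁻¹ + A.b * g⁻¹,
        mul_ne_zero A.a_ne_zero (inv_ne_zero hg)⟩ f = A.apply (g⁻¹ * f) := fun f => by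
      simp only [DiffOp1.apply, ratDeriv_mul]; ring
    rw [this]
    congr 2
    simp only [DiffOp1.apply]
    field_simp
  · rw [h, hAB]
    have : DiffOp1.apply ⟨A.a * g⁻¹, A.a * ratDeriv g⁻¹ + A.b * g⁻¹,
        mul_ne_zero A.a_ne_zero (inv_ne_zero hg)⟩ f = A.apply (g⁻¹ * f) := by
      simp only [DiffOp1.apply, ratDeriv_mul]; ring
    rw [this]
    simp only [DiffOp1.apply]
    field_simp

end Factor

/-! ### Reduction of an intertwiner to Darboux transformations -/

section Reduction

variable {K : Type*} [Field K]

/-- If `p (u' + u²) + q u + r = l`, then `T - l = (p D + q + p u) (D - u)`. -/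
theorem DiffOp2.apply_eq_of_riccati (T : DiffOp2 K) {u : RatFunc K} {l : K}
    (h : T.p * (ratDeriv u + u ^ 2) + T.q * u + T.r = RatFunc.C l) (f : RatFunc K) :
    T.apply f = DiffOp1.apply ⟨T.p, T.q + T.p * u, T.p_ne_zero⟩
      (DiffOp1.apply ⟨1, -u, one_ne_zero⟩ f) + RatFunc.C l * f := by
  simp only [DiffOp2.apply, DiffOp1.apply, ratDeriv_add, ratDeriv_mul, ratDeriv_one, ratDeriv_neg]
  rw [← h]
  ring

/-- An intertwiner from `T₀` that factors through `D - u` induces an intertwiner from the Darboux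
transform of `T₀`. -/
theorem Intertwines.darboux {T₀ T : DiffOp2 K} {a b c : (RatFunc K)[X]} {u : RatFunc K} {l : K}
    (hu : T₀.p * (ratDeriv u + u ^ 2) + T₀.q * u + T₀.r = RatFunc.C l)
    (hc : (X - C (RatFunc.C l)) * c = a + C u * b) (h : Intertwines T₀ T (a, b)) :
    Intertwines (DiffOp1.comp ⟨1, -u, one_ne_zero⟩ ⟨T₀.p, T₀.q + T₀.p * u, T₀.p_ne_zero⟩ l) T
      (b + c * C (T₀.q + T₀.p * u), c * C T₀.p) := by
  set T₁ := DiffOp1.comp ⟨1, -u, one_ne_zero⟩ ⟨T₀.p, T₀.q + T₀.p * u, T₀.p_ne_zero⟩ l with hT₁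
  have hp0 : (C T₀.p : (RatFunc K)[X]) ≠ 0 := C_ne_zero.2 T₀.p_ne_zero
  -- the matrix taking `(f, f')` to `(g, g')`, `g = f' - u f`
  let G : (RatFunc K)[X] × (RatFunc K)[X] → (RatFunc K)[X] × (RatFunc K)[X] := fun w =>
    (-(C u) * w.1 + (T₀.alpha - C (ratDeriv u)) * w.2, w.1 + (C T₀.beta - C u) * w.2)
  have hal : C T₀.p * T₀.alpha = X - C T₀.r := by
    rw [DiffOp2.alpha, ← mul_assoc, ← C_mul, mul_inv_cancel₀ T₀.p_ne_zero, C_1, one_mul]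
  have hbe : (C T₀.p : (RatFunc K)[X]) * C T₀.beta = - C T₀.q := by
    rw [← C_mul, ← C_neg]; congr 1; rw [DiffOp2.beta]; field_simp [T₀.p_ne_zero]
  have hu' : (C T₀.p : (RatFunc K)[X]) * (C (ratDeriv u) + C u ^ 2) + C T₀.q * C u + C T₀.r
      = C (RatFunc.C l) := by
    rw [← hu]; simp only [map_add, map_mul, map_pow]
  have hal1 : C T₀.p * T₁.alpha = X - C T₁.r := by
    have hp1 : T₁.p = T₀.p := by simp [hT₁, DiffOp1.comp]
    rw [DiffOp2.alpha, hp1, ← mul_assoc, ← C_mul, mul_inv_cancel₀ T₀.p_ne_zero, C_1, one_mul]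
  have hbe1 : (C T₀.p : (RatFunc K)[X]) * C T₁.beta = - C T₀.q - C (ratDeriv T₀.p) := by
    have hp1 : T₁.p = T₀.p := by simp [hT₁, DiffOp1.comp]
    have hq1 : T₁.q = T₀.q + ratDeriv T₀.p := by simp [hT₁, DiffOp1.comp]; ring
    rw [← C_mul, ← C_neg, ← C_sub]; congr 1
    rw [DiffOp2.beta, hp1, hq1]; field_simp [T₀.p_ne_zero]; ring
  have hr1 : (C T₁.r : (RatFunc K)[X]) = C (ratDeriv T₀.q) + C (ratDeriv T₀.p) * C u
      + C T₀.p * C (ratDeriv u) - C u * (C T₀.q + C T₀.p * C u) + C (RatFunc.C l) := by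
    simp only [hT₁, DiffOp1.comp, ratDeriv_add, ratDeriv_mul, map_add, map_mul, map_neg, map_one]
    ring
  have hald : C T₀.p * coeffDeriv T₀.alpha = - C (ratDeriv T₀.r)
      - C (ratDeriv T₀.p) * T₀.alpha := by
    have := congrArg coeffDeriv hal
    rw [coeffDeriv_mul, coeffDeriv_sub] at this
    simp only [coeffDeriv_C, coeffDeriv_X] at this
    linear_combination this
  have hbed : (C T₀.p : (RatFunc K)[X]) * C (ratDeriv T₀.beta) = - C (ratDeriv T₀.q)
      - C (ratDeriv T₀.p) * C T₀.beta := by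
    have := congrArg coeffDeriv hbe
    rw [coeffDeriv_mul] at this
    simp only [coeffDeriv_C, ← C_neg, ratDeriv_neg] at this
    rw [C_neg] at this
    linear_combination this
  have hud : C (ratDeriv T₀.p) * (C (ratDeriv u) + C u ^ 2) + C T₀.p * (C (ratDeriv (ratDeriv u))
      + 2 * C u * C (ratDeriv u)) + C (ratDeriv T₀.q) * C u + C T₀.q * C (ratDeriv u)
      + C (ratDeriv T₀.r) = 0 := by
    have := congrArg coeffDeriv hu'
    simp only [coeffDeriv_add, coeffDeriv_mul, coeffDeriv_C, pow_two, ratDeriv_C, C_0] at this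
    linear_combination this
  have hG : ∀ w, T₀.nabla (G w) = G (T₁.nabla w) := by
    intro w
    apply Prod.ext
    · simp only [DiffOp2.nabla, G, coeffDeriv_add, coeffDeriv_mul, coeffDeriv_sub, coeffDeriv_C,
        ← C_neg, ratDeriv_neg]
      rw [C_neg, C_neg]
      apply mul_left_cancel₀ hp0
      linear_combination w.2 * (hald + T₀.alpha * hbe - C u * hal + C u * hal1
        - (T₀.alpha - C (ratDeriv u)) * hbe1 - C u * hr1 + C u * hu' - hud)
    · simp only [DiffOp2.nabla, G, coeffDeriv_add, coeffDeriv_mul, coeffDeriv_sub, coeffDeriv_C]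
      apply mul_left_cancel₀ hp0
      linear_combination w.2 * (hal + hbed + (C T₀.beta - C u) * hbe - hal1
        - (C T₀.beta - C u) * hbe1 + hr1 - hu')
  have hv : G (b + c * C (T₀.q + T₀.p * u), c * C T₀.p) = (a, b) := by
    apply Prod.ext
    · simp only [G, map_add, map_mul]
      linear_combination c * hal - c * hu' + hc
    · simp only [G, map_add, map_mul]
      linear_combination c * hbe
  have hinj : ∀ w, G w = 0 → w = 0 := by
    intro w hw
    have w1 : -(C u) * w.1 + (T₀.alpha - C (ratDeriv u)) * w.2 = 0 := congrArg Prod.fst hw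
    have w2 : w.1 + (C T₀.beta - C u) * w.2 = 0 := congrArg Prod.snd hw
    have : (X - C (RatFunc.C l)) * w.2 = 0 := by
      linear_combination C T₀.p * w1 + C T₀.p * C u * w2 - w.2 * hal - w.2 * C u * hbe
        + w.2 * hu'
    have w3 : w.2 = 0 := (mul_eq_zero.1 this).resolve_left (X_sub_C_ne_zero _)
    rw [w3, mul_zero, add_zero] at w2
    exact Prod.ext w2 w3
  set v₁ : (RatFunc K)[X] × (RatFunc K)[X] := (b + c * C (T₀.q + T₀.p * u), c * C T₀.p)
  have key : G (C T.p * (T₁.nabla (T₁.nabla v₁)).1 + C T.q * (T₁.nabla v₁).1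
        + (C T.r - X) * v₁.1,
      C T.p * (T₁.nabla (T₁.nabla v₁)).2 + C T.q * (T₁.nabla v₁).2 + (C T.r - X) * v₁.2) = 0 := by
    obtain ⟨h1, h2⟩ := h
    rw [← hv, hG, hG] at h1 h2
    apply Prod.ext
    · simp only [G, Prod.fst_zero] at h1 ⊢
      linear_combination h1
    · simp only [G, Prod.snd_zero] at h2 ⊢
      linear_combination h2
  have := hinj _ key
  exact ⟨congrArg Prod.fst this, congrArg Prod.snd this⟩

end Reduction

section Chain

/-- A factor depending on `λ` only can be cancelled from an intertwiner. -/
theorem Intertwines.of_mul {K : Type*} [Field K] {T₀ T : DiffOp2 K} {a b : (RatFunc K)[X]} {c : K}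
    (h : Intertwines T₀ T ((X - C (RatFunc.C c)) * a, (X - C (RatFunc.C c)) * b)) :
    Intertwines T₀ T (a, b) := by
  have hd : coeffDeriv (X - C (RatFunc.C c)) = 0 := by simp [coeffDeriv_sub]
  have hn : ∀ v : (RatFunc K)[X] × (RatFunc K)[X],
      T₀.nabla ((X - C (RatFunc.C c)) * v.1, (X - C (RatFunc.C c)) * v.2)
        = ((X - C (RatFunc.C c)) * (T₀.nabla v).1, (X - C (RatFunc.C c)) * (T₀.nabla v).2) := by
    intro v
    apply Prod.ext
    · simp only [DiffOp2.nabla, coeffDeriv_mul, hd]; ring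
    · simp only [DiffOp2.nabla, coeffDeriv_mul, hd]; ring
  have hX : (X - C (RatFunc.C c) : (RatFunc K)[X]) ≠ 0 := X_sub_C_ne_zero _
  obtain ⟨h1, h2⟩ := h
  rw [hn (a, b), hn] at h1 h2
  constructor
  · apply mul_left_cancel₀ hX
    simp only at h1 ⊢
    linear_combination h1
  · apply mul_left_cancel₀ hX
    simp only at h2 ⊢
    linear_combination h2

/-- An intertwiner independent of `λ` and without `D` part is a gauge transformation. -/
theorem Intertwines.apply_eq_of_C {K : Type*} [Field K] {T₀ T : DiffOp2 K} (hp : T.p = T₀.p)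
    {g : RatFunc K} (hg : g ≠ 0) (h : Intertwines T₀ T (C g, 0)) (f : RatFunc K) :
    T.apply f = g * T₀.apply (g⁻¹ * f) := by
  obtain ⟨h1, h2⟩ := h
  have hal : C T₀.p * T₀.alpha = X - C T₀.r := by
    rw [DiffOp2.alpha, ← mul_assoc, ← C_mul, mul_inv_cancel₀ T₀.p_ne_zero, C_1, one_mul]
  have hbe : T₀.p * T₀.beta = - T₀.q := by
    rw [DiffOp2.beta]; field_simp [T₀.p_ne_zero]
  have n1 : T₀.nabla (C g, 0) = (C (ratDeriv g), C g) := by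
    apply Prod.ext <;> simp [DiffOp2.nabla]
  have n2 : T₀.nabla (C (ratDeriv g), C g) = (C (ratDeriv (ratDeriv g)) + C g * T₀.alpha,
      C (ratDeriv g + ratDeriv g + T₀.beta * g)) := by
    apply Prod.ext <;> simp [DiffOp2.nabla]
  rw [n1, n2, hp] at h1 h2
  simp only at h1 h2
  have k2 : T₀.p * (ratDeriv g + ratDeriv g + T₀.beta * g) + T.q * g = 0 := by
    apply C_injective
    rw [C_0, ← h2]
    simp only [map_add, map_mul]; ring
  have k1 : T₀.p * ratDeriv (ratDeriv g) + T.q * ratDeriv g + (T.r - T₀.r) * g = 0 := by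
    apply C_injective
    rw [C_0, ← h1]
    simp only [map_add, map_mul, map_sub]
    linear_combination -C g * hal
  obtain ⟨e, rfl⟩ : ∃ e, f = g * e := ⟨g⁻¹ * f, by field_simp⟩
  rw [inv_mul_cancel_left₀ hg]
  simp only [DiffOp2.apply, ratDeriv_mul, ratDeriv_add, hp]
  linear_combination e * k1 + ratDeriv e * k2 - g * ratDeriv e * hbe

/-- A nonzero intertwiner decomposes into rational Darboux transformations. A root of its
determinant is a value of `λ` at which `a + b D` either vanishes or shares a right factor `D - u`
with `T₀ - λ`; dividing by `X - λ`, respectively passing to the Darboux transform of `T₀` with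
factor `D - u`, lowers the degree of the determinant. -/
theorem Intertwines.factorizationChain {T : DiffOp2 ℂ} (n : ℕ) :
    ∀ (T₀ : DiffOp2 ℂ) (a b : (RatFunc ℂ)[X]), T₀.Factorable → T.p = T₀.p →
      Intertwines T₀ T (a, b) → (a ≠ 0 ∨ b ≠ 0) → 2 * a.natDegree ≤ n →
      (b = 0 ∨ 2 * b.natDegree + 1 ≤ n) → FactorizationChain T₀ T := by
  induction n with
  | zero =>
    intro T₀ a b hF hp h h0 ha hb
    have hb0 : b = 0 := hb.resolve_right (by omega)
    subst hb0
    have ha0 : a.natDegree = 0 := by omega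
    rw [eq_C_of_natDegree_eq_zero ha0] at h h0
    have hg : a.coeff 0 ≠ 0 := by
      rintro h; rw [h] at h0; simp at h0
    exact factorizationChain_of_gauge hF hg (h.apply_eq_of_C hp hg)
  | succ n ih =>
    intro T₀ a b hF hp h h0 ha hb
    by_cases hbase : b = 0 ∧ a.natDegree = 0
    · exact ih T₀ a b hF hp h h0 (by omega) (Or.inl hbase.1)
    have hdeg := T₀.one_le_natDegree_wronskian (v := (a, b)) (by tauto)
    obtain ⟨m, hm⟩ := exists_eq_C_mul_map_of_coeffDeriv_eq
      (by rintro h; rw [h] at hdeg; simp at hdeg) (h.coeffDeriv_wronskian hp)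
    have hmdeg : m.degree ≠ 0 := by
      intro hm0
      rw [hm, eq_C_of_degree_eq_zero hm0, Polynomial.map_C, ← C_mul, natDegree_C] at hdeg
      omega
    obtain ⟨l, hl⟩ := IsAlgClosed.exists_root m hmdeg
    have hev : (T₀.wronskian (a, b)).eval (RatFunc.C l) = 0 := by
      rw [hm, eval_mul, eval_map_apply, hl.eq_zero, map_zero, mul_zero]
    rw [T₀.wronskian_eq] at hev
    simp only [eval_add, eval_sub, eval_mul, eval_pow, eval_C, eval_X, eval_coeffDeriv] at hev
    set a₀ := a.eval (RatFunc.C l) with ha₀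
    set b₀ := b.eval (RatFunc.C l) with hb₀
    by_cases hb0 : b₀ = 0
    · have ha0 : a₀ = 0 := by
        rw [hb0] at hev
        simpa using hev
      obtain ⟨a', rfl⟩ := dvd_iff_isRoot.2 (show a.IsRoot (RatFunc.C l) from ha0)
      obtain ⟨b', rfl⟩ := dvd_iff_isRoot.2 (show b.IsRoot (RatFunc.C l) from hb0)
      refine ih T₀ a' b' hF hp h.of_mul ?_ ?_ ?_
      · rcases h0 with h | h
        · exact Or.inl (right_ne_zero_of_mul h)
        · exact Or.inr (right_ne_zero_of_mul h)
      · by_cases ha' : a' = 0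
        · simp [ha']
        · rw [natDegree_mul (X_sub_C_ne_zero _) ha', natDegree_X_sub_C] at ha
          omega
      · by_cases hb' : b' = 0
        · exact Or.inl hb'
        · rw [natDegree_mul (X_sub_C_ne_zero _) hb', natDegree_X_sub_C] at hb
          right
          have := hb.resolve_left (mul_ne_zero (X_sub_C_ne_zero _) hb')
          omega
    · -- the vanishing determinant is the Riccati equation for `u = -a / b` at `λ = l`
      have hp0 := T₀.p_ne_zero
      have hbne : b ≠ 0 := by
        rintro rfl; simp [hb₀] at hb0
      have hbn : 2 * b.natDegree + 1 ≤ n + 1 := hb.resolve_left hbne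
      set u := -a₀ / b₀ with hu
      have hric : T₀.p * (ratDeriv u + u ^ 2) + T₀.q * u + T₀.r = RatFunc.C l := by
        rw [hu, ratDeriv_div' _ hb0, ratDeriv_neg]
        rw [DiffOp2.beta] at hev
        field_simp at hev ⊢
        linear_combination hev
      have hroot : (a + C u * b).IsRoot (RatFunc.C l) := by
        rw [IsRoot.def, eval_add, eval_mul, eval_C, ← ha₀, ← hb₀, hu]
        field_simp
        ring
      obtain ⟨c, hc⟩ := dvd_iff_isRoot.2 hroot
      have hstep : IsRationalDarboux T₀ _ :=
        isRationalDarboux_comp (T₀.apply_eq_of_riccati hric)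
      refine Relation.ReflTransGen.head hstep
        (ih _ _ _ (DiffOp1.factorable_comp _ _ _) ?_ (h.darboux hric hc.symm) ?_ ?_ ?_)
      · rw [hp]; simp [DiffOp1.comp]
      · by_cases hc0 : c = 0
        · left; simpa [hc0] using hbne
        · right; exact mul_ne_zero hc0 (C_ne_zero.2 hp0)
      all_goals
        have hcdeg : c = 0 ∨ 2 * c.natDegree + 1 ≤ n := by
          by_cases hc0 : c = 0
          · exact Or.inl hc0
          right
          have e1 := congrArg natDegree hc
          rw [natDegree_mul (X_sub_C_ne_zero _) hc0, natDegree_X_sub_C] at e1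
          have e2 := natDegree_add_le a (C u * b)
          have e3 := natDegree_C_mul_le u b
          omega
      · have e1 := natDegree_add_le b (c * C (T₀.q + T₀.p * u))
        have e2 := natDegree_mul_C_le c (T₀.q + T₀.p * u)
        rcases hcdeg with rfl | hcd
        · simp only [zero_mul, add_zero]; omega
        · omega
      · rcases hcdeg with rfl | hcd
        · left; simp
        · right
          have e2 := natDegree_mul_C_le c T₀.p
          omega

end Chain

/-! ### Polynomial differential operators -/

section PolyOp

variable {K : Type*} [Field K]

/-- The operator `P D² + Q D + R` with polynomial coefficients. -/
noncomputable def polyOp (P Q R : K[X]) : K[X] →ₗ[K] K[X] :=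
  LinearMap.mulLeft K P ∘ₗ derivative ∘ₗ derivative + LinearMap.mulLeft K Q ∘ₗ derivative
    + LinearMap.mulLeft K R

theorem polyOp_apply (P Q R y : K[X]) :
    polyOp P Q R y = P * derivative (derivative y) + Q * derivative y + R * y := rfl

theorem coeff_X_mul_derivative (y : K[X]) (k : ℕ) :
    (X * derivative y).coeff k = k * y.coeff k := by
  cases k with
  | zero => simp
  | succ k => rw [coeff_X_mul, coeff_derivative]; push_cast; ring

theorem coeff_X_sq_mul_derivative₂ (y : K[X]) (k : ℕ) :
    (X ^ 2 * derivative (derivative y)).coeff k = k * (k - 1) * y.coeff k := by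
  have : X ^ 2 * derivative (derivative y) = X * derivative (X * derivative y)
      - X * derivative y := by
    simp only [derivative_mul, derivative_X]; ring
  rw [this, coeff_sub, coeff_X_mul_derivative, coeff_X_mul_derivative]
  ring

theorem natDegree_X_mul_derivative_le (y : K[X]) : (X * derivative y).natDegree ≤ y.natDegree := by
  rw [natDegree_le_iff_coeff_eq_zero]
  intro n hn
  rw [coeff_X_mul_derivative, coeff_eq_zero_of_natDegree_lt hn, mul_zero]

theorem natDegree_X_sq_mul_derivative₂_le (y : K[X]) :
    (X ^ 2 * derivative (derivative y)).natDegree ≤ y.natDegree := by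
  rw [natDegree_le_iff_coeff_eq_zero]
  intro n hn
  rw [coeff_X_sq_mul_derivative₂, coeff_eq_zero_of_natDegree_lt hn, mul_zero]

/-- The top coefficient of `P y'' + Q y' + R y`. -/
theorem coeff_polyOp {P Q R y : K[X]} {m k : ℕ} (hP : P.natDegree ≤ m + 2)
    (hQ : Q.natDegree ≤ m + 1) (hR : R.natDegree ≤ m) (hy : y.natDegree ≤ k) :
    (polyOp P Q R y).coeff (m + k)
      = (P.coeff (m + 2) * (k * (k - 1)) + Q.coeff (m + 1) * k + R.coeff m) * y.coeff k := by
  have h2 : (P * derivative (derivative y)).coeff (m + k)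
      = P.coeff (m + 2) * (k * (k - 1) * y.coeff k) := by
    rw [← coeff_X_sq_mul_derivative₂, ← coeff_mul_add_eq_of_natDegree_le hP
      ((natDegree_X_sq_mul_derivative₂_le y).trans hy)]
    rw [show P * (X ^ 2 * derivative (derivative y)) = P * derivative (derivative y) * X ^ 2 by ring,
      show m + 2 + k = m + k + 2 by ring, coeff_mul_X_pow]
  have h1 : (Q * derivative y).coeff (m + k) = Q.coeff (m + 1) * (k * y.coeff k) := by
    rw [← coeff_X_mul_derivative, ← coeff_mul_add_eq_of_natDegree_le hQ
      ((natDegree_X_mul_derivative_le y).trans hy)]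
    rw [show Q * (X * derivative y) = Q * derivative y * X by ring,
      show m + 1 + k = m + k + 1 by ring, coeff_mul_X]
  have h0 := coeff_mul_add_eq_of_natDegree_le hR hy
  rw [polyOp_apply, coeff_add, coeff_add, h2, h1, h0]
  ring

theorem natDegree_polyOp_le {P Q R y : K[X]} {m k : ℕ} (hP : P.natDegree ≤ m + 2)
    (hQ : Q.natDegree ≤ m + 1) (hR : R.natDegree ≤ m) (hy : y.natDegree ≤ k) :
    (polyOp P Q R y).natDegree ≤ m + k := by
  rw [natDegree_le_iff_coeff_eq_zero]
  intro n hn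
  obtain ⟨j, rfl⟩ : ∃ j, n = m + j := ⟨n - m, by omega⟩
  rw [coeff_polyOp hP hQ hR (k := j) (by omega),
    coeff_eq_zero_of_natDegree_lt (p := y) (by omega), mul_zero]

/-! ### Subspaces of finite codimension -/

/-- The multiples of `g`, as a subspace. -/
noncomputable def multiples (g : K[X]) : Submodule K K[X] := LinearMap.range (LinearMap.mulLeft K g)

/-- The images of the spaces `g^m K[X]` in the finite-dimensional quotient decrease, so they are
eventually constant. -/
theorem exists_sup_multiples_pow_eq (V : Submodule K K[X]) [FiniteDimensional K (K[X] ⧸ V)]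
    (g : K[X]) : ∃ m₀, ∀ m ≥ m₀, V ⊔ multiples (g ^ m) = V ⊔ multiples (g ^ m₀) := by
  have hanti : Antitone fun m : ℕ => (multiples (g ^ m)).map V.mkQ := by
    intro m n hmn
    apply Submodule.map_mono
    rintro f ⟨w, rfl⟩
    exact ⟨g ^ (n - m) * w, by
      simp only [LinearMap.mulLeft_apply, ← mul_assoc, ← pow_add, Nat.add_sub_cancel' hmn]⟩
  obtain ⟨m₀, h⟩ := IsArtinian.monotone_stabilizes
    (⟨fun m => OrderDual.toDual ((multiples (g ^ m)).map V.mkQ), fun m n hmn => hanti hmn⟩ :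
      ℕ →o (Submodule K (K[X] ⧸ V))ᵒᵈ)
  refine ⟨m₀, fun m hm => ?_⟩
  have h' : (multiples (g ^ m₀)).map V.mkQ = (multiples (g ^ m)).map V.mkQ :=
    congrArg OrderDual.ofDual (h m hm)
  rw [← Submodule.comap_map_mkQ, ← Submodule.comap_map_mkQ, h']

/-- Together with the polynomials of degree below a bound for `E`, the `y k` span everything. -/
theorem finiteDimensional_quotient_span {y : ℕ → K[X]} {E : Finset ℕ}
    (hy : ∀ k ∉ E, (y k).degree = k) :
    FiniteDimensional K (K[X] ⧸ Submodule.span K {v : K[X] | ∃ k ∉ E, v = y k}) := by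
  set V := Submodule.span K {v : K[X] | ∃ k ∉ E, v = y k} with hV
  obtain ⟨M, hM⟩ : ∃ M, ∀ k ∈ E, k < M :=
    ⟨E.sup id + 1, fun k hk => Nat.lt_succ_of_le (Finset.le_sup (f := id) hk)⟩
  have htop : ∀ n, ∀ f : K[X], f.natDegree < n → f ∈ V ⊔ degreeLT K M := by
    intro n
    induction n with
    | zero => intro f hf; omega
    | succ n ih =>
      intro f hf
      by_cases hlt : f.natDegree < M
      · exact Submodule.mem_sup_right (mem_degreeLT.2 (degree_le_natDegree.trans_lt
          (by exact_mod_cast hlt)))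
      have hk : f.natDegree ∉ E := fun h => hlt (hM _ h)
      have hd := hy _ hk
      have hyV : y f.natDegree ∈ V := Submodule.subset_span ⟨_, hk, rfl⟩
      have hy0 : (y f.natDegree).coeff f.natDegree ≠ 0 := by
        have h0 : y f.natDegree ≠ 0 := by rintro h0; rw [h0] at hd; simp at hd
        have h1 := leadingCoeff_ne_zero.2 h0
        rwa [leadingCoeff, natDegree_eq_of_degree_eq_some hd] at h1
      set c := f.coeff f.natDegree / (y f.natDegree).coeff f.natDegree with hc
      have hsub : f - c • y f.natDegree ∈ V ⊔ degreeLT K M := by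
        by_cases hf0 : f.natDegree = 0
        · have : f - c • y f.natDegree = 0 := by
            have hle : (f - c • y f.natDegree).natDegree ≤ 0 := by
              refine (natDegree_sub_le _ _).trans (max_le hf0.le
                ((natDegree_smul_le _ _).trans ?_))
              rw [natDegree_eq_of_degree_eq_some hd, hf0]
            rw [eq_C_of_natDegree_le_zero hle, coeff_sub, coeff_smul, smul_eq_mul, ← hf0, hc,
              div_mul_cancel₀ _ hy0, sub_self, C_0]
          rw [this]; exact zero_mem _
        apply ih
        have hle : (f - c • y f.natDegree).natDegree ≤ f.natDegree :=
          (natDegree_sub_le _ _).trans (max_le le_rfl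
            ((natDegree_smul_le _ _).trans (natDegree_eq_of_degree_eq_some hd).le))
        have hne : (f - c • y f.natDegree).natDegree ≠ f.natDegree := by
          intro h
          have h0 : (f - c • y f.natDegree).coeff f.natDegree = 0 := by
            rw [coeff_sub, coeff_smul, smul_eq_mul, hc, div_mul_cancel₀ _ hy0, sub_self]
          have h1 : (f - c • y f.natDegree).leadingCoeff = 0 := by rw [leadingCoeff, h, h0]
          rw [leadingCoeff_eq_zero.1 h1, natDegree_zero] at h
          exact hf0 h.symm
        omega
      have := add_mem hsub (Submodule.mem_sup_left (V.smul_mem c hyV))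
      rwa [sub_add_cancel] at this
  have hsurj : Function.Surjective (V.mkQ ∘ₗ (degreeLT K M).subtype) := by
    intro x
    obtain ⟨f, rfl⟩ := V.mkQ_surjective x
    obtain ⟨v, hv, w, hw, rfl⟩ := Submodule.mem_sup.1 (htop _ f (Nat.lt_succ_self _))
    refine ⟨⟨w, hw⟩, ?_⟩
    simp [(Submodule.Quotient.mk_eq_zero V).2 hv]
  have : FiniteDimensional K (degreeLT K M) :=
    Module.Finite.equiv (degreeLTEquiv K M).symm
  exact Module.Finite.of_surjective _ hsurj

/-- Every sufficiently large order of vanishing at a point occurs in a subspace of finite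
codimension. -/
theorem exists_rootMultiplicity_eq (V : Submodule K K[X]) [FiniteDimensional K (K[X] ⧸ V)]
    (ξ : K) : ∃ N₀, ∀ N ≥ N₀, ∃ v ∈ V, v ≠ 0 ∧ v.rootMultiplicity ξ = N := by
  obtain ⟨N₀, h⟩ := exists_sup_multiples_pow_eq V (X - C ξ)
  refine ⟨N₀, fun N hN => ?_⟩
  have hmem : (X - C ξ) ^ N ∈ V ⊔ multiples ((X - C ξ) ^ (N + 1)) := by
    rw [h (N + 1) (by omega), ← h N hN]
    exact Submodule.mem_sup_right ⟨1, by simp⟩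
  obtain ⟨v, hv, _, ⟨w, rfl⟩, e⟩ := Submodule.mem_sup.1 hmem
  rw [LinearMap.mulLeft_apply] at e
  have hv' : v = (1 - (X - C ξ) * w) * (X - C ξ) ^ N := by linear_combination e
  have hnr : (1 - (X - C ξ) * w).eval ξ ≠ 0 := by simp
  have hne : (1 - (X - C ξ) * w) ≠ 0 := by rintro h; rw [h] at hnr; simp at hnr
  refine ⟨v, hv, ?_, ?_⟩
  · rw [hv']; exact mul_ne_zero hne (pow_ne_zero _ (X_sub_C_ne_zero _))
  · rw [hv', rootMultiplicity_mul_X_sub_C_pow hne, rootMultiplicity_eq_zero hnr, zero_add]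

/-! ### Local exponents -/

/-- Leading behaviour at `ξ` of `P v'' + Q v' + R v` for `v = (X - ξ)^N w`. -/
theorem sq_mul_polyOp {P Q R A B D : K[X]} {ξ : K} {t : ℕ} (hP : P = (X - C ξ) ^ t * A)
    (hQ : (X - C ξ) * Q = (X - C ξ) ^ t * B) (hR : (X - C ξ) ^ 2 * R = (X - C ξ) ^ t * D)
    (N : ℕ) (w : K[X]) : ∃ G : K[X],
      (X - C ξ) ^ 2 * polyOp P Q R ((X - C ξ) ^ N * w) = (X - C ξ) ^ (t + N) * G ∧
      G.eval ξ = (A.eval ξ * (N * (N - 1)) + B.eval ξ * N + D.eval ξ) * w.eval ξ := by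
  set x : K[X] := X - C ξ with hx
  have hdx : derivative x = 1 := by simp [hx]
  have hθ : ∀ w : K[X], x * derivative (x ^ N * w) = x ^ N * (N * w + x * derivative w) := by
    intro w
    cases N with
    | zero => simp
    | succ N =>
      rw [derivative_mul, derivative_pow, hdx]
      simp only [Nat.add_sub_cancel, map_natCast]
      push_cast
      ring
  have hθ2 : x ^ 2 * derivative (derivative (x ^ N * w))
      = x ^ N * (N * (N - 1) * w + x * (2 * N * derivative w + x * derivative (derivative w))) := by
    have e : x ^ 2 * derivative (derivative (x ^ N * w))
        = x * derivative (x * derivative (x ^ N * w)) - x * derivative (x ^ N * w) := by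
      rw [derivative_mul (f := x), hdx]; ring
    rw [e, hθ, hθ]
    simp only [derivative_mul, derivative_add, hdx, derivative_natCast]
    ring
  refine ⟨A * (N * (N - 1) * w + x * (2 * N * derivative w + x * derivative (derivative w)))
    + B * (N * w + x * derivative w) + D * w, ?_, ?_⟩
  · rw [polyOp_apply]
    calc _ = P * (x ^ 2 * derivative (derivative (x ^ N * w)))
          + (x * Q) * (x * derivative (x ^ N * w)) + (x ^ 2 * R) * (x ^ N * w) := by ring
      _ = _ := by rw [hθ2, hθ, hQ, hR, hP, pow_add]; ring
  · simp [hx]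
    ring

/-- Let `P D² + Q D + R = h T`, where `T` preserves a space `V` of polynomials of finite
codimension, and suppose that `T` lowers orders of vanishing at `ξ` by `s ≥ 1`, multiplying the
leading coefficient of a function of order `N` by `c(N)`, up to a constant. Orders can only stop
decreasing at roots of `c`, so `c` has a root in each residue class modulo `s`. -/
theorem exists_indicial_root_modEq {P Q R h A B D : K[X]} {V : Submodule K K[X]}
    [FiniteDimensional K (K[X] ⧸ V)] (hV : ∀ v ∈ V, ∃ u ∈ V, polyOp P Q R v = h * u)
    (h0 : h ≠ 0) {ξ : K} {t s : ℕ} (hP : P = (X - C ξ) ^ t * A)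
    (hQ : (X - C ξ) * Q = (X - C ξ) ^ t * B) (hR : (X - C ξ) ^ 2 * R = (X - C ξ) ^ t * D)
    (hs : h.rootMultiplicity ξ + 2 = t + s) (hs1 : 1 ≤ s) (i : ℕ) :
    ∃ N : ℕ, N % s = i % s ∧ A.eval ξ * (N * (N - 1)) + B.eval ξ * N + D.eval ξ = 0 := by
  by_contra! hcon
  have hdesc : ∀ N : ℕ, N % s = i % s → ∀ v ∈ V, v ≠ 0 → v.rootMultiplicity ξ ≠ N := by
    intro N
    induction N using Nat.strong_induction_on with
    | _ N ih =>
      intro hN v hv hv0 hvN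
      obtain ⟨w, hw, hwr⟩ := exists_eq_pow_rootMultiplicity_mul_and_not_dvd v hv0 ξ
      rw [hvN] at hw
      have hwξ : w.eval ξ ≠ 0 := fun h => hwr (dvd_iff_isRoot.2 h)
      obtain ⟨G, hG, hGξ⟩ := sq_mul_polyOp hP hQ hR N w
      rw [← hw] at hG
      obtain ⟨u, hu, hvu⟩ := hV v hv
      have hGξ0 : G.eval ξ ≠ 0 := by rw [hGξ]; exact mul_ne_zero (hcon N hN) hwξ
      have hG0 : G ≠ 0 := by rintro h; rw [h] at hGξ0; simp at hGξ0
      rw [hvu] at hG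
      have hx0 := X_sub_C_ne_zero ξ
      have hne : (X - C ξ) ^ (t + N) * G ≠ 0 := mul_ne_zero (pow_ne_zero _ hx0) hG0
      have hu0 : u ≠ 0 := by rintro rfl; rw [← hG] at hne; simp at hne
      have hr := congrArg (rootMultiplicity ξ) hG
      have hpow : ∀ n, ((X - C ξ) ^ n).rootMultiplicity ξ = n := fun n => by
        simpa using rootMultiplicity_X_sub_C_pow ξ n
      rw [rootMultiplicity_mul (mul_ne_zero (pow_ne_zero _ hx0) (mul_ne_zero h0 hu0)),
        rootMultiplicity_mul (mul_ne_zero h0 hu0), rootMultiplicity_mul hne, hpow, hpow,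
        rootMultiplicity_eq_zero (p := G) hGξ0] at hr
      have hle : s ≤ N := by omega
      refine ih (u.rootMultiplicity ξ) (by omega) ?_ u hu hu0 rfl
      have : N = u.rootMultiplicity ξ + s := by omega
      rw [← hN, this, Nat.add_mod_right]
  obtain ⟨N₀, hN₀⟩ := exists_rootMultiplicity_eq V ξ
  obtain ⟨v, hv, hv0, hvN⟩ := hN₀ (i + s * N₀) (by nlinarith)
  exact hdesc (i + s * N₀) (by simp) v hv hv0 hvN

/-- A quadratic polynomial with three distinct roots vanishes. -/
theorem quadratic_eq_zero {a b c : K} {x y z : K} (hxy : x ≠ y) (hxz : x ≠ z) (hyz : y ≠ z)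
    (hx : a * (x * (x - 1)) + b * x + c = 0) (hy : a * (y * (y - 1)) + b * y + c = 0)
    (hz : a * (z * (z - 1)) + b * z + c = 0) : a = 0 ∧ b = 0 ∧ c = 0 := by
  have h1 : a * (x + y - 1) + b = 0 := by
    apply mul_left_cancel₀ (sub_ne_zero.2 hxy); linear_combination hx - hy
  have h2 : a * (x + z - 1) + b = 0 := by
    apply mul_left_cancel₀ (sub_ne_zero.2 hxz); linear_combination hx - hz
  have ha : a = 0 := by
    apply mul_left_cancel₀ (sub_ne_zero.2 hyz); linear_combination h1 - h2
  have hb : b = 0 := by simpa [ha] using h1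
  exact ⟨ha, hb, by simpa [ha, hb] using hx⟩

/-- An operator that preserves a space of polynomials of finite codimension lowers orders of
vanishing by at most two. -/
theorem order_drop_le_two [CharZero K] {P Q R h A B D : K[X]} {V : Submodule K K[X]}
    [FiniteDimensional K (K[X] ⧸ V)] (hV : ∀ v ∈ V, ∃ u ∈ V, polyOp P Q R v = h * u)
    (h0 : h ≠ 0) {ξ : K} {t : ℕ} (hP : P = (X - C ξ) ^ t * A)
    (hQ : (X - C ξ) * Q = (X - C ξ) ^ t * B) (hR : (X - C ξ) ^ 2 * R = (X - C ξ) ^ t * D)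
    (hne : ¬(A.eval ξ = 0 ∧ B.eval ξ = 0 ∧ D.eval ξ = 0)) : h.rootMultiplicity ξ ≤ t := by
  by_contra! hlt
  obtain ⟨s, hs⟩ : ∃ s, h.rootMultiplicity ξ + 2 = t + s := ⟨h.rootMultiplicity ξ + 2 - t, by omega⟩
  have hs3 : 3 ≤ s := by omega
  obtain ⟨x, hx, ex⟩ := exists_indicial_root_modEq hV h0 hP hQ hR hs (by omega) 0
  obtain ⟨y, hy, ey⟩ := exists_indicial_root_modEq hV h0 hP hQ hR hs (by omega) 1
  obtain ⟨z, hz, ez⟩ := exists_indicial_root_modEq hV h0 hP hQ hR hs (by omega) 2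
  rw [Nat.mod_eq_of_lt (by omega : 0 < s)] at hx
  rw [Nat.mod_eq_of_lt (by omega : 1 < s)] at hy
  rw [Nat.mod_eq_of_lt (by omega : 2 < s)] at hz
  refine hne (quadratic_eq_zero (x := (x : K)) (y := y) (z := z) ?_ ?_ ?_ ex ey ez)
  all_goals
    rw [Ne, Nat.cast_inj]
    rintro rfl
    omega

/-- Normalized coefficients at `ξ`. -/
theorem exists_local_form (ξ : K) {P : K[X]} (Q R : K[X]) (hP : P ≠ 0) : ∃ (t : ℕ) (A B D : K[X]),
    P = (X - C ξ) ^ t * A ∧ (X - C ξ) * Q = (X - C ξ) ^ t * B ∧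
    (X - C ξ) ^ 2 * R = (X - C ξ) ^ t * D ∧
    ¬(A.eval ξ = 0 ∧ B.eval ξ = 0 ∧ D.eval ξ = 0) := by
  have key : ∀ (n : ℕ) (A B D : K[X]), A ≠ 0 → A.natDegree < n → ∃ (t : ℕ) (A' B' D' : K[X]),
      A = (X - C ξ) ^ t * A' ∧ B = (X - C ξ) ^ t * B' ∧ D = (X - C ξ) ^ t * D' ∧
      ¬(A'.eval ξ = 0 ∧ B'.eval ξ = 0 ∧ D'.eval ξ = 0) := by
    intro n
    induction n with
    | zero => intro A B D _ h; omega
    | succ n ih =>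
      intro A B D hA hn
      by_cases h : A.eval ξ = 0 ∧ B.eval ξ = 0 ∧ D.eval ξ = 0
      · obtain ⟨a, rfl⟩ := dvd_iff_isRoot.2 (show A.IsRoot ξ from h.1)
        obtain ⟨b, rfl⟩ := dvd_iff_isRoot.2 (show B.IsRoot ξ from h.2.1)
        obtain ⟨d, rfl⟩ := dvd_iff_isRoot.2 (show D.IsRoot ξ from h.2.2)
        have ha := right_ne_zero_of_mul hA
        rw [natDegree_mul (X_sub_C_ne_zero _) ha, natDegree_X_sub_C] at hn
        obtain ⟨t, A', B', D', rfl, rfl, rfl, h'⟩ := ih a b d ha (by omega)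
        exact ⟨t + 1, A', B', D', by ring, by ring, by ring, h'⟩
      · exact ⟨0, A, B, D, by simp, by simp, by simp, h⟩
  exact key _ P _ _ hP (Nat.lt_succ_self _)

end PolyOp

/-! ### The coefficients of an operator with eigenpolynomials in almost all degrees -/

section Structure

variable {K : Type*} [Field K]

theorem rootMultiplicity_pow_X_sub_C_mul {A : K[X]} (ξ : K) (t : ℕ) (hA : A ≠ 0) :
    ((X - C ξ) ^ t * A).rootMultiplicity ξ = t + A.rootMultiplicity ξ := by
  rw [mul_comm, rootMultiplicity_mul_X_sub_C_pow hA, add_comm]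

theorem le_rootMultiplicity_of_eq {P A : K[X]} {ξ : K} {t : ℕ} (hP : P ≠ 0)
    (h : P = (X - C ξ) ^ t * A) : t ≤ P.rootMultiplicity ξ :=
  (le_rootMultiplicity_iff hP).2 ⟨A, h⟩

theorem eval_ne_zero_of_isCoprime {a b : K[X]} (h : IsCoprime a b) {ξ : K}
    (hb : b.eval ξ = 0) : a.eval ξ ≠ 0 := by
  intro ha
  obtain ⟨u, v, e⟩ := h
  have := congrArg (eval ξ) e
  simp [ha, hb] at this

/-- The leading coefficient has no poles: at a pole of `p` the orders of vanishing would drop by more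
than two. -/
theorem denom_p_eval_ne_zero [CharZero K] {np dp nq dq nr dr : K[X]} (hnp : np ≠ 0) (hdp : dp ≠ 0)
    (hdq : dq ≠ 0) (hdr : dr ≠ 0) (hcp : IsCoprime np dp) {V : Submodule K K[X]}
    [FiniteDimensional K (K[X] ⧸ V)]
    (hV : ∀ v ∈ V, ∃ u ∈ V, polyOp (np * dq * dr) (nq * dp * dr) (nr * dp * dq) v
      = dp * dq * dr * u) (ξ : K) : dp.eval ξ ≠ 0 := by
  intro hξ
  have hP : np * dq * dr ≠ 0 := mul_ne_zero (mul_ne_zero hnp hdq) hdr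
  have hh : dp * dq * dr ≠ 0 := mul_ne_zero (mul_ne_zero hdp hdq) hdr
  obtain ⟨t, A, B, D, eA, eB, eD, hne⟩ := exists_local_form ξ (nq * dp * dr) (nr * dp * dq) hP
  have h1 := order_drop_le_two hV hh eA eB eD hne
  have h2 := le_rootMultiplicity_of_eq hP eA
  rw [rootMultiplicity_mul hP, rootMultiplicity_mul (mul_ne_zero hnp hdq)] at h2
  rw [rootMultiplicity_mul hh, rootMultiplicity_mul (mul_ne_zero hdp hdq)] at h1
  have h3 : np.rootMultiplicity ξ = 0 :=
    rootMultiplicity_eq_zero (eval_ne_zero_of_isCoprime hcp hξ)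
  have h4 : 0 < dp.rootMultiplicity ξ := (rootMultiplicity_pos hdp).2 hξ
  omega

/-- The poles of `q` are simple, they are not zeros of `p`, and the residue of `q / p` at each of
them is a nonpositive even integer: the two local exponents have different parity. -/
theorem denom_q_local [CharZero K] {p nq dq nr dr : K[X]} (hp : p ≠ 0)
    (hdq : dq ≠ 0) (hdr : dr ≠ 0) (hcq : IsCoprime nq dq) {V : Submodule K K[X]}
    [FiniteDimensional K (K[X] ⧸ V)]
    (hV : ∀ v ∈ V, ∃ u ∈ V, polyOp (p * dq * dr) (nq * dr) (nr * dq) v = dq * dr * u) {ξ : K}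
    (hξ : dq.eval ξ = 0) : (derivative dq).eval ξ ≠ 0 ∧ p.eval ξ ≠ 0 ∧
      ∃ ν : ℕ, nq.eval ξ + 2 * ν * p.eval ξ * (derivative dq).eval ξ = 0 := by
  have hP : p * dq * dr ≠ 0 := mul_ne_zero (mul_ne_zero hp hdq) hdr
  have hh : dq * dr ≠ 0 := mul_ne_zero hdq hdr
  have hx0 := X_sub_C_ne_zero ξ
  have hnqξ : nq.eval ξ ≠ 0 := eval_ne_zero_of_isCoprime hcq hξ
  have hnq : nq ≠ 0 := by rintro rfl; simp at hnqξ
  obtain ⟨t, A, B, D, eA, eB, eD, hne⟩ := exists_local_form ξ (nq * dr) (nr * dq) hP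
  have h1 := order_drop_le_two hV hh eA eB eD hne
  have hQ0 : (X - C ξ) * (nq * dr) ≠ 0 := mul_ne_zero hx0 (mul_ne_zero hnq hdr)
  have h2 := le_rootMultiplicity_of_eq hQ0 eB
  rw [rootMultiplicity_mul hQ0, rootMultiplicity_X_sub_C_self,
    rootMultiplicity_mul (mul_ne_zero hnq hdr), rootMultiplicity_eq_zero (p := nq) hnqξ] at h2
  have h3 : 0 < dq.rootMultiplicity ξ := (rootMultiplicity_pos hdq).2 hξ
  have h1' := h1
  rw [rootMultiplicity_mul hh] at h1
  have ht : (dq * dr).rootMultiplicity ξ + 2 = t + 2 := by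
    rw [rootMultiplicity_mul hh]; omega
  have hA0 : A ≠ 0 := by rintro rfl; rw [mul_zero] at eA; exact hP eA
  have hrA := congrArg (rootMultiplicity ξ) eA
  rw [rootMultiplicity_mul hP, rootMultiplicity_mul (mul_ne_zero hp hdq),
    rootMultiplicity_pow_X_sub_C_mul ξ t hA0] at hrA
  obtain ⟨m, hm, em⟩ := exists_indicial_root_modEq hV hh eA eB eD ht (by omega) 0
  obtain ⟨n, hn, en⟩ := exists_indicial_root_modEq hV hh eA eB eD ht (by omega) 1
  -- the two local exponents have opposite parity, so they are distinct and determine `B / A`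
  have hmn : (m : K) - n ≠ 0 := by
    rw [sub_ne_zero, Ne, Nat.cast_inj]; omega
  have hlin : A.eval ξ * (m + n - 1) + B.eval ξ = 0 := by
    apply mul_left_cancel₀ hmn; linear_combination em - en
  have hAξ : A.eval ξ ≠ 0 := by
    intro h0
    have hB : B.eval ξ = 0 := by simpa [h0] using hlin
    exact hne ⟨h0, hB, by simpa [h0, hB] using em⟩
  have hrA0 : A.rootMultiplicity ξ = 0 := rootMultiplicity_eq_zero hAξ
  have hpξ : p.eval ξ ≠ 0 := by
    intro h0
    have := (rootMultiplicity_pos hp).2 h0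
    omega
  obtain ⟨k, hk⟩ := dvd_iff_isRoot.2 (show dq.IsRoot ξ from hξ)
  have hk0 : k ≠ 0 := by rintro rfl; rw [mul_zero] at hk; exact hdq hk
  have hkr : k.rootMultiplicity ξ = 0 := by
    have := congrArg (rootMultiplicity ξ) hk
    rw [rootMultiplicity_mul (hk ▸ hdq), rootMultiplicity_X_sub_C_self] at this
    omega
  have hkξ : k.eval ξ ≠ 0 := fun h => by
    have := (rootMultiplicity_pos hk0).2 h
    omega
  have hd : (derivative dq).eval ξ = k.eval ξ := by rw [hk]; simp [derivative_mul]
  refine ⟨hd ▸ hkξ, hpξ, (m + n) / 2, ?_⟩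
  have hrel : A * nq = B * p * k := by
    apply mul_left_cancel₀ (mul_ne_zero hx0 hdr)
    apply mul_left_cancel₀ (pow_ne_zero t hx0)
    linear_combination (X - C ξ) ^ t * A * eB - (X - C ξ) ^ t * B * eA
      + (X - C ξ) ^ t * B * p * dr * hk
  have hrel' := congrArg (eval ξ) hrel
  simp only [eval_mul] at hrel'
  have hcast : (2 : K) * ((m + n) / 2 : ℕ) = m + n - 1 := by
    have h : 2 * ((m + n) / 2) + 1 = m + n := by omega
    have h' : ((2 * ((m + n) / 2) + 1 : ℕ) : K) = ((m + n : ℕ) : K) := by rw [h]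
    push_cast at h'
    linear_combination h'
  rw [hd, hcast]
  apply mul_left_cancel₀ hAξ
  linear_combination hrel' + p.eval ξ * k.eval ξ * hlin

/-- Three distinct degrees outside a finite set. -/
theorem exists_three_notMem (E : Finset ℕ) : ∃ a ∉ E, ∃ b ∉ E, ∃ c ∉ E, a ≠ b ∧ a ≠ c ∧ b ≠ c := by
  have hM : ∀ k, E.sup id + 1 ≤ k → k ∉ E := fun k hk hE => by
    have := Finset.le_sup (f := id) hE
    simp only [id] at this
    omega
  exact ⟨_, hM (E.sup id + 1) le_rfl, _, hM (E.sup id + 2) (by omega), _,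
    hM (E.sup id + 3) (by omega), by omega, by omega, by omega⟩

variable {P Q R h : K[X]} {E : Finset ℕ} {y : ℕ → K[X]}

theorem coeff_ne_zero_of_degree_eq {f : K[X]} {k : ℕ} (hf : f.degree = k) : f.coeff k ≠ 0 := by
  have h0 : f ≠ 0 := by rintro rfl; simp at hf
  have h1 := leadingCoeff_ne_zero.2 h0
  rwa [leadingCoeff, natDegree_eq_of_degree_eq_some hf] at h1

/-- The coefficients of `P`, `Q`, `R` that would raise degrees by `m > deg h` vanish: the quadratic
in `k` that they define has all `k ∉ E` as roots. -/
theorem coeff_eq_zero_of_eigen [CharZero K] (hy : ∀ k ∉ E, (y k).degree = k) {l : ℕ → K}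
    (heig : ∀ k ∉ E, polyOp P Q R (y k) = h * (C (l k) * y k)) {m : ℕ} (hm : h.natDegree < m) :
    P.coeff (m + 2) = 0 ∧ Q.coeff (m + 1) = 0 ∧ R.coeff m = 0 := by
  have key : ∀ j m : ℕ, P.natDegree + Q.natDegree + R.natDegree < m + j → h.natDegree < m →
      P.coeff (m + 2) = 0 ∧ Q.coeff (m + 1) = 0 ∧ R.coeff m = 0 := by
    intro j
    induction j with
    | zero =>
      intro m hm _
      exact ⟨coeff_eq_zero_of_natDegree_lt (by omega), coeff_eq_zero_of_natDegree_lt (by omega),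
        coeff_eq_zero_of_natDegree_lt (by omega)⟩
    | succ j ih =>
      intro m hj hm
      have hP : P.natDegree ≤ m + 2 := natDegree_le_iff_coeff_eq_zero.2 fun i hi => by
        obtain ⟨n, rfl⟩ : ∃ n, i = n + 2 := ⟨i - 2, by omega⟩
        exact (ih n (by omega) (by omega)).1
      have hQ : Q.natDegree ≤ m + 1 := natDegree_le_iff_coeff_eq_zero.2 fun i hi => by
        obtain ⟨n, rfl⟩ : ∃ n, i = n + 1 := ⟨i - 1, by omega⟩
        exact (ih n (by omega) (by omega)).2.1
      have hR : R.natDegree ≤ m := natDegree_le_iff_coeff_eq_zero.2 fun i hi =>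
        (ih i (by omega) (by omega)).2.2
      have hroot : ∀ k ∉ E, P.coeff (m + 2) * ((k : K) * (k - 1)) + Q.coeff (m + 1) * k
          + R.coeff m = 0 := by
        intro k hk
        have hd := hy k hk
        have hn := natDegree_eq_of_degree_eq_some hd
        have h1 := coeff_polyOp hP hQ hR hn.le
        rw [heig k hk, coeff_eq_zero_of_natDegree_lt] at h1
        · exact (mul_eq_zero.1 h1.symm).resolve_right (coeff_ne_zero_of_degree_eq hd)
        · refine natDegree_mul_le.trans_lt ?_
          have := natDegree_C_mul_le (l k) (y k)
          omega
      obtain ⟨a, ha, b, hb, c, hc, hab, hac, hbc⟩ := exists_three_notMem E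
      exact quadratic_eq_zero (Nat.cast_injective.ne hab) (Nat.cast_injective.ne hac)
        (Nat.cast_injective.ne hbc) (hroot a ha) (hroot b hb) (hroot c hc)
  -- downward induction on `m`, written as induction on the distance `j` to a bound
  exact key _ m (by omega : _ < m + (P.natDegree + Q.natDegree + R.natDegree + 1)) hm

theorem natDegree_le_of_eigen [CharZero K] (hy : ∀ k ∉ E, (y k).degree = k) {l : ℕ → K}
    (heig : ∀ k ∉ E, polyOp P Q R (y k) = h * (C (l k) * y k)) :
    P.natDegree ≤ h.natDegree + 2 ∧ Q.natDegree ≤ h.natDegree + 1 ∧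
      R.natDegree ≤ h.natDegree := by
  refine ⟨natDegree_le_iff_coeff_eq_zero.2 fun i hi => ?_,
    natDegree_le_iff_coeff_eq_zero.2 fun i hi => ?_,
    natDegree_le_iff_coeff_eq_zero.2 fun i hi => ?_⟩
  · obtain ⟨n, rfl⟩ : ∃ n, i = n + 2 := ⟨i - 2, by omega⟩
    exact (coeff_eq_zero_of_eigen hy heig (by omega)).1
  · obtain ⟨n, rfl⟩ : ∃ n, i = n + 1 := ⟨i - 1, by omega⟩
    exact (coeff_eq_zero_of_eigen hy heig (by omega)).2.1
  · exact (coeff_eq_zero_of_eigen hy heig hi).2.2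

/-- The eigenvalue is a quadratic function of the degree. -/
theorem eigenvalue_eq (hP : P.natDegree ≤ h.natDegree + 2) (hQ : Q.natDegree ≤ h.natDegree + 1)
    (hR : R.natDegree ≤ h.natDegree) (hh : h.Monic) {f : K[X]} {l : K} {k : ℕ}
    (hf : f.degree = k) (heig : polyOp P Q R f = h * (C l * f)) :
    l = P.coeff (h.natDegree + 2) * (k * (k - 1)) + Q.coeff (h.natDegree + 1) * k
      + R.coeff h.natDegree := by
  have hn := natDegree_eq_of_degree_eq_some hf
  have h1 := coeff_polyOp hP hQ hR hn.le
  rw [heig, coeff_mul_add_eq_of_natDegree_le le_rfl ((natDegree_C_mul_le l f).trans hn.le),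
    coeff_C_mul, hh.coeff_natDegree, one_mul] at h1
  exact mul_right_cancel₀ (coeff_ne_zero_of_degree_eq hf) h1

/-- The eigenvalues are not all equal: a second-order operator does not annihilate a space of
polynomials of finite codimension. -/
theorem eigenvalue_not_const [CharZero K] (hP0 : P ≠ 0) (hy : ∀ k ∉ E, (y k).degree = k)
    (c : K) : ¬ ∀ k ∉ E, polyOp P Q R (y k) = h * (C c * y k) := by
  intro hc
  set V := Submodule.span K {v : K[X] | ∃ k ∉ E, v = y k} with hVdef
  have := finiteDimensional_quotient_span hy
  have hker : V ≤ LinearMap.ker (polyOp P Q (R - C c * h)) := by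
    rw [hVdef, Submodule.span_le]
    rintro _ ⟨k, hk, rfl⟩
    have := hc k hk
    rw [polyOp_apply] at this
    rw [SetLike.mem_coe, LinearMap.mem_ker, polyOp_apply]
    linear_combination this
  obtain ⟨t, A, B, D, eA, eB, eD, hne⟩ := exists_local_form (0 : K) Q (R - C c * h) hP0
  -- the zero operator on `V` is divisible by every `h`, so orders would drop arbitrarily far
  have h1 := order_drop_le_two (h := (X - C 0) ^ (t + 1)) (V := V)
    (fun v hv => ⟨0, zero_mem _, by rw [LinearMap.mem_ker.1 (hker hv), mul_zero]⟩)
    (pow_ne_zero _ (X_sub_C_ne_zero _)) eA eB eD hne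
  rw [rootMultiplicity_X_sub_C_pow] at h1
  omega

end Structure

/-! ### Clearing denominators -/

section Clear

variable {K : Type*} [Field K]

local notation "ι" => algebraMap K[X] (RatFunc K)

theorem DiffOp2.den_mul_apply (T : DiffOp2 K) (f : K[X]) :
    ι (T.p.denom * T.q.denom * T.r.denom) * T.apply (ι f)
      = ι (polyOp (T.p.num * T.q.denom * T.r.denom) (T.q.num * T.p.denom * T.r.denom)
        (T.r.num * T.p.denom * T.q.denom) f) := by
  have key : ∀ g : RatFunc K, ι g.denom * g = ι g.num := fun g => by
    have h := algebraMap_ratFunc_ne_zero g.denom_ne_zero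
    have := RatFunc.num_div_denom g
    rw [div_eq_iff h] at this
    rw [this, mul_comm]
  rw [DiffOp2.apply, polyOp_apply]
  simp only [ratDeriv_algebraMap, map_mul, map_add, ← key]
  ring

theorem DiffOp2.apply_eq_iff (T : DiffOp2 K) (f g : K[X]) :
    T.apply (ι f) = ι g ↔
      polyOp (T.p.num * T.q.denom * T.r.denom) (T.q.num * T.p.denom * T.r.denom)
        (T.r.num * T.p.denom * T.q.denom) f = T.p.denom * T.q.denom * T.r.denom * g := by
  have h0 := algebraMap_ratFunc_ne_zero (mul_ne_zero (mul_ne_zero T.p.denom_ne_zero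
    T.q.denom_ne_zero) T.r.denom_ne_zero)
  rw [← (RatFunc.algebraMap_injective K).eq_iff, ← T.den_mul_apply,
    map_mul ι (T.p.denom * T.q.denom * T.r.denom) g, mul_right_inj' h0]

end Clear

/-! ### The denominator `η` -/

section Eta

/-- If the residue of `n / (p d)` at each (simple) zero of `d` is `-2ν`, `ν ∈ ℕ`, then adding
`2 η' / η` for a suitable real polynomial `η` removes all these poles. -/
theorem exists_eta {p n d : ℝ[X]} (hd : d ≠ 0)
    (H : ∀ ξ : ℂ, aeval ξ d = 0 → aeval ξ (derivative d) ≠ 0 ∧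
      ∃ ν : ℕ, aeval ξ n + 2 * ν * aeval ξ p * aeval ξ (derivative d) = 0)
    (Hp : ∀ ξ : ℂ, aeval ξ d = 0 → aeval ξ p ≠ 0) :
    ∃ η Q : ℝ[X], η ≠ 0 ∧ Q * d * η = n * η + 2 * p * derivative η * d := by
  classical
  have hd' : d.map (algebraMap ℝ ℂ) ≠ 0 := (Polynomial.map_ne_zero_iff (algebraMap ℝ ℂ).injective).2 hd
  choose ν hν using fun ξ : ℂ => fun h : aeval ξ d = 0 => (H ξ h).2
  -- a bound for the residues
  obtain ⟨J, hJ⟩ : ∃ J, ∀ (ξ : ℂ) (h : aeval ξ d = 0), ν ξ h < J := by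
    have hfin : {ξ : ℂ | aeval ξ d = 0}.Finite := by
      refine ((d.map (algebraMap ℝ ℂ)).roots.toFinset.finite_toSet).subset fun ξ hξ => ?_
      simp only [Finset.mem_coe, Multiset.mem_toFinset, mem_roots hd', IsRoot.def,
        eval_map_algebraMap]
      exact hξ
    obtain ⟨J, hJ⟩ := (hfin.image fun ξ => if h : aeval ξ d = 0 then ν ξ h else 0).bddAbove
    refine ⟨J + 1, fun ξ h => Nat.lt_succ_of_le (hJ ⟨ξ, h, ?_⟩)⟩
    simp [h]
  -- the zeros of `d` at which the residue is `-2j`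
  let g : ℕ → ℝ[X] := fun j => EuclideanDomain.gcd d (n + 2 * (j : ℝ[X]) * p * derivative d)
  have hgd : ∀ j, g j ∣ d := fun j => EuclideanDomain.gcd_dvd_left _ _
  have hg0 : ∀ j, g j ≠ 0 := fun j => ne_zero_of_dvd_ne_zero hd (hgd j)
  have hgm0 : ∀ j, (g j).map (algebraMap ℝ ℂ) ≠ 0 := fun j =>
    (Polynomial.map_ne_zero_iff (algebraMap ℝ ℂ).injective).2 (hg0 j)
  have hgroot : ∀ j (ξ : ℂ), aeval ξ (g j) = 0 ↔
      aeval ξ d = 0 ∧ aeval ξ n + 2 * j * aeval ξ p * aeval ξ (derivative d) = 0 := by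
    intro j ξ
    have : eval₂ (algebraMap ℝ ℂ) ξ (g j) = 0 ↔ eval₂ (algebraMap ℝ ℂ) ξ d = 0 ∧
        eval₂ (algebraMap ℝ ℂ) ξ (n + 2 * (j : ℝ[X]) * p * derivative d) = 0 :=
      root_gcd_iff_root_left_right
    rw [← aeval_def, ← aeval_def, ← aeval_def] at this
    rw [this]
    simp only [map_add, map_mul, map_natCast, map_ofNat]
  set η := ∏ j ∈ Finset.range J, g j ^ j with hη
  have hη0 : η ≠ 0 := Finset.prod_ne_zero_iff.2 fun j _ => pow_ne_zero _ (hg0 j)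
  have hηm0 : η.map (algebraMap ℝ ℂ) ≠ 0 :=
    (Polynomial.map_ne_zero_iff (algebraMap ℝ ℂ).injective).2 hη0
  have hsimple : ∀ ξ : ℂ, aeval ξ d = 0 → (d.map (algebraMap ℝ ℂ)).rootMultiplicity ξ = 1 := by
    intro ξ hξ
    have h1 : 0 < (d.map (algebraMap ℝ ℂ)).rootMultiplicity ξ :=
      (rootMultiplicity_pos hd').2 (by rw [IsRoot.def, eval_map_algebraMap]; exact hξ)
    have h2 : ¬ 1 < (d.map (algebraMap ℝ ℂ)).rootMultiplicity ξ := by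
      rw [one_lt_rootMultiplicity_iff_isRoot hd']
      rintro ⟨-, h⟩
      rw [IsRoot.def, derivative_map, eval_map_algebraMap] at h
      exact (H ξ hξ).1 h
    omega
  have hgmult : ∀ j (ξ : ℂ) (h : aeval ξ d = 0),
      ((g j).map (algebraMap ℝ ℂ)).rootMultiplicity ξ = if j = ν ξ h then 1 else 0 := by
    intro j ξ h
    split_ifs with hj
    · have hr : aeval ξ (g j) = 0 := (hgroot j ξ).2 ⟨h, by rw [hj]; exact hν ξ h⟩
      have h1 : 0 < ((g j).map (algebraMap ℝ ℂ)).rootMultiplicity ξ :=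
        (rootMultiplicity_pos (hgm0 j)).2 (by rw [IsRoot.def, eval_map_algebraMap]; exact hr)
      have h2 := rootMultiplicity_le_rootMultiplicity_of_dvd hd'
        (Polynomial.map_dvd (algebraMap ℝ ℂ) (hgd j)) ξ
      rw [hsimple ξ h] at h2
      omega
    · apply rootMultiplicity_eq_zero
      rw [IsRoot.def, eval_map_algebraMap]
      intro hr
      have h1 := ((hgroot j ξ).1 hr).2
      have h2 := hν ξ h
      have h3 : ((j : ℂ) - ν ξ h) * (aeval ξ p * aeval ξ (derivative d)) = 0 := by
        linear_combination (h1 - h2) / 2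
      rcases mul_eq_zero.1 h3 with h4 | h4
      · exact hj (by exact_mod_cast sub_eq_zero.1 h4)
      · exact (mul_ne_zero (Hp ξ h) (H ξ h).1) h4
  have hηmult : ∀ (ξ : ℂ) (h : aeval ξ d = 0),
      (η.map (algebraMap ℝ ℂ)).rootMultiplicity ξ = ν ξ h := by
    intro ξ h
    have hprod : ∀ s : Finset ℕ, ((∏ j ∈ s, g j ^ j).map (algebraMap ℝ ℂ)).rootMultiplicity ξ
        = ∑ j ∈ s, j * (if j = ν ξ h then 1 else 0) := by
      intro s
      rw [Polynomial.map_prod, ← count_roots, roots_prod]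
      · simp only [Polynomial.map_pow, roots_pow, Multiset.count_bind]
        simp only [Multiset.count_nsmul, count_roots, hgmult _ ξ h]
        rfl
      · exact Finset.prod_ne_zero_iff.2 fun j _ => by
          rw [Polynomial.map_pow]; exact pow_ne_zero _ (hgm0 j)
    rw [hη, hprod]
    simp [hJ ξ h]
  have hηnr : ∀ ξ : ℂ, aeval ξ d ≠ 0 → (η.map (algebraMap ℝ ℂ)).rootMultiplicity ξ = 0 := by
    intro ξ h
    apply rootMultiplicity_eq_zero
    rw [IsRoot.def, eval_map_algebraMap, hη, map_prod]
    refine Finset.prod_ne_zero_iff.2 fun j _ => ?_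
    rw [map_pow]
    exact pow_ne_zero _ fun hr => h ((hgroot j ξ).1 hr).1
  suffices hdvd : d * η ∣ n * η + 2 * p * derivative η * d by
    obtain ⟨Q, hQ⟩ := hdvd
    exact ⟨η, Q, hη0, by rw [hQ]; ring⟩
  rw [← map_dvd_map' (algebraMap ℝ ℂ)]
  by_cases hZ : (n * η + 2 * p * derivative η * d).map (algebraMap ℝ ℂ) = 0
  · rw [hZ]; exact dvd_zero _
  have hdη : (d * η).map (algebraMap ℝ ℂ) ≠ 0 := by
    rw [Polynomial.map_mul]; exact mul_ne_zero hd' hηm0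
  -- compare multiplicities of complex roots
  rw [(IsAlgClosed.splits _).dvd_iff_roots_le_roots hdη hZ, Multiset.le_iff_count]
  intro ξ
  rw [count_roots, count_roots, le_rootMultiplicity_iff hZ, Polynomial.map_mul,
    rootMultiplicity_mul (by rwa [← Polynomial.map_mul])]
  by_cases h : aeval ξ d = 0
  · rw [hsimple ξ h]
    obtain ⟨e, he⟩ := (le_rootMultiplicity_iff hηm0).1 (hηmult ξ h).ge
    obtain ⟨k, hk⟩ := dvd_iff_isRoot.2 (show (d.map (algebraMap ℝ ℂ)).IsRoot ξ by
      rw [IsRoot.def, eval_map_algebraMap]; exact h)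
    have hkξ : aeval ξ (derivative d) = k.eval ξ := by
      rw [← eval_map_algebraMap, ← derivative_map, hk]; simp [derivative_mul]
    rw [hηmult ξ h]
    have hroot : (n.map (algebraMap ℝ ℂ) * e + 2 * p.map (algebraMap ℝ ℂ) * k * ((ν ξ h : ℂ[X]) * e
        + (X - C ξ) * derivative e)).IsRoot ξ := by
      have := hν ξ h
      rw [hkξ] at this
      simp only [IsRoot.def, eval_add, eval_mul, eval_map_algebraMap, eval_sub, eval_X, eval_C,
        sub_self, zero_mul, add_zero, eval_natCast, eval_ofNat]
      linear_combination e.eval ξ * this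
    obtain ⟨Z, hZ'⟩ := dvd_iff_isRoot.2 hroot
    refine ⟨Z, ?_⟩
    have hder : derivative ((X - C ξ) ^ ν ξ h * e) * (X - C ξ)
        = (X - C ξ) ^ ν ξ h * ((ν ξ h : ℂ[X]) * e + (X - C ξ) * derivative e) := by
      cases ν ξ h with
      | zero => simp; ring
      | succ N =>
        rw [derivative_mul, derivative_pow]
        simp only [Nat.add_sub_cancel, map_natCast, derivative_sub, derivative_X, derivative_C]
        push_cast
        ring
    simp only [Polynomial.map_add, Polynomial.map_mul, ← derivative_map, Polynomial.map_ofNat]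
    rw [he, hk]
    linear_combination (X - C ξ) ^ ν ξ h * hZ' + 2 * p.map (algebraMap ℝ ℂ) * k * hder
  · rw [hηnr ξ h, rootMultiplicity_eq_zero
      (by rw [IsRoot.def, eval_map_algebraMap]; exact h)]
    simp

end Eta

/-! ### Invariant subspaces and the normal form -/

section Invariant

variable {K : Type*} [Field K]

local notation "ι" => algebraMap K[X] (RatFunc K)

/-- `T` maps the space `V` of polynomials into itself. -/
def DiffOp2.Preserves (T : DiffOp2 K) (V : Submodule K K[X]) : Prop :=
  ∀ v ∈ V, ∃ u ∈ V, T.apply (ι v) = ι u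

theorem DiffOp2.apply_add (T : DiffOp2 K) (f g : RatFunc K) :
    T.apply (f + g) = T.apply f + T.apply g := by
  simp only [DiffOp2.apply, ratDeriv_add]; ring

theorem C_mul_algebraMap (c : K) (f : K[X]) : RatFunc.C c * ι f = ι (C c * f) := by
  rw [map_mul, RatFunc.algebraMap_C]

theorem DiffOp2.apply_C_mul (T : DiffOp2 K) (c : K) (f : RatFunc K) :
    T.apply (RatFunc.C c * f) = RatFunc.C c * T.apply f := by
  simp only [DiffOp2.apply, ratDeriv_mul, ratDeriv_C, zero_mul, zero_add]; ring

theorem DiffOp2.preserves_span (T : DiffOp2 K) {E : Finset ℕ} {y : ℕ → K[X]}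
    (heig : ∀ k ∉ E, T.HasEigenpoly (y k)) :
    T.Preserves (Submodule.span K {v : K[X] | ∃ k ∉ E, v = y k}) := by
  intro v hv
  induction hv using Submodule.span_induction with
  | mem x hx =>
    obtain ⟨k, hk, rfl⟩ := hx
    obtain ⟨c, hc⟩ := heig k hk
    refine ⟨c • y k, Submodule.smul_mem _ _ (Submodule.subset_span ⟨k, hk, rfl⟩), ?_⟩
    rw [hc, C_mul_algebraMap, smul_eq_C_mul]
  | zero => exact ⟨0, zero_mem _, by simp [DiffOp2.apply]⟩
  | add x z _ _ hx hz =>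
    obtain ⟨u, hu, e⟩ := hx
    obtain ⟨w, hw, e'⟩ := hz
    exact ⟨u + w, add_mem hu hw, by rw [map_add, T.apply_add, e, e', map_add]⟩
  | smul c x _ hx =>
    obtain ⟨u, hu, e⟩ := hx
    exact ⟨c • u, Submodule.smul_mem _ _ hu, by
      rw [smul_eq_C_mul, smul_eq_C_mul, ← C_mul_algebraMap, T.apply_C_mul, e, C_mul_algebraMap]⟩

/-- A space of polynomials of finite codimension preserved by `T` can be enlarged to one that is
still preserved and contains a nonzero ideal: add all multiples of a high power of a common
denominator. -/
theorem DiffOp2.exists_preserves_multiples (T : DiffOp2 K) {V : Submodule K K[X]}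
    [FiniteDimensional K (K[X] ⧸ V)] (hV : T.Preserves V) :
    ∃ (V' : Submodule K K[X]) (g : K[X]), T.Preserves V' ∧ g ≠ 0 ∧ ∀ f, g * f ∈ V' := by
  set h := T.p.denom * T.q.denom * T.r.denom with hh
  have hh0 : h ≠ 0 := mul_ne_zero (mul_ne_zero T.p.denom_ne_zero T.q.denom_ne_zero)
    T.r.denom_ne_zero
  obtain ⟨m, hm⟩ := exists_sup_multiples_pow_eq V h
  refine ⟨V ⊔ multiples (h ^ m), h ^ m, ?_, pow_ne_zero _ hh0,
    fun f => Submodule.mem_sup_right ⟨f, rfl⟩⟩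
  intro v hv
  rw [← hm (m + 3) (by omega)] at hv
  obtain ⟨v₁, hv₁, _, ⟨w, rfl⟩, rfl⟩ := Submodule.mem_sup.1 hv
  obtain ⟨u, hu, e⟩ := hV v₁ hv₁
  rw [LinearMap.mulLeft_apply]
  -- two derivatives and one division by `h` cost at most three powers of `h`
  obtain ⟨w', hw'⟩ : ∃ w', polyOp (T.p.num * T.q.denom * T.r.denom)
      (T.q.num * T.p.denom * T.r.denom) (T.r.num * T.p.denom * T.q.denom) (h ^ (m + 3) * w)
      = h * (h ^ m * w') := by
    have d1 : ∀ (n : ℕ) (w : K[X]), ∃ w', derivative (h ^ (n + 1) * w) = h ^ n * w' := by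
      intro n w
      refine ⟨(n + 1) * derivative h * w + h * derivative w, ?_⟩
      rw [derivative_mul, derivative_pow]
      simp only [Nat.add_sub_cancel, map_natCast]
      push_cast
      ring
    obtain ⟨w₁, e₁⟩ := d1 (m + 2) w
    obtain ⟨w₂, e₂⟩ := d1 (m + 1) w₁
    rw [polyOp_apply, e₁, e₂]
    exact ⟨T.p.num * T.q.denom * T.r.denom * w₂ + T.q.num * T.p.denom * T.r.denom * h * w₁
      + T.r.num * T.p.denom * T.q.denom * h ^ 2 * w, by ring⟩
  refine ⟨u + h ^ m * w', add_mem (Submodule.mem_sup_left hu) (Submodule.mem_sup_right ⟨w', rfl⟩),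
    ?_⟩
  rw [map_add, T.apply_add, e, (T.apply_eq_iff _ _).2 hw', map_add]

end Invariant

section NormalForm

local notation "ι" => algebraMap ℝ[X] (RatFunc ℝ)

/-- Over `ℂ`, where the poles of the coefficients live, the codimension is still finite. -/
theorem finiteDimensional_complex_span {E : Finset ℕ} {y : ℕ → ℝ[X]}
    (hy : ∀ k ∉ E, (y k).degree = k) : FiniteDimensional ℂ (ℂ[X] ⧸ Submodule.span ℂ
      {v : ℂ[X] | ∃ k ∉ E, v = (y k).map (algebraMap ℝ ℂ)}) :=
  finiteDimensional_quotient_span fun k hk => by rw [degree_map, hy k hk]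

theorem complex_span_invariant {P Q R h : ℝ[X]} {E : Finset ℕ} {y : ℕ → ℝ[X]} {l : ℕ → ℝ}
    (heig : ∀ k ∉ E, polyOp P Q R (y k) = h * (C (l k) * y k)) :
    ∀ v ∈ Submodule.span ℂ {v : ℂ[X] | ∃ k ∉ E, v = (y k).map (algebraMap ℝ ℂ)},
      ∃ u ∈ Submodule.span ℂ {v : ℂ[X] | ∃ k ∉ E, v = (y k).map (algebraMap ℝ ℂ)},
        polyOp (P.map (algebraMap ℝ ℂ)) (Q.map (algebraMap ℝ ℂ)) (R.map (algebraMap ℝ ℂ)) v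
          = h.map (algebraMap ℝ ℂ) * u := by
  intro v hv
  induction hv using Submodule.span_induction with
  | mem x hx =>
    obtain ⟨k, hk, rfl⟩ := hx
    refine ⟨(l k : ℂ) • (y k).map (algebraMap ℝ ℂ),
      Submodule.smul_mem _ _ (Submodule.subset_span ⟨k, hk, rfl⟩), ?_⟩
    have := congrArg (Polynomial.map (algebraMap ℝ ℂ)) (heig k hk)
    rw [polyOp_apply] at this ⊢
    simp only [Polynomial.map_add, Polynomial.map_mul, ← derivative_map, Polynomial.map_C] at this
    rw [this, smul_eq_C_mul]
    rfl
  | zero => exact ⟨0, zero_mem _, by simp⟩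
  | add x z _ _ hx hz =>
    obtain ⟨u, hu, e⟩ := hx
    obtain ⟨w, hw, e'⟩ := hz
    exact ⟨u + w, add_mem hu hw, by rw [map_add, e, e', mul_add]⟩
  | smul c x _ hx =>
    obtain ⟨u, hu, e⟩ := hx
    exact ⟨c • u, Submodule.smul_mem _ _ hu, by rw [map_smul, e, mul_smul_comm]⟩

variable {T : DiffOp2 ℝ} {E : Finset ℕ} {y : ℕ → ℝ[X]}

theorem exists_eigenvalues (heig : ∀ k ∉ E, T.HasEigenpoly (y k)) :
    ∃ l : ℕ → ℝ, (∀ k ∉ E, T.apply (ι (y k)) = ι (C (l k) * y k)) ∧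
      ∀ k ∉ E, polyOp (T.p.num * T.q.denom * T.r.denom) (T.q.num * T.p.denom * T.r.denom)
        (T.r.num * T.p.denom * T.q.denom) (y k)
        = T.p.denom * T.q.denom * T.r.denom * (C (l k) * y k) := by
  classical
  choose l hl using heig
  refine ⟨fun k => if h : k ∉ E then l k h else 0, ?_, ?_⟩
  · intro k hk
    simp only [dif_pos hk]
    rw [hl k hk, C_mul_algebraMap]
  · intro k hk
    simp only [dif_pos hk]
    rw [← T.apply_eq_iff, hl k hk, C_mul_algebraMap]

/-- The leading coefficient of an operator with eigenpolynomials in almost all degrees is a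
polynomial. -/
theorem denom_p_eq_one (hy : ∀ k ∉ E, (y k).degree = k) (heig : ∀ k ∉ E, T.HasEigenpoly (y k)) :
    T.p.denom = 1 := by
  obtain ⟨l, -, hl⟩ := exists_eigenvalues heig
  have hfin := finiteDimensional_complex_span hy
  have hinv := complex_span_invariant hl
  have hm : ∀ {f : ℝ[X]}, f ≠ 0 → f.map (algebraMap ℝ ℂ) ≠ 0 := fun hf =>
    (Polynomial.map_ne_zero_iff (algebraMap ℝ ℂ).injective).2 hf
  simp only [Polynomial.map_mul] at hinv
  have h := denom_p_eval_ne_zero (hm (RatFunc.num_ne_zero T.p_ne_zero)) (hm T.p.denom_ne_zero)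
    (hm T.q.denom_ne_zero) (hm T.r.denom_ne_zero)
    (T.p.isCoprime_num_denom.map (Polynomial.mapRingHom (algebraMap ℝ ℂ))) hinv
  have hdeg : (T.p.denom.map (algebraMap ℝ ℂ)).degree = 0 := by
    by_contra hd
    obtain ⟨ξ, hξ⟩ := IsAlgClosed.exists_root _ hd
    exact h ξ hξ
  rw [degree_map] at hdeg
  exact T.p.monic_denom.natDegree_eq_zero.1 (natDegree_eq_of_degree_eq_some hdeg)

theorem denom_q_complex_local (hy : ∀ k ∉ E, (y k).degree = k)
    (heig : ∀ k ∉ E, T.HasEigenpoly (y k)) {ξ : ℂ} (hξ : aeval ξ T.q.denom = 0) :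
    aeval ξ (derivative T.q.denom) ≠ 0 ∧ aeval ξ T.p.num ≠ 0 ∧ ∃ ν : ℕ,
      aeval ξ T.q.num + 2 * ν * aeval ξ T.p.num * aeval ξ (derivative T.q.denom) = 0 := by
  obtain ⟨l, -, hl⟩ := exists_eigenvalues heig
  rw [denom_p_eq_one hy heig, mul_one, mul_one, one_mul] at hl
  have hfin := finiteDimensional_complex_span hy
  have hinv := complex_span_invariant hl
  have hm : ∀ {f : ℝ[X]}, f ≠ 0 → f.map (algebraMap ℝ ℂ) ≠ 0 := fun hf =>
    (Polynomial.map_ne_zero_iff (algebraMap ℝ ℂ).injective).2 hf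
  simp only [Polynomial.map_mul] at hinv
  have := denom_q_local (hm (RatFunc.num_ne_zero T.p_ne_zero))
    (hm T.q.denom_ne_zero) (hm T.r.denom_ne_zero)
    (T.q.isCoprime_num_denom.map (Polynomial.mapRingHom (algebraMap ℝ ℂ))) hinv (ξ := ξ)
    (by rw [eval_map_algebraMap]; exact hξ)
  simpa only [derivative_map, coe_mapRingHom, eval_map_algebraMap] using this

/-- The shape of an operator with eigenpolynomials in all but finitely many degrees: `p` is a
polynomial of degree at most two, and `q = Q - 2 p η' / η` with `Q` linear and `η` a polynomial. In
terms of `n = k - deg η`, the eigenvalue in degree `k` is that of `p D² + Q D` in degree `n`, up to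
an additive constant. -/
structure NormalForm (T : DiffOp2 ℝ) (p Q η : ℝ[X]) (c : ℝ) : Prop where
  p_ne_zero : p ≠ 0
  η_ne_zero : η ≠ 0
  p_eq : T.p = ι p
  natDegree_p : p.natDegree ≤ 2
  natDegree_Q : Q.natDegree ≤ 1
  q_eq : T.q * ι η = ι Q * ι η - 2 * ι p * ι (derivative η)
  eigenvalue : ∀ (f : ℝ[X]) (k : ℕ) (l : ℝ), f.degree = k → T.apply (ι f) = ι (C l * f) →
    l = p.coeff 2 * (((k : ℝ) - η.natDegree) * ((k - η.natDegree) - 1))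
      + Q.coeff 1 * (k - η.natDegree) + c
  nonconst : p.coeff 2 ≠ 0 ∨ Q.coeff 1 ≠ 0
  natDegree_le : ∀ f g : ℝ[X], T.apply (ι f) = ι g → g.natDegree ≤ f.natDegree

/-- The polynomial `η` removes the poles of `q`; the degree bounds and the eigenvalues come from the
top coefficients of `T` with its denominators cleared. -/
theorem exists_normalForm (hy : ∀ k ∉ E, (y k).degree = k)
    (heig : ∀ k ∉ E, T.HasEigenpoly (y k)) : ∃ p Q η c, NormalForm T p Q η c := by
  obtain ⟨l, hl', hl⟩ := exists_eigenvalues heig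
  have hdp := denom_p_eq_one hy heig
  have hiff := T.apply_eq_iff
  rw [hdp, mul_one, mul_one, one_mul] at hl hiff
  set p := T.p.num with hp
  set n := T.q.num with hn
  set d := T.q.denom with hd
  set e := T.r.denom with he
  have hp0 : p ≠ 0 := RatFunc.num_ne_zero T.p_ne_zero
  have hd0 : d ≠ 0 := T.q.denom_ne_zero
  have he0 : e ≠ 0 := T.r.denom_ne_zero
  have hdm : d.Monic := T.q.monic_denom
  have hem : e.Monic := T.r.monic_denom
  have hh : (d * e).Monic := hdm.mul hem
  obtain ⟨hP, hQ', hR⟩ := natDegree_le_of_eigen hy hl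
  have hpdeg : p.natDegree ≤ 2 := by
    rw [mul_assoc, natDegree_mul hp0 hh.ne_zero] at hP
    omega
  have hndeg : n.natDegree ≤ d.natDegree + 1 := by
    by_cases hn0 : n = 0
    · simp [hn0]
    rw [natDegree_mul hn0 he0, natDegree_mul hd0 he0] at hQ'
    omega
  obtain ⟨η, Q, hη, hQ⟩ := exists_eta (p := p) (n := n) hd0
    (fun ξ hξ => ⟨(denom_q_complex_local hy heig hξ).1, (denom_q_complex_local hy heig hξ).2.2⟩)
    (fun ξ hξ => (denom_q_complex_local hy heig hξ).2.1)
  have hXQ : Q * (d * (X * η)) = n * (X * η) + 2 * (p * (d * (X * derivative η))) := by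
    linear_combination X * hQ
  have hXη : (X * η).natDegree = 1 + η.natDegree := by rw [natDegree_X_mul hη, add_comm]
  have hXη' := natDegree_X_mul_derivative_le η
  have hQdeg : Q.natDegree ≤ 1 := by
    by_cases hQ0 : Q = 0
    · simp [hQ0]
    have h1 := congrArg natDegree hXQ
    rw [natDegree_mul hQ0 (mul_ne_zero hd0 (mul_ne_zero X_ne_zero hη)),
      natDegree_mul hd0 (mul_ne_zero X_ne_zero hη), hXη] at h1
    have h2 := natDegree_add_le (n * (X * η)) (2 * (p * (d * (X * derivative η))))
    have h3 : (n * (X * η)).natDegree ≤ n.natDegree + (1 + η.natDegree) :=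
      hXη ▸ natDegree_mul_le
    have h4 : (2 * (p * (d * (X * derivative η)))).natDegree
        ≤ 2 + (d.natDegree + η.natDegree) := by
      refine natDegree_mul_le.trans ?_
      rw [show (2 : ℝ[X]) = C 2 from rfl, natDegree_C, zero_add]
      refine natDegree_mul_le.trans (add_le_add hpdeg (natDegree_mul_le.trans ?_))
      omega
    omega
  -- comparison of leading coefficients
  have hlead : Q.coeff 1 = n.coeff (d.natDegree + 1) + 2 * (p.coeff 2 * η.natDegree) := by
    have h1 := congrArg (fun f => coeff f (1 + (d.natDegree + (1 + η.natDegree)))) hXQ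
    simp only [coeff_add] at h1
    have hηX : (X * η).coeff (1 + η.natDegree) = η.leadingCoeff := by
      rw [add_comm, coeff_X_mul, leadingCoeff]
    have t1 : (Q * (d * (X * η))).coeff (1 + (d.natDegree + (1 + η.natDegree)))
        = Q.coeff 1 * η.leadingCoeff := by
      rw [coeff_mul_add_eq_of_natDegree_le hQdeg (natDegree_mul_le.trans (by omega)),
        coeff_mul_add_eq_of_natDegree_le le_rfl hXη.le, hηX, hdm.coeff_natDegree, one_mul]
    have t2 : (n * (X * η)).coeff (1 + (d.natDegree + (1 + η.natDegree)))
        = n.coeff (d.natDegree + 1) * η.leadingCoeff := by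
      rw [show 1 + (d.natDegree + (1 + η.natDegree)) = (d.natDegree + 1) + (1 + η.natDegree) by ring,
        coeff_mul_add_eq_of_natDegree_le hndeg hXη.le, hηX]
    have t3 : (2 * (p * (d * (X * derivative η)))).coeff (1 + (d.natDegree + (1 + η.natDegree)))
        = 2 * (p.coeff 2 * (η.natDegree * η.leadingCoeff)) := by
      rw [show (2 : ℝ[X]) = C 2 from rfl, coeff_C_mul,
        show 1 + (d.natDegree + (1 + η.natDegree)) = 2 + (d.natDegree + η.natDegree) by ring,
        coeff_mul_add_eq_of_natDegree_le hpdeg (natDegree_mul_le.trans (by omega)),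
        coeff_mul_add_eq_of_natDegree_le le_rfl hXη', coeff_X_mul_derivative,
        hdm.coeff_natDegree, one_mul, leadingCoeff]
    rw [t1, t2, t3] at h1
    apply mul_right_cancel₀ (leadingCoeff_ne_zero.2 hη)
    linear_combination h1
  have c2 : (p * d * e).coeff ((d * e).natDegree + 2) = p.coeff 2 := by
    rw [mul_assoc, add_comm, coeff_mul_add_eq_of_natDegree_le hpdeg le_rfl, hh.coeff_natDegree,
      mul_one]
  have c1 : (n * e).coeff ((d * e).natDegree + 1) = n.coeff (d.natDegree + 1) := by
    rw [natDegree_mul hd0 he0, show d.natDegree + e.natDegree + 1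
      = (d.natDegree + 1) + e.natDegree by ring, coeff_mul_add_eq_of_natDegree_le hndeg le_rfl,
      hem.coeff_natDegree, mul_one]
  have heigen : ∀ (f : ℝ[X]) (k : ℕ) (l : ℝ), f.degree = k → T.apply (ι f) = ι (C l * f) →
      l = p.coeff 2 * (k * (k - 1)) + n.coeff (d.natDegree + 1) * k
        + (T.r.num * d).coeff (d * e).natDegree := by
    intro f k l hf hfl
    rw [← c1, ← c2]
    exact eigenvalue_eq hP hQ' hR hh hf ((hiff _ _).1 hfl)
  refine ⟨p, Q, η, (T.r.num * d).coeff (d * e).natDegree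
    - p.coeff 2 * (η.natDegree ^ 2 + η.natDegree) + Q.coeff 1 * η.natDegree, hp0, hη, ?_, hpdeg,
    hQdeg, ?_, ?_, ?_, ?_⟩
  · conv_lhs => rw [← RatFunc.num_div_denom T.p, hdp]
    simp [hp]
  · have hq : T.q * ι d = ι n := by
      have h := algebraMap_ratFunc_ne_zero hd0
      have := RatFunc.num_div_denom T.q
      rw [div_eq_iff h] at this
      exact this.symm
    have h := congrArg ι hQ
    simp only [map_mul, map_add, map_ofNat] at h
    apply mul_right_cancel₀ (algebraMap_ratFunc_ne_zero hd0)
    linear_combination ι η * hq - h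
  · intro f k l hf hfl
    rw [heigen f k l hf hfl, hlead]
    ring
  · by_contra! hcon
    obtain ⟨h1, h2⟩ := hcon
    rw [h1, h2] at hlead
    have h3 : n.coeff (d.natDegree + 1) = 0 := by linear_combination -hlead
    refine eigenvalue_not_const (mul_ne_zero (mul_ne_zero hp0 hd0) he0) hy
      ((T.r.num * d).coeff (d * e).natDegree) (h := d * e) (Q := n * e) (R := T.r.num * d) ?_
    intro k hk
    have := heigen (y k) k (l k) (hy k hk) (hl' k hk)
    rw [h1, h3, zero_mul, zero_mul, zero_add, zero_add] at this
    rw [← this]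
    exact hl k hk
  · intro f g hfg
    have h1 := natDegree_polyOp_le hP hQ' hR (le_refl f.natDegree)
    rw [(hiff f g).1 hfg] at h1
    by_cases hg : g = 0
    · simp [hg]
    rw [natDegree_mul hh.ne_zero hg] at h1
    omega

end NormalForm

/-! ### Integration against the weight -/

section Weight

local notation "ι" => algebraMap ℝ[X] (RatFunc ℝ)

theorem isOpen_openInterval (a b : EReal) : IsOpen (openInterval a b) :=
  (isOpen_Ioo (a := a) (b := b)).preimage continuous_coe_real_ereal

theorem ordConnected_openInterval (a b : EReal) : (openInterval a b).OrdConnected :=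
  ⟨fun _ hx _ hy _ hz => ⟨hx.1.trans_le (EReal.coe_le_coe_iff.2 hz.1),
    (EReal.coe_le_coe_iff.2 hz.2).trans_lt hy.2⟩⟩

theorem openInterval_nonempty {a b : EReal} (h : a < b) : (openInterval a b).Nonempty := by
  obtain ⟨x, h1, h2⟩ := EReal.lt_iff_exists_real_btwn.1 h
  exact ⟨x, h1, h2⟩

theorem neBot_left {a b : EReal} (h : a < b) : (comap Real.toEReal (𝓝[>] a)).NeBot := by
  rw [comap_neBot_iff]
  intro t ht
  obtain ⟨u, hu, hut⟩ := (mem_nhdsGT_iff_exists_Ioo_subset' h).1 ht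
  obtain ⟨x, h1, h2⟩ := EReal.lt_iff_exists_real_btwn.1 hu
  exact ⟨x, hut ⟨h1, h2⟩⟩

theorem neBot_right {a b : EReal} (h : a < b) : (comap Real.toEReal (𝓝[<] b)).NeBot := by
  rw [comap_neBot_iff]
  intro t ht
  obtain ⟨u, hu, hut⟩ := (mem_nhdsLT_iff_exists_Ioo_subset' h).1 ht
  obtain ⟨x, h1, h2⟩ := EReal.lt_iff_exists_real_btwn.1 hu
  exact ⟨x, hut ⟨h1, h2⟩⟩

theorem eventually_left {a c : EReal} (h : a < c) :
    ∀ᶠ x : ℝ in comap Real.toEReal (𝓝[>] a), a < (x : EReal) ∧ (x : EReal) < c :=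
  (eventually_comap.2 ((Ioo_mem_nhdsGT h : Set.Ioo a c ∈ 𝓝[>] a) |> Filter.mem_of_superset <|
    fun _ hy _ hx => by rw [← hx] at hy; exact hy))

theorem eventually_right {b c : EReal} (h : c < b) :
    ∀ᶠ x : ℝ in comap Real.toEReal (𝓝[<] b), c < (x : EReal) ∧ (x : EReal) < b :=
  (eventually_comap.2 ((Ioo_mem_nhdsLT h : Set.Ioo c b ∈ 𝓝[<] b) |> Filter.mem_of_superset <|
    fun _ hy _ hx => by rw [← hx] at hy; exact hy))

theorem ratEval_algebraMap (f : ℝ[X]) (x : ℝ) : ratEval (ι f) x = f.eval x := by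
  simp [ratEval, RatFunc.eval_algebraMap]

theorem ratEval_mul_denom (f : RatFunc ℝ) {x : ℝ} (hx : f.denom.eval x ≠ 0) :
    ratEval f x * f.denom.eval x = f.num.eval x := by
  rw [ratEval, RatFunc.eval, eval₂_id, eval₂_id, div_mul_cancel₀ _ hx]

variable {T : DiffOp2 ℝ} {a b : EReal} {W : ℝ → ℝ} {E : Finset ℕ} {y : ℕ → ℝ[X]} {p Q η : ℝ[X]}
  {c : ℝ}

theorem IsSLOPS.integrableOn_mul (h : IsSLOPS T a b W E y) (u : ℝ[X]) :
    IntegrableOn (fun x => u.eval x * W x) (openInterval a b) := by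
  induction u using Polynomial.induction_on' with
  | add u v hu hv =>
    simp only [eval_add, add_mul]
    exact hu.add hv
  | monomial n c =>
    simp only [eval_monomial, mul_assoc]
    exact (h.moments n).const_mul c

/-- The linear functional `u ↦ ∫ u W` on polynomials. -/
noncomputable def weightFunctional (a b : EReal) (W : ℝ → ℝ) (u : ℝ[X]) : ℝ :=
  ∫ x in openInterval a b, u.eval x * W x

theorem IsSLOPS.weightFunctional_add (h : IsSLOPS T a b W E y) (u v : ℝ[X]) :
    weightFunctional a b W (u + v) = weightFunctional a b W u + weightFunctional a b W v := by
  simp only [weightFunctional, eval_add, add_mul]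
  exact integral_add (h.integrableOn_mul u) (h.integrableOn_mul v)

theorem weightFunctional_C_mul (k : ℝ) (u : ℝ[X]) :
    weightFunctional a b W (C k * u) = k * weightFunctional a b W u := by
  simp only [weightFunctional, eval_mul, eval_C, mul_assoc]
  exact integral_const_mul k _

theorem IsSLOPS.weightFunctional_sq_pos (h : IsSLOPS T a b W E y) {u : ℝ[X]} (hu : u ≠ 0) :
    0 < weightFunctional a b W (u ^ 2) := by
  have hnn : 0 ≤ᵐ[volume.restrict (openInterval a b)] fun x => (u ^ 2).eval x * W x := by
    filter_upwards [ae_restrict_mem (isOpen_openInterval a b).measurableSet] with x hx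
    rw [eval_pow]
    exact mul_nonneg (sq_nonneg _) (h.weight.pos x hx).le
  rw [weightFunctional, setIntegral_pos_iff_support_of_nonneg_ae hnn (h.integrableOn_mul _)]
  have hopen : IsOpen (openInterval a b ∩ {x | u.eval x ≠ 0}) :=
    (isOpen_openInterval a b).inter (isOpen_ne_fun u.continuous continuous_const)
  have hne : (openInterval a b ∩ {x | u.eval x ≠ 0}).Nonempty := by
    by_contra hcon
    rw [Set.not_nonempty_iff_eq_empty] at hcon
    have hinf : (openInterval a b).Infinite :=
      infinite_of_mem_nhds _ ((isOpen_openInterval a b).mem_nhds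
        (openInterval_nonempty h.lt).choose_spec)
    refine hinf ((u.roots.toFinset.finite_toSet).subset fun x hx => ?_)
    have : ¬ u.eval x ≠ 0 := fun hx' => by
      have : x ∈ openInterval a b ∩ {x | u.eval x ≠ 0} := ⟨hx, hx'⟩
      rw [hcon] at this; exact this
    simpa [hu] using not_not.1 this
  refine (hopen.measure_pos volume hne).trans_le (measure_mono fun x hx => ⟨?_, hx.1⟩)
  rw [Function.mem_support, eval_pow]
  exact mul_ne_zero (pow_ne_zero _ hx.2) (h.weight.pos x hx.1).ne'

/-- The Pearson equation `(p W)' = q W` in the form `(w p W)' = (p w' + q w) W`, away from the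
exceptional points. -/
theorem IsSLOPS.hasDerivAt (h : IsSLOPS T a b W E y) (nf : NormalForm T p Q η c) {w v : ℝ[X]}
    (hwv : ι p * ι (derivative w) + T.q * ι w = ι v) {x : ℝ} (hx : x ∈ openInterval a b)
    (hp : p.eval x ≠ 0) (hq : T.q.denom.eval x ≠ 0) :
    HasDerivAt (fun t => w.eval t * p.eval t * W t) (v.eval x * W x) x := by
  have h1 := h.weight.deriv x hx (by rw [denom_p_eq_one h.degree_eq h.eigen]; simp) hq
    (by rwa [nf.p_eq, ratEval_algebraMap])
  simp only [nf.p_eq, ratEval_algebraMap] at h1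
  have h2 := (w.hasDerivAt x).mul h1
  have hqd : T.q * ι T.q.denom = ι T.q.num := by
    have := RatFunc.num_div_denom T.q
    rw [div_eq_iff (algebraMap_ratFunc_ne_zero T.q.denom_ne_zero)] at this
    exact this.symm
  have hpoly : v * T.q.denom = p * derivative w * T.q.denom + T.q.num * w := by
    apply RatFunc.algebraMap_injective ℝ
    simp only [map_mul, map_add, ← hwv, ← hqd]
    ring
  have hev := congrArg (eval x) hpoly
  simp only [eval_mul, eval_add] at hev
  rw [← ratEval_mul_denom T.q hq] at hev
  have hev' : v.eval x = p.eval x * (derivative w).eval x + ratEval T.q x * w.eval x := by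
    apply mul_right_cancel₀ hq; linear_combination hev
  refine (h2.congr_deriv ?_).congr_of_eventuallyEq (Eventually.of_forall fun t => ?_)
  · rw [hev']; field_simp
  · simp only [Pi.mul_apply]; ring

/-- The integral of an exact derivative `(w p W)' = v W` vanishes, because the boundary terms do. -/
theorem IsSLOPS.weightFunctional_eq_zero (h : IsSLOPS T a b W E y) (nf : NormalForm T p Q η c)
    {w v : ℝ[X]} (hwv : ι p * ι (derivative w) + T.q * ι w = ι v) :
    weightFunctional a b W v = 0 := by
  set F : ℝ → ℝ := fun t => w.eval t * p.eval t * W t with hF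
  have hFc : ContinuousOn F (openInterval a b) :=
    (w.continuous.mul p.continuous).continuousOn.mul h.weight.cont
  have hbad : ({x : ℝ | (p * T.q.denom).eval x = 0}).Countable := by
    refine Set.Finite.countable (((p * T.q.denom).roots.toFinset.finite_toSet).subset fun x hx => ?_)
    simpa [nf.p_ne_zero, T.q.denom_ne_zero] using hx
  have hint : ∀ s ∈ openInterval a b, ∀ t ∈ openInterval a b, s ≤ t →
      ∫ x in s..t, v.eval x * W x = F t - F s := by
    intro s hs t ht hst
    have hsub : Set.Icc s t ⊆ openInterval a b := (ordConnected_openInterval a b).out hs ht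
    refine integral_eq_of_hasDerivAt_off_countable_of_le _ _ hst hbad
      (hFc.mono hsub) ?_ ?_
    · intro x hx
      have hx2 : (p * T.q.denom).eval x ≠ 0 := hx.2
      rw [eval_mul] at hx2
      exact h.hasDerivAt nf hwv (hsub (Set.Ioo_subset_Icc_self hx.1)) (left_ne_zero_of_mul hx2)
        (right_ne_zero_of_mul hx2)
    · rw [intervalIntegrable_iff_integrableOn_Icc_of_le hst]
      exact (h.integrableOn_mul v).mono_set hsub
  have := neBot_left h.lt
  have := neBot_right h.lt
  obtain ⟨s, hs⟩ := exists_seq_tendsto (comap Real.toEReal (𝓝[>] a))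
  obtain ⟨t, ht⟩ := exists_seq_tendsto (comap Real.toEReal (𝓝[<] b))
  have hcover : AECover (volume.restrict (openInterval a b)) atTop
      fun n => Set.Ioc (s n) (t n) := by
    refine ⟨?_, fun n => measurableSet_Ioc⟩
    filter_upwards [ae_restrict_mem (isOpen_openInterval a b).measurableSet] with x hx
    filter_upwards [hs.eventually (eventually_left hx.1), ht.eventually (eventually_right hx.2)]
      with n h1 h2
    exact ⟨EReal.coe_lt_coe_iff.1 h1.2, (EReal.coe_lt_coe_iff.1 h2.1).le⟩
  have hlim := hcover.integral_tendsto_of_countably_generated (h.integrableOn_mul v)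
  obtain ⟨x₀, hx₀⟩ := openInterval_nonempty h.lt
  have hlim0 : Tendsto (fun n => F (t n) - F (s n)) atTop (𝓝 (0 - 0)) := by
    have hl := (h.boundary_left w).comp hs
    have hr := (h.boundary_right w).comp ht
    simp only [nf.p_eq, ratEval_algebraMap] at hl hr
    exact hr.sub hl
  refine tendsto_nhds_unique hlim ((sub_zero (0 : ℝ)) ▸ hlim0.congr' ?_)
  filter_upwards [hs.eventually (eventually_left hx₀.1), ht.eventually (eventually_right hx₀.2)]
    with n h1 h2
  have hsI : s n ∈ openInterval a b := ⟨h1.1, h1.2.trans hx₀.2⟩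
  have htI : t n ∈ openInterval a b := ⟨hx₀.1.trans h2.1, h2.2⟩
  have hst : s n ≤ t n := (EReal.coe_lt_coe_iff.1 (h1.2.trans h2.1)).le
  rw [← hint _ hsI _ htI hst, intervalIntegral.integral_of_le hst,
    Measure.restrict_restrict measurableSet_Ioc, Set.inter_eq_left.2]
  exact Set.Ioc_subset_Icc_self.trans ((ordConnected_openInterval a b).out hsI htI)

/-- Integration by parts against the weight `η² W`, whose Pearson equation has polynomial
coefficients. -/
theorem IsSLOPS.weightFunctional_eta_eq_zero (h : IsSLOPS T a b W E y)
    (nf : NormalForm T p Q η c) (w : ℝ[X]) :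
    weightFunctional a b W (η ^ 2 * (p * derivative w + Q * w)) = 0 := by
  apply h.weightFunctional_eq_zero nf (w := η ^ 2 * w)
  have := nf.q_eq
  simp only [pow_two, derivative_mul, map_mul, map_add]
  linear_combination ι η * ι w * this

/-- The operator `T` is symmetric on polynomials. -/
theorem IsSLOPS.weightFunctional_symm (h : IsSLOPS T a b W E y) (nf : NormalForm T p Q η c)
    {f g f' g' : ℝ[X]} (hf : T.apply (ι f) = ι f') (hg : T.apply (ι g) = ι g') :
    weightFunctional a b W (f * g' - f' * g) = 0 := by
  apply h.weightFunctional_eq_zero nf (w := f * derivative g - derivative f * g)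
  rw [DiffOp2.apply, nf.p_eq] at hf hg
  simp only [ratDeriv_algebraMap] at hf hg
  rw [derivative_sub]
  simp only [derivative_mul, map_mul, map_add, map_sub]
  linear_combination ι f * hg - ι g * hf

/-! ### Behaviour of the weight at the endpoints -/

/-- The function `η² p W` has logarithmic derivative `Q / p`. -/
theorem IsSLOPS.hasDerivAt_eta (h : IsSLOPS T a b W E y) (nf : NormalForm T p Q η c) {x : ℝ}
    (hx : x ∈ openInterval a b) (hp : p.eval x ≠ 0) (hq : T.q.denom.eval x ≠ 0) :
    HasDerivAt (fun t => (η ^ 2).eval t * p.eval t * W t)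
      (Q.eval x / p.eval x * ((η ^ 2).eval x * p.eval x * W x)) x := by
  have := h.hasDerivAt nf (w := η ^ 2) (v := η ^ 2 * Q) (by
    have := nf.q_eq
    simp only [pow_two, derivative_mul, map_mul, map_add]
    linear_combination ι η * this) hx hp hq
  convert this using 1
  rw [eval_mul]
  field_simp

/-- A positive nondecreasing function does not tend to zero at the right endpoint. -/
theorem not_tendsto_right {b : EReal} {G G' : ℝ → ℝ} {x₀ : ℝ} (hx₀ : (x₀ : EReal) < b)
    (hG : ∀ x : ℝ, x₀ < x → (x : EReal) < b → 0 < G x ∧ HasDerivAt G (G' x) x ∧ 0 ≤ G' x) :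
    ¬ Tendsto G (comap Real.toEReal (𝓝[<] b)) (𝓝 0) := by
  intro hlim
  have hS := isOpen_openInterval (x₀ : EReal) b
  have hmem : ∀ x ∈ openInterval (x₀ : EReal) b, x₀ < x ∧ (x : EReal) < b := fun x hx =>
    ⟨EReal.coe_lt_coe_iff.1 hx.1, hx.2⟩
  have hmono : MonotoneOn G (openInterval (x₀ : EReal) b) := by
    refine monotoneOn_of_deriv_nonneg (ordConnected_openInterval _ _).convex
      (fun x hx => (hG x (hmem x hx).1 (hmem x hx).2).2.1.continuousAt.continuousWithinAt) ?_ ?_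
    · rw [hS.interior_eq]
      exact fun x hx =>
        (hG x (hmem x hx).1 (hmem x hx).2).2.1.differentiableAt.differentiableWithinAt
    · rw [hS.interior_eq]
      intro x hx
      have := hG x (hmem x hx).1 (hmem x hx).2
      rw [this.2.1.deriv]; exact this.2.2
  obtain ⟨x₁, hx₁⟩ := openInterval_nonempty hx₀
  have := neBot_right hx₀
  have hle : G x₁ ≤ 0 := by
    refine ge_of_tendsto hlim ?_
    filter_upwards [eventually_right hx₁.2] with x hx
    exact hmono hx₁ ⟨hx₁.1.trans hx.1, hx.2⟩ (EReal.coe_lt_coe_iff.1 hx.1).le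
  exact absurd (hG x₁ (hmem x₁ hx₁).1 hx₁.2).1 (not_lt.2 hle)

theorem not_tendsto_left {a : EReal} {G G' : ℝ → ℝ} {x₀ : ℝ} (hx₀ : a < (x₀ : EReal))
    (hG : ∀ x : ℝ, x < x₀ → a < (x : EReal) → 0 < G x ∧ HasDerivAt G (G' x) x ∧ G' x ≤ 0) :
    ¬ Tendsto G (comap Real.toEReal (𝓝[>] a)) (𝓝 0) := by
  intro hlim
  have hS := isOpen_openInterval a (x₀ : EReal)
  have hmem : ∀ x ∈ openInterval a (x₀ : EReal), x < x₀ ∧ a < (x : EReal) := fun x hx =>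
    ⟨EReal.coe_lt_coe_iff.1 hx.2, hx.1⟩
  have hanti : AntitoneOn G (openInterval a (x₀ : EReal)) := by
    refine antitoneOn_of_deriv_nonpos (ordConnected_openInterval _ _).convex
      (fun x hx => (hG x (hmem x hx).1 (hmem x hx).2).2.1.continuousAt.continuousWithinAt) ?_ ?_
    · rw [hS.interior_eq]
      exact fun x hx =>
        (hG x (hmem x hx).1 (hmem x hx).2).2.1.differentiableAt.differentiableWithinAt
    · rw [hS.interior_eq]
      intro x hx
      have := hG x (hmem x hx).1 (hmem x hx).2
      rw [this.2.1.deriv]; exact this.2.2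
  obtain ⟨x₁, hx₁⟩ := openInterval_nonempty hx₀
  have := neBot_left hx₀
  have hle : G x₁ ≤ 0 := by
    refine ge_of_tendsto hlim ?_
    filter_upwards [eventually_left hx₁.1] with x hx
    exact hanti ⟨hx.1, hx.2.trans hx₁.2⟩ hx₁ (EReal.coe_lt_coe_iff.1 hx.2).le
  exact absurd (hG x₁ (hmem x₁ hx₁).1 hx₁.1).1 (not_lt.2 hle)

/-- The points where the logarithmic derivative of `η² p W` need not be `Q / p` are finite in
number. -/
theorem NormalForm.finite_bad (nf : NormalForm T p Q η c) :
    {x : ℝ | ¬(p.eval x ≠ 0 ∧ T.q.denom.eval x ≠ 0 ∧ η.eval x ≠ 0)}.Finite := by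
  refine ((p * T.q.denom * η).roots.toFinset.finite_toSet).subset fun x hx => ?_
  have : (p * T.q.denom * η) ≠ 0 :=
    mul_ne_zero (mul_ne_zero nf.p_ne_zero T.q.denom_ne_zero) nf.η_ne_zero
  simp only [Finset.mem_coe, Multiset.mem_toFinset, mem_roots this, IsRoot.def, eval_mul]
  simp only [Set.mem_ofPred_eq] at hx
  by_contra hcon
  exact hx ⟨fun h => hcon (by rw [h]; ring), fun h => hcon (by rw [h]; ring),
    fun h => hcon (by rw [h]; ring)⟩

theorem IsSLOPS.exists_good_right (h : IsSLOPS T a b W E y) (nf : NormalForm T p Q η c)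
    {x₁ : ℝ} (hx₁ : (x₁ : EReal) < b) : ∃ x₀ ∈ openInterval a b, x₁ ≤ x₀ ∧
      ∀ x : ℝ, x₀ < x → (x : EReal) < b →
        p.eval x ≠ 0 ∧ T.q.denom.eval x ≠ 0 ∧ η.eval x ≠ 0 := by
  obtain ⟨z, hz⟩ := openInterval_nonempty h.lt
  have hfin : ({x : ℝ | ¬(p.eval x ≠ 0 ∧ T.q.denom.eval x ≠ 0 ∧ η.eval x ≠ 0)}
      ∩ {x | (x : EReal) < b} ∪ {z, x₁}).Finite :=
    (nf.finite_bad.inter_of_left _).union (Set.toFinite _)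
  obtain ⟨m, hm, hmax⟩ := hfin.exists_maximalFor id _ ⟨z, Or.inr (by simp)⟩
  have hmax' : ∀ x ∈ ({x : ℝ | ¬(p.eval x ≠ 0 ∧ T.q.denom.eval x ≠ 0 ∧ η.eval x ≠ 0)}
      ∩ {x | (x : EReal) < b} ∪ {z, x₁}), x ≤ m := fun x hx => by
    rcases le_total x m with h | h
    · exact h
    · exact hmax hx h
  have hmb : (m : EReal) < b := by
    rcases hm with hm | rfl | rfl
    · exact hm.2
    · exact hz.2
    · exact hx₁
  refine ⟨m, ⟨hz.1.trans_le (EReal.coe_le_coe_iff.2 (hmax' z (Or.inr (by simp)))), hmb⟩,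
    hmax' x₁ (Or.inr (by simp)), fun x hx hxb => ?_⟩
  by_contra hcon
  exact absurd (hmax' x (Or.inl ⟨hcon, hxb⟩)) (not_le.2 hx)

theorem IsSLOPS.exists_good_left (h : IsSLOPS T a b W E y) (nf : NormalForm T p Q η c)
    {x₁ : ℝ} (hx₁ : a < (x₁ : EReal)) : ∃ x₀ ∈ openInterval a b, x₀ ≤ x₁ ∧
      ∀ x : ℝ, x < x₀ → a < (x : EReal) →
        p.eval x ≠ 0 ∧ T.q.denom.eval x ≠ 0 ∧ η.eval x ≠ 0 := by
  obtain ⟨z, hz⟩ := openInterval_nonempty h.lt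
  have hfin : ({x : ℝ | ¬(p.eval x ≠ 0 ∧ T.q.denom.eval x ≠ 0 ∧ η.eval x ≠ 0)}
      ∩ {x | a < (x : EReal)} ∪ {z, x₁}).Finite :=
    (nf.finite_bad.inter_of_left _).union (Set.toFinite _)
  obtain ⟨m, hm, hmin⟩ := hfin.exists_minimalFor id _ ⟨z, Or.inr (by simp)⟩
  have hmin' : ∀ x ∈ ({x : ℝ | ¬(p.eval x ≠ 0 ∧ T.q.denom.eval x ≠ 0 ∧ η.eval x ≠ 0)}
      ∩ {x | a < (x : EReal)} ∪ {z, x₁}), m ≤ x := fun x hx => by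
    rcases le_total m x with h | h
    · exact h
    · exact hmin hx h
  have hma : a < (m : EReal) := by
    rcases hm with hm | rfl | rfl
    · exact hm.2
    · exact hz.1
    · exact hx₁
  refine ⟨m, ⟨hma, (EReal.coe_le_coe_iff.2 (hmin' z (Or.inr (by simp)))).trans_lt hz.2⟩,
    hmin' x₁ (Or.inr (by simp)), fun x hx hxa => ?_⟩
  by_contra hcon
  exact absurd (hmin' x (Or.inl ⟨hcon, hxa⟩)) (not_le.2 hx)

/-- If `g η² p W` moves away from zero towards the right endpoint, it does not tend to zero there.
Squaring makes the argument independent of the sign of `p`. -/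
theorem IsSLOPS.not_tendsto_mul_right (h : IsSLOPS T a b W E y) (nf : NormalForm T p Q η c)
    {g γ : ℝ → ℝ} {x₁ : ℝ} (hx₁ : (x₁ : EReal) < b)
    (hg : ∀ x : ℝ, x₁ < x → (x : EReal) < b →
      g x ≠ 0 ∧ HasDerivAt g (γ x * g x) x ∧ 0 ≤ γ x + Q.eval x / p.eval x) :
    ¬ Tendsto (fun x => g x * ((η ^ 2).eval x * p.eval x * W x))
      (comap Real.toEReal (𝓝[<] b)) (𝓝 0) := by
  intro hlim
  obtain ⟨x₀, hx₀, hx₁₀, hgood⟩ := h.exists_good_right nf hx₁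
  have hlim2 := hlim.pow 2
  rw [zero_pow two_ne_zero] at hlim2
  refine not_tendsto_right (x₀ := x₀) hx₀.2 (G' := fun x => 2 * (γ x + Q.eval x / p.eval x)
    * (g x * ((η ^ 2).eval x * p.eval x * W x)) ^ 2) (fun x hx hxb => ?_) hlim2
  obtain ⟨h1, h2, h3⟩ := hgood x hx hxb
  have hxI : x ∈ openInterval a b := ⟨hx₀.1.trans (EReal.coe_lt_coe_iff.2 hx), hxb⟩
  obtain ⟨g1, g2, g3⟩ := hg x (hx₁₀.trans_lt hx) hxb
  refine ⟨?_, ?_, mul_nonneg (mul_nonneg two_pos.le g3) (sq_nonneg _)⟩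
  · have hne : (η ^ 2).eval x * p.eval x * W x ≠ 0 := by
      rw [eval_pow]
      exact mul_ne_zero (mul_ne_zero (pow_ne_zero _ h3) h1) (h.weight.pos x hxI).ne'
    exact sq_pos_of_ne_zero (mul_ne_zero g1 hne)
  · have := (g2.mul (h.hasDerivAt_eta nf hxI h1 h2)).pow 2
    refine this.congr_deriv ?_
    simp only [Pi.mul_apply]
    push_cast
    ring

theorem IsSLOPS.not_tendsto_mul_left (h : IsSLOPS T a b W E y) (nf : NormalForm T p Q η c)
    {g γ : ℝ → ℝ} {x₁ : ℝ} (hx₁ : a < (x₁ : EReal))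
    (hg : ∀ x : ℝ, x < x₁ → a < (x : EReal) →
      g x ≠ 0 ∧ HasDerivAt g (γ x * g x) x ∧ γ x + Q.eval x / p.eval x ≤ 0) :
    ¬ Tendsto (fun x => g x * ((η ^ 2).eval x * p.eval x * W x))
      (comap Real.toEReal (𝓝[>] a)) (𝓝 0) := by
  intro hlim
  obtain ⟨x₀, hx₀, hx₁₀, hgood⟩ := h.exists_good_left nf hx₁
  have hlim2 := hlim.pow 2
  rw [zero_pow two_ne_zero] at hlim2
  refine not_tendsto_left (x₀ := x₀) hx₀.1 (G' := fun x => 2 * (γ x + Q.eval x / p.eval x)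
    * (g x * ((η ^ 2).eval x * p.eval x * W x)) ^ 2) (fun x hx hxb => ?_) hlim2
  obtain ⟨h1, h2, h3⟩ := hgood x hx hxb
  have hxI : x ∈ openInterval a b := ⟨hxb, (EReal.coe_lt_coe_iff.2 hx).trans hx₀.2⟩
  obtain ⟨g1, g2, g3⟩ := hg x (hx.trans_le hx₁₀) hxb
  refine ⟨?_, ?_, mul_nonpos_of_nonpos_of_nonneg (by linarith) (sq_nonneg _)⟩
  · have hne : (η ^ 2).eval x * p.eval x * W x ≠ 0 := by
      rw [eval_pow]
      exact mul_ne_zero (mul_ne_zero (pow_ne_zero _ h3) h1) (h.weight.pos x hxI).ne'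
    exact sq_pos_of_ne_zero (mul_ne_zero g1 hne)
  · have := (g2.mul (h.hasDerivAt_eta nf hxI h1 h2)).pow 2
    refine this.congr_deriv ?_
    simp only [Pi.mul_apply]
    push_cast
    ring

end Weight

section Endpoints

variable {T : DiffOp2 ℝ} {a b : EReal} {W : ℝ → ℝ} {E : Finset ℕ} {y : ℕ → ℝ[X]} {p Q η : ℝ[X]}
  {c : ℝ}

theorem IsSLOPS.tendsto_right (h : IsSLOPS T a b W E y) (nf : NormalForm T p Q η c) (u : ℝ[X]) :
    Tendsto (fun x => u.eval x * ((η ^ 2).eval x * p.eval x * W x))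
      (comap Real.toEReal (𝓝[<] b)) (𝓝 0) := by
  have := h.boundary_right (u * η ^ 2)
  simp only [nf.p_eq, ratEval_algebraMap, eval_mul] at this
  refine this.congr fun x => by ring

theorem IsSLOPS.tendsto_left (h : IsSLOPS T a b W E y) (nf : NormalForm T p Q η c) (u : ℝ[X]) :
    Tendsto (fun x => u.eval x * ((η ^ 2).eval x * p.eval x * W x))
      (comap Real.toEReal (𝓝[>] a)) (𝓝 0) := by
  have := h.boundary_left (u * η ^ 2)
  simp only [nf.p_eq, ratEval_algebraMap, eval_mul] at this
  refine this.congr fun x => by ring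

/-- Near a point that is not a zero of `p`, the logarithmic derivative `Q / p` is bounded. -/
theorem exists_bound_near {x₀ : ℝ} (hp : p.eval x₀ ≠ 0) : ∃ M ε : ℝ, 0 < ε ∧
    ∀ x, |x - x₀| < ε → |Q.eval x / p.eval x| ≤ M := by
  have hc : ContinuousAt (fun x => |Q.eval x / p.eval x|) x₀ :=
    (Q.continuous.continuousAt.div p.continuous.continuousAt hp).abs
  have hev := hc.eventually_lt (continuousAt_const (y := |Q.eval x₀ / p.eval x₀| + 1))
    (by linarith)
  obtain ⟨ε, hε, h⟩ := Metric.eventually_nhds_iff.1 hev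
  exact ⟨_, ε, hε, fun x hx => (h (by rwa [Real.dist_eq])).le⟩

/-- A finite endpoint is a zero of `p`: elsewhere `η² p W` cannot tend to zero. -/
theorem IsSLOPS.eval_right_eq_zero (h : IsSLOPS T a b W E y) (nf : NormalForm T p Q η c) {b₀ : ℝ}
    (hb : b = b₀) : p.eval b₀ = 0 := by
  subst hb
  by_contra hp
  obtain ⟨M, ε, hε, hM⟩ := exists_bound_near (Q := Q) hp
  refine h.not_tendsto_mul_right nf (x₁ := b₀ - ε) (g := fun x => Real.exp (M * x)) (γ := fun _ => M)
    (EReal.coe_lt_coe_iff.2 (by linarith)) (fun x hx hxb => ⟨(Real.exp_pos _).ne', ?_, ?_⟩) ?_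
  · have := ((hasDerivAt_id x).const_mul M).exp
    refine this.congr_deriv ?_
    simp only [id, mul_one]
    ring
  · have hxb' := EReal.coe_lt_coe_iff.1 hxb
    have := (abs_le.1 (hM x (by rw [abs_lt]; constructor <;> linarith))).1
    linarith
  · have hle : comap Real.toEReal (𝓝[<] (b₀ : EReal)) ≤ 𝓝 b₀ := by
      rw [EReal.isEmbedding_coe.nhds_eq_comap]
      exact comap_mono nhdsWithin_le_nhds
    have h1 : Tendsto (fun x => Real.exp (M * x)) (comap Real.toEReal (𝓝[<] (b₀ : EReal)))
        (𝓝 (Real.exp (M * b₀))) :=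
      ((Real.continuous_exp.comp (continuous_const.mul continuous_id)).tendsto b₀).mono_left hle
    have h2 := h1.mul (h.tendsto_right nf 1)
    simpa using h2

theorem IsSLOPS.eval_left_eq_zero (h : IsSLOPS T a b W E y) (nf : NormalForm T p Q η c) {a₀ : ℝ}
    (ha : a = a₀) : p.eval a₀ = 0 := by
  subst ha
  by_contra hp
  obtain ⟨M, ε, hε, hM⟩ := exists_bound_near (Q := Q) hp
  refine h.not_tendsto_mul_left nf (x₁ := a₀ + ε) (g := fun x => Real.exp (-M * x)) (γ := fun _ => -M)
    (EReal.coe_lt_coe_iff.2 (by linarith)) (fun x hx hxb => ⟨(Real.exp_pos _).ne', ?_, ?_⟩) ?_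
  · have := ((hasDerivAt_id x).const_mul (-M)).exp
    refine this.congr_deriv ?_
    simp only [id, mul_one]
    ring
  · have hxb' := EReal.coe_lt_coe_iff.1 hxb
    have := (abs_le.1 (hM x (by rw [abs_lt]; constructor <;> linarith))).2
    linarith
  · have hle : comap Real.toEReal (𝓝[>] (a₀ : EReal)) ≤ 𝓝 a₀ := by
      rw [EReal.isEmbedding_coe.nhds_eq_comap]
      exact comap_mono nhdsWithin_le_nhds
    have h1 : Tendsto (fun x => Real.exp (-M * x)) (comap Real.toEReal (𝓝[>] (a₀ : EReal)))
        (𝓝 (Real.exp (-M * a₀))) :=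
      ((Real.continuous_exp.comp (continuous_const.mul continuous_id)).tendsto a₀).mono_left hle
    have h2 := h1.mul (h.tendsto_left nf 1)
    simpa using h2

/-- The logarithmic derivative of a power; the right-hand side is correct for `m = 0` as well. -/
theorem hasDerivAt_pow_log (m : ℕ) {x : ℝ} (hx : x ≠ 0) :
    HasDerivAt (fun t : ℝ => t ^ m) (m / x * x ^ m) x := by
  refine (hasDerivAt_pow m x).congr_deriv ?_
  cases m with
  | zero => simp
  | succ m => simp only [Nat.add_sub_cancel, pow_succ]; field_simp

/-- If `x^m η² p W` is eventually monotone away from zero, the interval is bounded above. -/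
theorem IsSLOPS.right_ne_top (h : IsSLOPS T a b W E y) (nf : NormalForm T p Q η c) (m : ℕ)
    (hm : ∀ᶠ x : ℝ in atTop, 0 ≤ m / x + Q.eval x / p.eval x) : b ≠ ⊤ := by
  rintro rfl
  obtain ⟨x₁, hx₁⟩ := eventually_atTop.1 (hm.and (eventually_gt_atTop 0))
  refine h.not_tendsto_mul_right nf (x₁ := x₁) (g := fun x => x ^ m) (γ := fun x => m / x)
    (EReal.coe_lt_top _) (fun x hx _ => ?_) ?_
  · obtain ⟨h1, h2⟩ := hx₁ x hx.le
    exact ⟨pow_ne_zero _ h2.ne', hasDerivAt_pow_log m h2.ne', h1⟩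
  · simpa using h.tendsto_right nf (X ^ m)

theorem IsSLOPS.left_ne_bot (h : IsSLOPS T a b W E y) (nf : NormalForm T p Q η c) (m : ℕ)
    (hm : ∀ᶠ x : ℝ in atBot, m / x + Q.eval x / p.eval x ≤ 0) : a ≠ ⊥ := by
  rintro rfl
  obtain ⟨x₁, hx₁⟩ := eventually_atBot.1 (hm.and (eventually_lt_atBot 0))
  refine h.not_tendsto_mul_left nf (x₁ := x₁) (g := fun x => x ^ m) (γ := fun x => m / x)
    (EReal.bot_lt_coe _) (fun x hx _ => ?_) ?_
  · obtain ⟨h1, h2⟩ := hx₁ x hx.le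
    exact ⟨pow_ne_zero _ h2.ne, hasDerivAt_pow_log m h2.ne, h1⟩
  · simpa using h.tendsto_left nf (X ^ m)

/-- If `deg p = 2`, then `Q / p = O(1 / x)`, so for large `m` the derivative of `x^m η² p W` has the
sign that keeps it away from zero at both infinities. -/
theorem exists_pow_dominating (hp : p.natDegree = 2) (hQ : Q.natDegree ≤ 1) : ∃ m : ℕ,
    (∀ᶠ x : ℝ in atTop, 0 ≤ m / x + Q.eval x / p.eval x) ∧
    (∀ᶠ x : ℝ in atBot, m / x + Q.eval x / p.eval x ≤ 0) := by
  have hp2 : p.coeff 2 ≠ 0 := by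
    have : p ≠ 0 := by rintro rfl; simp at hp
    rw [← hp]; exact leadingCoeff_ne_zero.2 this
  obtain ⟨m, hm⟩ := exists_nat_gt (-(p.coeff 2 * Q.coeff 1) / p.coeff 2 ^ 2)
  rw [div_lt_iff₀ (by positivity)] at hm
  set S : ℝ[X] := p * (C (m : ℝ) * p + X * Q) with hS
  have hd1 : (C (m : ℝ) * p + X * Q).natDegree ≤ 2 :=
    natDegree_add_le_of_degree_le ((natDegree_C_mul_le _ _).trans hp.le)
      (natDegree_mul_le.trans (by rw [natDegree_X]; omega))
  have hc4 : S.coeff 4 = p.coeff 2 * (m * p.coeff 2 + Q.coeff 1) := by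
    rw [hS, show 4 = 2 + 2 from rfl, coeff_mul_add_eq_of_natDegree_le hp.le hd1, coeff_add,
      coeff_C_mul, coeff_X_mul]
  have hc4pos : 0 < S.coeff 4 := by rw [hc4]; nlinarith
  have hS4 : S.natDegree = 4 := le_antisymm
    (natDegree_mul_le.trans (by omega)) (le_natDegree_of_ne_zero hc4pos.ne')
  have hdeg : 0 < S.degree := natDegree_pos_iff_degree_pos.1 (by omega)
  have hlc : 0 ≤ S.leadingCoeff := by rw [leadingCoeff, hS4]; exact hc4pos.le
  have htop := S.tendsto_atTop_of_leadingCoeff_nonneg hdeg hlc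
  have hcomp : (S.comp (-X)).natDegree = 4 := by rw [natDegree_comp, hS4]; simp
  have htop' := (S.comp (-X)).tendsto_atTop_of_leadingCoeff_nonneg
    (natDegree_pos_iff_degree_pos.1 (by omega))
    (by rw [leadingCoeff_comp (by simp), hS4]; norm_num; exact hlc)
  have key : ∀ x : ℝ, x ≠ 0 → 0 < S.eval x →
      m / x + Q.eval x / p.eval x = S.eval x / p.eval x ^ 2 / x ∧ 0 < p.eval x ^ 2 := by
    intro x hx hSx
    rw [hS] at hSx ⊢
    simp only [eval_mul, eval_add, eval_C, eval_X] at hSx ⊢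
    have hpx : p.eval x ≠ 0 := by intro h0; rw [h0] at hSx; simp at hSx
    refine ⟨?_, by positivity⟩
    field_simp
  refine ⟨m, ?_, ?_⟩
  · filter_upwards [htop.eventually_gt_atTop 0, eventually_gt_atTop 0] with x h1 h2
    obtain ⟨e, h3⟩ := key x h2.ne' h1
    rw [e]
    positivity
  · have := (htop'.comp tendsto_neg_atBot_atTop).eventually_gt_atTop 0
    filter_upwards [this, eventually_lt_atBot 0] with x h1 h2
    simp only [Function.comp_apply, eval_comp, eval_neg, eval_X, neg_neg] at h1
    obtain ⟨e, h3⟩ := key x h2.ne h1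
    rw [e]
    exact div_nonpos_of_nonneg_of_nonpos (by positivity) h2.le

/-- A quadratic `p` has two distinct real zeros, the endpoints of the interval. -/
theorem IsSLOPS.exists_roots (h : IsSLOPS T a b W E y) (nf : NormalForm T p Q η c)
    (hp : p.natDegree = 2) :
    ∃ r s : ℝ, r < s ∧ p = C (p.coeff 2) * ((X - C r) * (X - C s)) := by
  obtain ⟨m, hm1, hm2⟩ := exists_pow_dominating hp nf.natDegree_Q
  have hb := h.right_ne_top nf m hm1
  have ha := h.left_ne_bot nf m hm2
  have hlt := h.lt
  lift b to ℝ using ⟨hb, fun hb' => by rw [hb'] at hlt; exact not_lt_bot hlt⟩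
  lift a to ℝ using ⟨fun ha' => by rw [ha'] at hlt; exact not_top_lt hlt, ha⟩
  have hab := EReal.coe_lt_coe_iff.1 hlt
  have hpb := h.eval_right_eq_zero nf rfl
  have hpa := h.eval_left_eq_zero nf rfl
  refine ⟨a, b, hab, ?_⟩
  obtain ⟨k, hk⟩ := dvd_iff_isRoot.2 (show p.IsRoot a from hpa)
  have hkb : k.eval b = 0 := by
    rw [hk, eval_mul] at hpb
    simpa [sub_ne_zero.2 hab.ne'] using hpb
  obtain ⟨e, he⟩ := dvd_iff_isRoot.2 (show k.IsRoot b from hkb)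
  rw [he, ← mul_assoc] at hk
  have he0 : e ≠ 0 := by rintro rfl; rw [mul_zero] at hk; exact nf.p_ne_zero hk
  have hm : ((X - C a) * (X - C b) : ℝ[X]).Monic := (monic_X_sub_C a).mul (monic_X_sub_C b)
  have hmd : ((X - C a) * (X - C b) : ℝ[X]).natDegree = 2 := by
    rw [(monic_X_sub_C a).natDegree_mul (monic_X_sub_C b), natDegree_X_sub_C, natDegree_X_sub_C]
  have hed : e.natDegree = 0 := by
    have := congrArg natDegree hk
    rw [hp, hm.natDegree_mul' he0, hmd] at this
    omega
  have hlc : p.coeff 2 = e.coeff 0 := by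
    rw [hk, show 2 = 2 + 0 from rfl, coeff_mul_add_eq_of_natDegree_le hmd.le hed.le]
    have := hm.coeff_natDegree
    rw [hmd] at this
    rw [this, one_mul]
  rw [hlc, ← eq_C_of_natDegree_eq_zero hed, mul_comm]
  exact hk

/-- For constant `p` the weight decays at infinity like a Gaussian. -/
theorem IsSLOPS.div_neg_of_natDegree_eq_zero (h : IsSLOPS T a b W E y)
    (nf : NormalForm T p Q η c) (hp : p.natDegree = 0) : Q.coeff 1 / p.coeff 0 < 0 := by
  have hpC := eq_C_of_natDegree_eq_zero hp
  have hp0 : p.coeff 0 ≠ 0 := by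
    intro h0; rw [h0, C_0] at hpC; exact nf.p_ne_zero hpC
  have hQ1 : Q.coeff 1 ≠ 0 := by
    rcases nf.nonconst with h2 | h1
    · exact absurd (coeff_eq_zero_of_natDegree_lt (by omega)) h2
    · exact h1
  by_contra! hcon
  -- otherwise `η² p W` grows at `+∞`, so `b` is finite; but then `p` vanishes at `b`
  have hpos : 0 < Q.coeff 1 / p.coeff 0 := lt_of_le_of_ne hcon (div_ne_zero hQ1 hp0).symm
  have hb : b ≠ ⊤ := by
    refine h.right_ne_top nf 0 ?_
    filter_upwards [eventually_ge_atTop (-(Q.coeff 0 / p.coeff 0) / (Q.coeff 1 / p.coeff 0))]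
      with x hx
    rw [div_le_iff₀ hpos] at hx
    have hQx : Q.eval x = Q.coeff 1 * x + Q.coeff 0 := by
      conv_lhs => rw [eq_X_add_C_of_natDegree_le_one nf.natDegree_Q]
      simp
    rw [hpC, eval_C, hQx, add_div, mul_div_right_comm]
    simp only [Nat.cast_zero, zero_div, zero_add]
    linarith
  have hlt := h.lt
  lift b to ℝ using ⟨hb, fun hb' => by rw [hb'] at hlt; exact not_lt_bot hlt⟩
  have := h.eval_right_eq_zero nf rfl
  rw [hpC, eval_C] at this
  exact hp0 this

end Endpoints

/-! ### Orthogonal polynomials for a Pearson functional -/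

section Orthogonal

/-- If every prime factor of `H` divides `B`, then `H` is a square times a divisor of `B`. -/
theorem exists_eq_mul_sq_of_forall_prime {B H : ℝ[X]} (hH : H ≠ 0)
    (h : ∀ π : ℝ[X], Prime π → π ∣ H → π ∣ B) : ∃ S R, H = S * R ^ 2 ∧ S ∣ B := by
  induction H using UniqueFactorizationMonoid.induction_on_prime with
  | h₁ => exact absurd rfl hH
  | h₂ u hu => exact ⟨u, 1, by ring, hu.dvd⟩
  | h₃ H₀ π hH₀ hπ ih =>
    obtain ⟨S, R, e, hS⟩ := ih hH₀ fun ρ hρ hd => h ρ hρ (hd.mul_left π)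
    by_cases hd : π ∣ S
    · obtain ⟨S₁, rfl⟩ := hd
      exact ⟨S₁, π * R, by rw [e]; ring, (dvd_mul_left _ _).trans hS⟩
    · refine ⟨π * S, R, by rw [e]; ring, IsCoprime.mul_dvd ?_ (h π hπ (dvd_mul_right _ _)) hS⟩
      exact (hπ.irreducible.coprime_iff_not_dvd).2 hd

/-- If `A H + B H' = 0`, then every prime factor of `H` divides `B`, since it occurs in `H'` with
smaller multiplicity than in `H`. -/
theorem exists_eq_mul_sq {A B H : ℝ[X]} (hH : H ≠ 0) (h : A * H + B * derivative H = 0) :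
    ∃ S R, H = S * R ^ 2 ∧ S ∣ B := by
  refine exists_eq_mul_sq_of_forall_prime hH fun π hπ hd => ?_
  have hfin : FiniteMultiplicity π H := FiniteMultiplicity.of_prime_left hπ hH
  obtain ⟨H₀, hH₀, hnd⟩ := hfin.exists_eq_pow_mul_and_not_dvd
  obtain ⟨e, he⟩ : ∃ e, multiplicity π H = e + 1 := by
    refine Nat.exists_eq_succ_of_ne_zero fun h0 => ?_
    rw [h0, pow_zero, one_mul] at hH₀
    exact hnd (hH₀ ▸ hd)
  rw [he] at hH₀
  have hder : derivative H = π ^ e * ((e + 1) * derivative π * H₀ + π * derivative H₀) := by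
    rw [hH₀, derivative_mul, derivative_pow]
    simp only [Nat.add_sub_cancel, map_natCast]
    push_cast
    ring
  have h1 : B * ((e + 1) * derivative π * H₀) = π * (-(A * H₀) - B * derivative H₀) := by
    apply mul_left_cancel₀ (pow_ne_zero e hπ.ne_zero)
    rw [hder] at h
    rw [hH₀] at h
    linear_combination h
  have hπ' : ¬ π ∣ derivative π := by
    intro hdvd
    have hne : derivative π ≠ 0 := by
      intro h0
      have := derivative_eq_zero.1 h0
      rw [eq_C_of_natDegree_eq_zero this] at hπ
      exact hπ.not_isUnit (isUnit_C.2 (isUnit_iff_ne_zero.2 fun h => by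
        rw [h, C_0] at hπ; exact hπ.ne_zero rfl))
    exact absurd (degree_le_of_dvd hdvd hne) (not_le.2 (degree_derivative_lt hπ.ne_zero))
  have hnat : ¬ π ∣ ((e + 1 : ℝ[X])) := by
    intro hdvd
    have hu : IsUnit ((e + 1 : ℝ[X])) := by
      have : ((e + 1 : ℝ[X])) = C ((e : ℝ) + 1) := by simp
      rw [this, isUnit_C]
      exact isUnit_iff_ne_zero.2 (by positivity)
    exact hπ.not_isUnit (isUnit_of_dvd_unit hdvd hu)
  rcases hπ.dvd_or_dvd (Dvd.intro _ h1.symm) with h2 | h2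
  · exact h2
  · rcases hπ.dvd_or_dvd h2 with h3 | h3
    · rcases hπ.dvd_or_dvd h3 with h4 | h4
      · exact absurd h4 hnat
      · exact absurd h4 hπ'
    · exact absurd h3 hnd

/-- A positive linear functional on polynomials satisfying the Pearson equation `(p w)' = Q w` of a
weight `w`, in weak form. -/
structure IsPearson (L : ℝ[X] →ₗ[ℝ] ℝ) (p Q : ℝ[X]) : Prop where
  pearson : ∀ w, L (p * derivative w + Q * w) = 0
  pos : ∀ u, u ≠ 0 → 0 < L (u ^ 2)

variable {L : ℝ[X] →ₗ[ℝ] ℝ} {p Q H : ℝ[X]} {n : ℕ}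

/-- The eigenvalue of `p D² + Q D` in degree `x`. -/
noncomputable def eigenvalueAt (p Q : ℝ[X]) (x : ℝ) : ℝ := p.coeff 2 * (x * (x - 1)) + Q.coeff 1 * x

theorem coeff_polyOp_zero (hp : p.natDegree ≤ 2) (hQ : Q.natDegree ≤ 1) {f : ℝ[X]}
    {k : ℕ} (hf : f.natDegree ≤ k) :
    (polyOp p Q 0 f).coeff k = eigenvalueAt p Q k * f.coeff k := by
  have := coeff_polyOp (m := 0) (R := 0) (by simpa using hp) (by simpa using hQ) (by simp) hf
  simpa [eigenvalueAt] using this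

theorem natDegree_polyOp_zero_le (hp : p.natDegree ≤ 2) (hQ : Q.natDegree ≤ 1) (f : ℝ[X]) :
    (polyOp p Q 0 f).natDegree ≤ f.natDegree := by
  have := natDegree_polyOp_le (m := 0) (R := 0) (by simpa using hp) (by simpa using hQ) (by simp)
    (le_refl f.natDegree)
  simpa using this

theorem mem_degreeLT_of_natDegree_lt {f : ℝ[X]} {n : ℕ} (h : f.natDegree < n) : f ∈ degreeLT ℝ n :=
  mem_degreeLT.2 (degree_le_natDegree.trans_lt (by exact_mod_cast h))

theorem natDegree_lt_of_mem_degreeLT {f : ℝ[X]} {n : ℕ} (hn : 0 < n) (h : f ∈ degreeLT ℝ n) :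
    f.natDegree < n := by
  by_cases hf : f = 0
  · simpa [hf] using hn
  · exact (natDegree_lt_iff_degree_lt hf).2 (mem_degreeLT.1 h)

instance finiteDimensional_degreeLT (n : ℕ) : FiniteDimensional ℝ (degreeLT ℝ n) :=
  Module.Finite.equiv (degreeLTEquiv ℝ n).symm

/-- `p D² + Q D - μ` is onto on the polynomials of degree `< n`, unless `μ` is one of the
eigenvalues there. -/
theorem exists_polyOp_sub_eq (hp : p.natDegree ≤ 2) (hQ : Q.natDegree ≤ 1) {μ : ℝ}
    (hμ : ∀ j < n, eigenvalueAt p Q j ≠ μ) {v : ℝ[X]} (hv : v ∈ degreeLT ℝ n) :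
    ∃ G ∈ degreeLT ℝ n, polyOp p Q 0 G - C μ * G = v := by
  rcases Nat.eq_zero_or_pos n with rfl | hn
  · refine ⟨0, zero_mem _, ?_⟩
    have : v = 0 := by
      have := mem_degreeLT.1 hv
      simpa using this
    simp [this]
  set S : ℝ[X] →ₗ[ℝ] ℝ[X] := polyOp p Q 0 - LinearMap.mulLeft ℝ (C μ) with hS
  have hSapply : ∀ f, S f = polyOp p Q 0 f - C μ * f := fun f => rfl
  have hmaps : ∀ f ∈ degreeLT ℝ n, S f ∈ degreeLT ℝ n := fun f hf => by
    have h1 := natDegree_lt_of_mem_degreeLT hn hf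
    apply mem_degreeLT_of_natDegree_lt
    rw [hSapply]
    exact (natDegree_sub_le _ _).trans_lt (max_lt
      ((natDegree_polyOp_zero_le hp hQ f).trans_lt h1) ((natDegree_C_mul_le _ _).trans_lt h1))
  have hinj : Function.Injective (S.restrict hmaps) := by
    rw [injective_iff_map_eq_zero]
    rintro ⟨f, hf⟩ h0
    have h1 : S f = 0 := congrArg Subtype.val h0
    by_contra hne
    have hf0 : f ≠ 0 := fun h => hne (Subtype.ext h)
    have h2 := congrArg (fun g => coeff g f.natDegree) h1
    simp only [hSapply, coeff_sub, coeff_polyOp_zero hp hQ le_rfl, coeff_C_mul, coeff_zero] at h2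
    rw [← sub_mul, mul_eq_zero, sub_eq_zero] at h2
    exact h2.elim (hμ _ (natDegree_lt_of_mem_degreeLT hn hf))
      (leadingCoeff_ne_zero.2 hf0)
  obtain ⟨⟨G, hG⟩, e⟩ := (LinearMap.injective_iff_surjective.1 hinj) ⟨v, hv⟩
  exact ⟨G, hG, congrArg Subtype.val e⟩

/-- Correct `X^n`, an eigenvector modulo lower degrees, by a polynomial of lower degree. -/
theorem exists_eigenpoly (hp : p.natDegree ≤ 2) (hQ : Q.natDegree ≤ 1)
    (hμ : ∀ j < n, eigenvalueAt p Q j ≠ eigenvalueAt p Q n) : ∃ H : ℝ[X], H.degree = n ∧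
      polyOp p Q 0 H = C (eigenvalueAt p Q n) * H := by
  have hv : polyOp p Q 0 (X ^ n) - C (eigenvalueAt p Q n) * X ^ n ∈ degreeLT ℝ n := by
    rw [mem_degreeLT, degree_lt_iff_coeff_zero]
    intro m hm
    have hX : (X ^ n : ℝ[X]).natDegree ≤ m := (natDegree_X_pow n).le.trans hm
    rw [coeff_sub, coeff_polyOp_zero hp hQ hX, coeff_C_mul, coeff_X_pow]
    split_ifs with h
    · rw [h]; ring
    · ring
  obtain ⟨G, hG, e⟩ := exists_polyOp_sub_eq hp hQ hμ hv
  refine ⟨X ^ n - G, ?_, ?_⟩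
  · rw [degree_sub_eq_left_of_degree_lt (by rw [degree_X_pow]; exact mem_degreeLT.1 hG),
      degree_X_pow]
  · rw [map_sub]; linear_combination -e

/-- Eigenpolynomials are orthogonal to all polynomials of lower degree. -/
theorem IsPearson.orthogonal (hL : IsPearson L p Q) (hp : p.natDegree ≤ 2) (hQ : Q.natDegree ≤ 1)
    (hμ : ∀ j < n, eigenvalueAt p Q j ≠ eigenvalueAt p Q n)
    (hH : polyOp p Q 0 H = C (eigenvalueAt p Q n) * H) {v : ℝ[X]} (hv : v ∈ degreeLT ℝ n) :
    L (H * v) = 0 := by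
  obtain ⟨G, -, e⟩ := exists_polyOp_sub_eq hp hQ hμ hv
  -- Green's identity for `p D² + Q D`
  rw [← hL.pearson (H * derivative G - derivative H * G), ← e]
  congr 1
  rw [polyOp_apply] at hH ⊢
  rw [derivative_sub]
  simp only [derivative_mul]
  linear_combination G * hH

/-- `H'` is not a multiple of `H` modulo low degrees: otherwise `H = S R²` with `S` of degree `< n`,
and `L (H S) = L ((S R)²) > 0` contradicts orthogonality. -/
theorem IsPearson.eq_zero_of_mul_add_mul_derivative (hL : IsPearson L p Q) (hH0 : H ≠ 0)
    (horth : ∀ v ∈ degreeLT ℝ n, L (H * v) = 0) {A B : ℝ[X]} (hB : B.natDegree < n)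
    (h : A * H + B * derivative H = 0) : A = 0 ∧ B = 0 := by
  have hB0 : B = 0 := by
    by_contra hB0
    obtain ⟨S, R, e, hS⟩ := exists_eq_mul_sq hH0 h
    have hdeg := natDegree_le_of_dvd hS hB0
    have h1 := horth S (mem_degreeLT_of_natDegree_lt (hdeg.trans_lt hB))
    have hSR : S * R ≠ 0 := by
      rintro h0
      rw [pow_two, ← mul_assoc, h0, zero_mul] at e
      exact hH0 e
    have h2 := hL.pos _ hSR
    rw [show (S * R) ^ 2 = H * S by rw [e]; ring, h1] at h2
    exact lt_irrefl _ h2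
  rw [hB0, zero_mul, add_zero] at h
  exact ⟨(mul_eq_zero.1 h).resolve_right hH0, hB0⟩

/-- Polynomials of degree `≤ n + M` orthogonal to all polynomials of degree `< n - M` have the form
`a H + b p H'` with `deg a ≤ M`, `deg b < M`: both spaces have dimension `2 M + 1`. -/
theorem IsPearson.exists_eq_mul_add (hL : IsPearson L p Q) (hp0 : p ≠ 0) (hp : p.natDegree ≤ 2)
    (hQ : Q.natDegree ≤ 1) (hHn : H.degree = n) (horth : ∀ v ∈ degreeLT ℝ n, L (H * v) = 0)
    {M : ℕ} (hM : M + 2 ≤ n) {F : ℝ[X]} (hF : F ∈ degreeLT ℝ (n + M + 1))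
    (hFo : ∀ u ∈ degreeLT ℝ (n - M), L (F * u) = 0) :
    ∃ a ∈ degreeLT ℝ (M + 1), ∃ b ∈ degreeLT ℝ M, F = a * H + b * p * derivative H := by
  have hHd := natDegree_eq_of_degree_eq_some hHn
  have hH0 : H ≠ 0 := by rintro rfl; simp at hHn
  let B : Submodule ℝ ℝ[X] :=
    { carrier := {F | F ∈ degreeLT ℝ (n + M + 1) ∧ ∀ u ∈ degreeLT ℝ (n - M), L (F * u) = 0}
      add_mem' := fun {f g} hf hg => ⟨add_mem hf.1 hg.1, fun u hu => by
        rw [add_mul, map_add, hf.2 u hu, hg.2 u hu, add_zero]⟩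
      zero_mem' := ⟨zero_mem _, fun u _ => by simp⟩
      smul_mem' := fun c f hf => ⟨Submodule.smul_mem _ _ hf.1, fun u hu => by
        rw [smul_mul_assoc, map_smul, hf.2 u hu, smul_zero]⟩ }
  have hBmem : ∀ f, f ∈ B ↔ f ∈ degreeLT ℝ (n + M + 1) ∧
      ∀ u ∈ degreeLT ℝ (n - M), L (f * u) = 0 := fun f => Iff.rfl
  -- the coefficients in degrees `n - M, …, n + M` determine an element of `B`
  let κ : B →ₗ[ℝ] (Fin (2 * M + 1) → ℝ) :=
    LinearMap.pi fun i => lcoeff ℝ (n - M + i) ∘ₗ B.subtype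
  have hκ : Function.Injective κ := by
    rw [injective_iff_map_eq_zero]
    rintro ⟨f, hf⟩ h0
    have hco : ∀ i < 2 * M + 1, f.coeff (n - M + i) = 0 := fun i hi => congrFun h0 ⟨i, hi⟩
    have hmem : f ∈ degreeLT ℝ (n - M) := by
      rw [mem_degreeLT, degree_lt_iff_coeff_zero]
      intro m hm
      by_cases hlt : m < n + M + 1
      · obtain ⟨i, rfl⟩ := Nat.exists_eq_add_of_le hm
        exact hco i (by omega)
      · exact (degree_lt_iff_coeff_zero f _).1 (mem_degreeLT.1 hf.1) m (not_lt.1 hlt)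
    have h1 := hf.2 f hmem
    by_contra hne
    have := hL.pos f fun h => hne (Subtype.ext h)
    rw [pow_two, h1] at this
    exact lt_irrefl _ this
  have : FiniteDimensional ℝ B := Module.Finite.of_injective κ hκ
  have hB : Module.finrank ℝ B ≤ 2 * M + 1 := by
    simpa using LinearMap.finrank_le_finrank_of_injective hκ
  -- `b p H'` is orthogonal to low degrees by integration by parts
  have hmemB : ∀ a ∈ degreeLT ℝ (M + 1), ∀ b ∈ degreeLT ℝ M,
      a * H + b * p * derivative H ∈ B := by
    intro a ha b hb
    have had := natDegree_lt_of_mem_degreeLT (Nat.succ_pos M) ha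
    refine B.add_mem ⟨?_, ?_⟩ ?_
    · apply mem_degreeLT_of_natDegree_lt
      have := natDegree_mul_le (p := a) (q := H)
      omega
    · intro u hu
      rw [show a * H * u = H * (a * u) by ring]
      have hud := natDegree_lt_of_mem_degreeLT (by omega) hu
      refine horth _ (mem_degreeLT_of_natDegree_lt ?_)
      have := natDegree_mul_le (p := a) (q := u)
      omega
    · rcases Nat.eq_zero_or_pos M with hM0 | hM0
      · have : b = 0 := by
          have := mem_degreeLT.1 hb
          rw [hM0] at this
          simpa using this
        rw [this, zero_mul, zero_mul]; exact zero_mem _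
      have hbd := natDegree_lt_of_mem_degreeLT hM0 hb
      refine ⟨?_, ?_⟩
      · apply mem_degreeLT_of_natDegree_lt
        have h1 := natDegree_mul_le (p := b * p) (q := derivative H)
        have h2 := natDegree_mul_le (p := b) (q := p)
        have h3 := natDegree_derivative_le H
        omega
      · intro u hu
        have hud := natDegree_lt_of_mem_degreeLT (by omega) hu
        have h1 := hL.pearson (b * u * H)
        have h2 : L (H * (p * derivative (b * u) + Q * (b * u))) = 0 := by
          refine horth _ (mem_degreeLT_of_natDegree_lt ?_)
          have e1 := natDegree_mul_le (p := b) (q := u)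
          have e2 := natDegree_derivative_le (b * u)
          have e3 := natDegree_mul_le (p := p) (q := derivative (b * u))
          have e4 := natDegree_mul_le (p := Q) (q := b * u)
          have e5 := natDegree_add_le (p * derivative (b * u)) (Q * (b * u))
          by_cases hz : (b * u).natDegree = 0
          · rw [eq_C_of_natDegree_eq_zero hz] at e4 e5 ⊢
            rw [derivative_C, mul_zero, zero_add] at e5 ⊢
            rw [natDegree_C] at e4
            omega
          · omega
        rw [show p * derivative (b * u * H) + Q * (b * u * H) = b * p * derivative H * u
          + H * (p * derivative (b * u) + Q * (b * u)) by
            rw [derivative_mul (f := b * u)]; ring, map_add, h2, add_zero] at h1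
        exact h1
  let Ψ : (degreeLT ℝ (M + 1) × degreeLT ℝ M) →ₗ[ℝ] B :=
    { toFun := fun ab => ⟨ab.1 * H + ab.2 * p * derivative H,
        hmemB _ ab.1.2 _ ab.2.2⟩
      map_add' := fun x y => Subtype.ext (by
        simp only [Prod.fst_add, Prod.snd_add, Submodule.coe_add]; ring)
      map_smul' := fun r x => Subtype.ext (by
        simp only [Prod.smul_fst, Prod.smul_snd, SetLike.val_smul, RingHom.id_apply, smul_add,
          smul_mul_assoc]) }
  have hΨ : Function.Injective Ψ := by
    rw [injective_iff_map_eq_zero]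
    rintro ⟨⟨a, ha⟩, ⟨b, hb⟩⟩ h0
    have h1 : a * H + b * p * derivative H = 0 := congrArg Subtype.val h0
    have hbp : (b * p).natDegree < n := by
      rcases Nat.eq_zero_or_pos M with hM0 | hM0
      · have : b = 0 := by
          have := mem_degreeLT.1 hb
          rw [hM0] at this
          simpa using this
        rw [this, zero_mul, natDegree_zero]; omega
      · have := natDegree_lt_of_mem_degreeLT hM0 hb
        have h2 := natDegree_mul_le (p := b) (q := p)
        omega
    obtain ⟨h2, h3⟩ := hL.eq_zero_of_mul_add_mul_derivative hH0 horth hbp h1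
    have h4 := (mul_eq_zero.1 h3).resolve_right hp0
    exact Prod.ext (Subtype.ext h2) (Subtype.ext h4)
  have hdim : Module.finrank ℝ (degreeLT ℝ (M + 1) × degreeLT ℝ M) = 2 * M + 1 := by
    rw [Module.finrank_prod, (degreeLTEquiv ℝ (M + 1)).finrank_eq, (degreeLTEquiv ℝ M).finrank_eq]
    simp
    omega
  have hsurj : Function.Surjective Ψ := by
    have hle := LinearMap.finrank_le_finrank_of_injective hΨ
    exact (LinearMap.injective_iff_surjective_of_finrank_eq_finrank (by omega)).1 hΨ
  obtain ⟨⟨⟨a, ha⟩, ⟨b, hb⟩⟩, e⟩ := hsurj ⟨F, hF, hFo⟩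
  exact ⟨a, ha, b, hb, (congrArg Subtype.val e).symm⟩

end Orthogonal

/-! ### Eigenpolynomials in terms of classical polynomials -/

section Band

local notation "ι" => algebraMap ℝ[X] (RatFunc ℝ)

variable {T : DiffOp2 ℝ} {a b : EReal} {W : ℝ → ℝ} {E : Finset ℕ} {y : ℕ → ℝ[X]} {p Q η : ℝ[X]}
  {c : ℝ}

/-- The quadratic `eigenvalueAt p Q` is eventually injective. -/
theorem exists_eigenvalueAt_ne (h : p.coeff 2 ≠ 0 ∨ Q.coeff 1 ≠ 0) (d : ℕ) :
    ∃ N : ℕ, ∀ n ≥ N, ∀ x : ℝ, -d ≤ x → x < n → eigenvalueAt p Q x ≠ eigenvalueAt p Q n := by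
  obtain ⟨N, hN⟩ := exists_nat_gt (d + 1 + |Q.coeff 1 / p.coeff 2|)
  refine ⟨N, fun n hn x hx hxn heq => ?_⟩
  have hn' : (N : ℝ) ≤ n := by exact_mod_cast hn
  have h1 : (n - x) * (p.coeff 2 * (n + x - 1) + Q.coeff 1) = 0 := by
    simp only [eigenvalueAt] at heq
    linear_combination -heq
  have h2 := (mul_eq_zero.1 h1).resolve_left (by linarith)
  by_cases hp : p.coeff 2 = 0
  · rw [hp, zero_mul, zero_add] at h2
    exact h.elim (· hp) (· h2)
  · have h3 : n + x - 1 = -(Q.coeff 1 / p.coeff 2) := by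
      field_simp
      linear_combination h2
    have := neg_le_abs (Q.coeff 1 / p.coeff 2)
    linarith

/-- The functional `u ↦ ∫ u η² W`, whose weight `η² W` solves the Pearson equation of a classical
operator. -/
noncomputable def IsSLOPS.functional (h : IsSLOPS T a b W E y) (η : ℝ[X]) : ℝ[X] →ₗ[ℝ] ℝ where
  toFun u := weightFunctional a b W (η ^ 2 * u)
  map_add' u v := by rw [mul_add, h.weightFunctional_add]
  map_smul' r u := by
    rw [smul_eq_C_mul, mul_left_comm, weightFunctional_C_mul, RingHom.id_apply, smul_eq_mul]

theorem IsSLOPS.isPearson (h : IsSLOPS T a b W E y) (nf : NormalForm T p Q η c) :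
    IsPearson (h.functional η) p Q where
  pearson w := h.weightFunctional_eta_eq_zero nf w
  pos u hu := by
    have := h.weightFunctional_sq_pos (mul_ne_zero nf.η_ne_zero hu)
    rwa [mul_pow] at this

/-- `T - λ` is onto on an invariant space of polynomials of bounded degree, if no eigenvalue of
smaller degree equals `λ`. -/
theorem NormalForm.exists_apply_sub_eq (nf : NormalForm T p Q η c) {V : Submodule ℝ ℝ[X]}
    (hV : T.Preserves V) {k : ℕ} {l : ℝ}
    (hl : ∀ j : ℕ, j < k → eigenvalueAt p Q (j - η.natDegree) + c ≠ l) {v : ℝ[X]} (hv : v ∈ V)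
    (hvk : v ∈ degreeLT ℝ k) : ∃ G G' : ℝ[X], T.apply (ι G) = ι G' ∧ G' - C l * G = v := by
  rcases Nat.eq_zero_or_pos k with rfl | hk
  · have : v = 0 := by simpa using mem_degreeLT.1 hvk
    exact ⟨0, 0, by simp [DiffOp2.apply], by simp [this]⟩
  have hι : Function.Injective ι := RatFunc.algebraMap_injective ℝ
  let U : Submodule ℝ ℝ[X] := V ⊓ degreeLT ℝ k
  have hfin : FiniteDimensional ℝ U :=
    Module.Finite.of_injective (Submodule.inclusion (inf_le_right : U ≤ degreeLT ℝ k))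
      (Submodule.inclusion_injective _)
  have hex : ∀ f : U, ∃ u : U, T.apply (ι f) = ι u := fun f => by
    obtain ⟨u, hu, e⟩ := hV f f.2.1
    refine ⟨⟨u, hu, mem_degreeLT_of_natDegree_lt ?_⟩, e⟩
    exact (nf.natDegree_le _ _ e).trans_lt (natDegree_lt_of_mem_degreeLT hk f.2.2)
  choose τ hτ using hex
  let S : U →ₗ[ℝ] U :=
    { toFun := fun f => τ f - l • f
      map_add' := fun f g => by
        have : τ (f + g) = τ f + τ g := Subtype.ext (hι (by
          rw [← hτ, Submodule.coe_add, Submodule.coe_add, map_add, map_add, T.apply_add, hτ, hτ]))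
        rw [this, smul_add]; abel
      map_smul' := fun r f => by
        have : τ (r • f) = r • τ f := Subtype.ext (hι (by
          rw [← hτ, Submodule.coe_smul, Submodule.coe_smul, smul_eq_C_mul, smul_eq_C_mul,
            ← C_mul_algebraMap, ← C_mul_algebraMap, T.apply_C_mul, hτ]))
        rw [this, RingHom.id_apply, smul_sub, smul_comm r l] }
  have hinj : Function.Injective S := by
    rw [injective_iff_map_eq_zero]
    intro f hf
    by_contra hne
    have hf0 : (f : ℝ[X]) ≠ 0 := fun h => hne (Subtype.ext h)
    have h1 : (τ f : ℝ[X]) = C l * f := by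
      have := congrArg Subtype.val (sub_eq_zero.1 hf)
      rwa [Submodule.coe_smul, smul_eq_C_mul] at this
    have h2 := nf.eigenvalue f _ l (degree_eq_natDegree hf0) (by rw [hτ, h1])
    exact hl _ (natDegree_lt_of_mem_degreeLT hk f.2.2) h2.symm
  obtain ⟨G, hG⟩ := LinearMap.injective_iff_surjective.1 hinj ⟨v, hv, hvk⟩
  refine ⟨G, τ G, hτ G, ?_⟩
  have := congrArg Subtype.val hG
  rw [← smul_eq_C_mul]
  exact this

/-- Up to a fixed denominator `g`, all eigenpolynomials of large degree are combinations, with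
coefficients of bounded degree, of an eigenpolynomial `H` of `p D² + Q D` and of `p H'`. -/
theorem IsSLOPS.exists_eq_mul_add (h : IsSLOPS T a b W E y) (nf : NormalForm T p Q η c) :
    ∃ (g : ℝ[X]) (M N : ℕ), g ≠ 0 ∧ ∀ n ≥ N, n + η.natDegree ∉ E → ∃ H : ℝ[X], H.degree = n ∧
      polyOp p Q 0 H = C (eigenvalueAt p Q n) * H ∧
      (∀ v ∈ degreeLT ℝ n, h.functional η (H * v) = 0) ∧
      T.apply (ι (y (n + η.natDegree))) =
        ι (C (eigenvalueAt p Q n + c) * y (n + η.natDegree)) ∧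
      ∃ A ∈ degreeLT ℝ (M + 1), ∃ B ∈ degreeLT ℝ M,
        g * y (n + η.natDegree) = A * H + B * p * derivative H := by
  set d := η.natDegree with hd
  have hfin := finiteDimensional_quotient_span (K := ℝ) h.degree_eq
  obtain ⟨V, g, hV, hg, hgV⟩ := T.exists_preserves_multiples (T.preserves_span h.eigen)
  obtain ⟨N, hN⟩ := exists_eigenvalueAt_ne nf.nonconst d
  -- `M = d + deg g` is the excess of `deg (g y) = deg g + n + d` over `n`
  refine ⟨g, d + g.natDegree, N + d + g.natDegree + 2, hg, fun n hn hE => ?_⟩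
  have hμ : ∀ j < n, eigenvalueAt p Q (j : ℕ) ≠ eigenvalueAt p Q n := fun j hj =>
    hN n (by omega) j ((neg_nonpos.2 (Nat.cast_nonneg d)).trans (Nat.cast_nonneg j))
      (by exact_mod_cast hj)
  obtain ⟨H, hHn, hH⟩ := exists_eigenpoly nf.natDegree_p nf.natDegree_Q hμ
  have hL := h.isPearson nf
  have horth : ∀ v ∈ degreeLT ℝ n, h.functional η (H * v) = 0 := fun v hv =>
    hL.orthogonal nf.natDegree_p nf.natDegree_Q hμ hH hv
  have hyd := h.degree_eq _ hE
  have hy0 : y (n + d) ≠ 0 := fun h0 =>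
    WithBot.natCast_ne_bot _ (hyd.symm.trans (by rw [h0, degree_zero]))
  have hTy : T.apply (ι (y (n + d))) = ι (C (eigenvalueAt p Q n + c) * y (n + d)) := by
    obtain ⟨l, hl⟩ := h.eigen _ hE
    rw [C_mul_algebraMap] at hl
    have := nf.eigenvalue _ _ l hyd hl
    rw [hl, this, eigenvalueAt, ← hd]
    push_cast
    rw [add_sub_cancel_right]
  refine ⟨H, hHn, hH, horth, hTy, ?_⟩
  have hgy : (g * y (n + d)).natDegree = g.natDegree + (n + d) := by
    rw [natDegree_mul hg hy0, natDegree_eq_of_degree_eq_some hyd]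
  refine hL.exists_eq_mul_add nf.p_ne_zero nf.natDegree_p nf.natDegree_Q hHn horth (by omega)
    (mem_degreeLT_of_natDegree_lt (by omega)) fun u hu => ?_
  have hud := natDegree_lt_of_mem_degreeLT (by omega) hu
  -- `g η² u = (T - λ) G` lies in the range of `T - λ`, to which the eigenvector is orthogonal
  obtain ⟨G, G', hG, e⟩ := nf.exists_apply_sub_eq hV (k := n + d)
    (l := eigenvalueAt p Q n + c) (fun j hj => by
      rw [← hd, Ne, add_left_inj]
      refine hN n (by omega) _ ?_ ?_
      · have : (0 : ℝ) ≤ j := Nat.cast_nonneg j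
        linarith
      · have : (j : ℝ) < n + d := by exact_mod_cast hj
        linarith) (hgV (η ^ 2 * u)) (mem_degreeLT_of_natDegree_lt (by
      have h1 := natDegree_mul_le (p := g) (q := η ^ 2 * u)
      have h2 := natDegree_mul_le (p := η ^ 2) (q := u)
      have h3 := natDegree_pow_le (p := η) (n := 2)
      omega))
  rw [← h.weightFunctional_symm nf hTy hG]
  change weightFunctional a b W _ = _
  congr 1
  linear_combination y (n + d) * (-e)

end Band

/-! ### Families of rational functions with a common denominator -/

section Bounded

variable {K : Type*} [Field K] {X : Type*} {f f' : X → RatFunc K}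

local notation "ι" => algebraMap K[X] (RatFunc K)

/-- The rational functions `f x` have a common denominator and numerators of bounded degree. -/
def HasBoundedFractions (f : X → RatFunc K) : Prop :=
  ∃ (D : K[X]) (N : ℕ), D ≠ 0 ∧ ∀ x, ∃ P : K[X], P.natDegree ≤ N ∧ ι D * f x = ι P

theorem HasBoundedFractions.of_mul {g : K[X]} (hg : g ≠ 0) {A : X → K[X]} {N : ℕ}
    (hA : ∀ x, (A x).natDegree ≤ N) (h : ∀ x, ι g * f x = ι (A x)) : HasBoundedFractions f :=
  ⟨g, N, hg, fun x => ⟨A x, hA x, h x⟩⟩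

theorem HasBoundedFractions.const (f : RatFunc K) : HasBoundedFractions fun _ : X => f :=
  ⟨f.denom, f.num.natDegree, f.denom_ne_zero, fun _ => ⟨f.num, le_rfl, by
    have h := (div_eq_iff (algebraMap_ratFunc_ne_zero f.denom_ne_zero)).1 (RatFunc.num_div_denom f)
    rw [h, mul_comm]⟩⟩

theorem HasBoundedFractions.constants (l : X → K) :
    HasBoundedFractions fun x => RatFunc.C (l x) :=
  ⟨1, 0, one_ne_zero, fun x => ⟨C (l x), (natDegree_C _).le, by
    rw [map_one, one_mul, RatFunc.algebraMap_C]⟩⟩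

theorem HasBoundedFractions.add (hf : HasBoundedFractions f) (hf' : HasBoundedFractions f') :
    HasBoundedFractions fun x => f x + f' x := by
  obtain ⟨D, N, hD, h⟩ := hf
  obtain ⟨D', N', hD', h'⟩ := hf'
  refine ⟨D * D', D'.natDegree + N + (D.natDegree + N'), mul_ne_zero hD hD', fun x => ?_⟩
  obtain ⟨P, hP, e⟩ := h x
  obtain ⟨P', hP', e'⟩ := h' x
  refine ⟨D' * P + D * P', ?_, ?_⟩
  · have h1 := natDegree_add_le (D' * P) (D * P')
    have h2 := natDegree_mul_le (p := D') (q := P)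
    have h3 := natDegree_mul_le (p := D) (q := P')
    omega
  · rw [map_add, map_mul, map_mul, map_mul, ← e, ← e']; ring

theorem HasBoundedFractions.mul (hf : HasBoundedFractions f) (hf' : HasBoundedFractions f') :
    HasBoundedFractions fun x => f x * f' x := by
  obtain ⟨D, N, hD, h⟩ := hf
  obtain ⟨D', N', hD', h'⟩ := hf'
  refine ⟨D * D', N + N', mul_ne_zero hD hD', fun x => ?_⟩
  obtain ⟨P, hP, e⟩ := h x
  obtain ⟨P', hP', e'⟩ := h' x
  refine ⟨P * P', natDegree_mul_le.trans (add_le_add hP hP'), ?_⟩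
  rw [map_mul, map_mul, ← e, ← e']; ring

theorem HasBoundedFractions.ratDeriv (hf : HasBoundedFractions f) :
    HasBoundedFractions fun x => ratDeriv (f x) := by
  obtain ⟨D, N, hD, h⟩ := hf
  refine ⟨D ^ 2, D.natDegree + N, pow_ne_zero 2 hD, fun x => ?_⟩
  obtain ⟨P, hP, e⟩ := h x
  refine ⟨D * derivative P - derivative D * P, ?_, ?_⟩
  · have h1 := natDegree_sub_le (D * derivative P) (derivative D * P)
    have h2 := natDegree_mul_le (p := D) (q := derivative P)
    have h3 := natDegree_mul_le (p := derivative D) (q := P)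
    have h4 := natDegree_derivative_le P
    have h5 := natDegree_derivative_le D
    omega
  · have := congrArg _root_.ratDeriv e
    rw [ratDeriv_mul, ratDeriv_algebraMap, ratDeriv_algebraMap] at this
    rw [map_sub, map_mul, map_mul, ← this, ← e, map_pow]; ring

end Bounded

/-! ### Interpolation of intertwiners in the spectral parameter -/

section Interpolation

variable {K : Type*} [Field K]

theorem DiffOp2.nabla_add (T : DiffOp2 K) (v w : (RatFunc K)[X] × (RatFunc K)[X]) :
    T.nabla (v + w) = T.nabla v + T.nabla w := by
  apply Prod.ext <;> simp only [DiffOp2.nabla, Prod.fst_add, Prod.snd_add, coeffDeriv_add] <;> ring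

theorem DiffOp2.nabla_smul (T : DiffOp2 K) (m : K[X]) (v : (RatFunc K)[X] × (RatFunc K)[X]) :
    T.nabla (m.map RatFunc.C • v) = m.map RatFunc.C • T.nabla v := by
  apply Prod.ext <;> simp only [DiffOp2.nabla, Prod.smul_fst, Prod.smul_snd, smul_eq_mul,
    coeffDeriv_mul, coeffDeriv_map_C] <;> ring

/-- The reduction of `(T - λ) (a + b D)` modulo `T₀ - λ`. -/
noncomputable def intertwiningDefect (T₀ T : DiffOp2 K) :
    (RatFunc K)[X] × (RatFunc K)[X] →+ (RatFunc K)[X] × (RatFunc K)[X] :=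
  AddMonoidHom.mk' (fun v =>
    (C T.p * (T₀.nabla (T₀.nabla v)).1 + C T.q * (T₀.nabla v).1 + (C T.r - X) * v.1,
      C T.p * (T₀.nabla (T₀.nabla v)).2 + C T.q * (T₀.nabla v).2 + (C T.r - X) * v.2)) fun v w => by
    apply Prod.ext <;> simp only [DiffOp2.nabla_add, Prod.fst_add, Prod.snd_add] <;> ring

theorem intertwiningDefect_apply (T₀ T : DiffOp2 K) (v : (RatFunc K)[X] × (RatFunc K)[X]) :
    intertwiningDefect T₀ T v =
    (C T.p * (T₀.nabla (T₀.nabla v)).1 + C T.q * (T₀.nabla v).1 + (C T.r - X) * v.1,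
      C T.p * (T₀.nabla (T₀.nabla v)).2 + C T.q * (T₀.nabla v).2 + (C T.r - X) * v.2) := rfl

theorem intertwines_iff {T₀ T : DiffOp2 K} {v : (RatFunc K)[X] × (RatFunc K)[X]} :
    Intertwines T₀ T v ↔ intertwiningDefect T₀ T v = 0 := by
  rw [intertwiningDefect_apply, Prod.mk_eq_zero]; rfl

theorem intertwiningDefect_smul (T₀ T : DiffOp2 K) (m : K[X])
    (v : (RatFunc K)[X] × (RatFunc K)[X]) :
    intertwiningDefect T₀ T (m.map RatFunc.C • v)
      = m.map RatFunc.C • intertwiningDefect T₀ T v := by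
  apply Prod.ext <;> simp only [intertwiningDefect_apply, DiffOp2.nabla_smul, Prod.smul_fst,
    Prod.smul_snd, smul_eq_mul] <;> ring

/-- For `a`, `b` independent of `λ`, the defect is affine in `λ`. -/
theorem natDegree_intertwiningDefect_le (T₀ T : DiffOp2 K) (a b : RatFunc K) :
    (intertwiningDefect T₀ T (C a, C b)).1.natDegree ≤ 1 ∧
      (intertwiningDefect T₀ T (C a, C b)).2.natDegree ≤ 1 := by
  simp only [intertwiningDefect_apply, DiffOp2.nabla, DiffOp2.alpha, coeffDeriv_add, coeffDeriv_mul,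
    coeffDeriv_sub, coeffDeriv_C, coeffDeriv_X]
  constructor <;> compute_degree

theorem eq_C_coeff_one_mul {R : Type*} [CommRing R] {P : R[X]} (hP : P.natDegree ≤ 1) {x : R}
    (hx : P.eval x = 0) : P = C (P.coeff 1) * (X - C x) := by
  have h := eq_X_add_C_of_natDegree_le_one hP
  rw [h, eval_add, eval_mul, eval_C, eval_X, eval_C] at hx
  have h1 : C (P.coeff 1) * C x + C (P.coeff 0) = 0 := by rw [← C_mul, ← C_add, hx, C_0]
  linear_combination h + h1

/-- If `(a i, b i)` intertwines at the value `l i` of the spectral parameter, and the pairs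
`(a i, b i)` satisfy a linear relation with constant coefficients, then Lagrange interpolation gives
an intertwiner for all values: the defect is affine in `λ`, so the interpolated defect is a multiple
of the leading coefficient of the defect of the vanishing combination. -/
theorem exists_intertwines {T₀ T : DiffOp2 K} {a b : ℕ → RatFunc K} {l : ℕ → K}
    (hl : Function.Injective l)
    (h₁ : ∀ i, (intertwiningDefect T₀ T (C (a i), C (b i))).1.eval (RatFunc.C (l i)) = 0)
    (h₂ : ∀ i, (intertwiningDefect T₀ T (C (a i), C (b i))).2.eval (RatFunc.C (l i)) = 0)
    {s : Finset ℕ} {c : ℕ → K} (ha : ∑ i ∈ s, RatFunc.C (c i) * a i = 0)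
    (hb : ∑ i ∈ s, RatFunc.C (c i) * b i = 0) {i₀ : ℕ} (hi₀ : i₀ ∈ s) (hc : c i₀ ≠ 0)
    (hab : a i₀ ≠ 0 ∨ b i₀ ≠ 0) :
    ∃ v : (RatFunc K)[X] × (RatFunc K)[X], Intertwines T₀ T v ∧ (v.1 ≠ 0 ∨ v.2 ≠ 0) := by
  classical
  let m : ℕ → K[X] := fun i => C (c i) * ∏ j ∈ s.erase i, (X - C (l j))
  let w : ℕ → (RatFunc K)[X] × (RatFunc K)[X] := fun i => (C (a i), C (b i))
  let Φ := intertwiningDefect T₀ T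
  refine ⟨∑ i ∈ s, (m i).map RatFunc.C • w i, ?_, ?_⟩
  · have hsum : ∑ i ∈ s, (C (c i)).map RatFunc.C • w i = 0 := by
      apply Prod.ext
      · simp only [w, Prod.fst_sum, Prod.smul_fst, smul_eq_mul, map_C, ← C_mul, Prod.fst_zero]
        rw [← map_sum, ha, C_0]
      · simp only [w, Prod.snd_sum, Prod.smul_snd, smul_eq_mul, map_C, ← C_mul, Prod.snd_zero]
        rw [← map_sum, hb, C_0]
    have hΦ : ∑ i ∈ s, (C (c i)).map RatFunc.C • Φ (w i) = 0 := by
      rw [← map_zero Φ, ← hsum, map_sum]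
      exact Finset.sum_congr rfl fun i _ => (intertwiningDefect_smul T₀ T _ _).symm
    have hm : ∀ i ∈ s, (m i).map RatFunc.C * (X - C (RatFunc.C (l i)))
        = C (RatFunc.C (c i)) * (∏ j ∈ s, (X - C (l j))).map RatFunc.C := fun i hi => by
      rw [← Finset.mul_prod_erase s _ hi]
      simp only [m, Polynomial.map_mul, Polynomial.map_sub, map_X, map_C]
      ring
    rw [intertwines_iff, map_sum]
    simp only [intertwiningDefect_smul]
    apply Prod.ext
    · have h0 := congrArg (fun v => v.1.coeff 1) hΦ
      simp only [Prod.fst_sum, finsetSum_coeff, Prod.smul_fst, smul_eq_mul, map_C, coeff_C_mul,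
        Prod.fst_zero, coeff_zero] at h0
      simp only [Prod.fst_sum, Prod.smul_fst, smul_eq_mul, Prod.fst_zero]
      have h3 : ∀ i ∈ s, (m i).map RatFunc.C * (Φ (w i)).1
          = (∏ j ∈ s, (X - C (l j))).map RatFunc.C
            * C (RatFunc.C (c i) * (Φ (w i)).1.coeff 1) := fun i hi => by
        have e : (Φ (w i)).1 = C ((Φ (w i)).1.coeff 1) * (X - C (RatFunc.C (l i))) :=
          eq_C_coeff_one_mul (natDegree_intertwiningDefect_le T₀ T (a i) (b i)).1 (h₁ i)
        rw [C_mul]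
        linear_combination (m i).map RatFunc.C * e + C ((Φ (w i)).1.coeff 1) * hm i hi
      rw [Finset.sum_congr rfl h3, ← Finset.mul_sum, ← map_sum, h0, C_0, mul_zero]
    · have h0 := congrArg (fun v => v.2.coeff 1) hΦ
      simp only [Prod.snd_sum, finsetSum_coeff, Prod.smul_snd, smul_eq_mul, map_C, coeff_C_mul,
        Prod.snd_zero, coeff_zero] at h0
      simp only [Prod.snd_sum, Prod.smul_snd, smul_eq_mul, Prod.snd_zero]
      have h3 : ∀ i ∈ s, (m i).map RatFunc.C * (Φ (w i)).2
          = (∏ j ∈ s, (X - C (l j))).map RatFunc.C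
            * C (RatFunc.C (c i) * (Φ (w i)).2.coeff 1) := fun i hi => by
        have e : (Φ (w i)).2 = C ((Φ (w i)).2.coeff 1) * (X - C (RatFunc.C (l i))) :=
          eq_C_coeff_one_mul (natDegree_intertwiningDefect_le T₀ T (a i) (b i)).2 (h₂ i)
        rw [C_mul]
        linear_combination (m i).map RatFunc.C * e + C ((Φ (w i)).2.coeff 1) * hm i hi
      rw [Finset.sum_congr rfl h3, ← Finset.mul_sum, ← map_sum, h0, C_0, mul_zero]
  · -- at `λ = l i₀` only the term with index `i₀` survives
    have hev : ∀ f : ℕ → RatFunc K, f i₀ ≠ 0 → ∑ i ∈ s, (m i).map RatFunc.C * C (f i) ≠ 0 := by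
      intro f hf h0
      have h4 := congrArg (eval (RatFunc.C (l i₀))) h0
      rw [eval_finsetSum, Finset.sum_eq_single i₀, eval_zero, eval_mul, eval_C, eval_map_apply,
        mul_eq_zero, or_iff_left hf, map_eq_zero] at h4
      · simp only [m, eval_mul, eval_C, eval_prod, eval_sub, eval_X, mul_eq_zero,
          Finset.prod_eq_zero_iff, hc, false_or] at h4
        obtain ⟨j, hj, h5⟩ := h4
        exact (Finset.mem_erase.1 hj).1 (hl (sub_eq_zero.1 h5)).symm
      · intro i hi hne
        rw [eval_mul, eval_map_apply]
        have : (m i).eval (l i₀) = 0 := by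
          simp only [m, eval_mul, eval_prod]
          rw [Finset.prod_eq_zero (Finset.mem_erase.2 ⟨hne.symm, hi₀⟩) (by simp), mul_zero]
        rw [this, map_zero, zero_mul]
      · exact fun h => absurd hi₀ h
    rw [Prod.fst_sum, Prod.snd_sum]
    exact hab.imp (hev a) (hev b)

/-- Along a solution `f` of `T₀ f = l f`, the operator `∇` is differentiation of `a f + b f'`. -/
theorem DiffOp2.ratDeriv_eq_nabla {T₀ : DiffOp2 K} {f : RatFunc K} {l : K}
    (hf : T₀.apply f = RatFunc.C l * f) (v : (RatFunc K)[X] × (RatFunc K)[X]) :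
    ratDeriv (v.1.eval (RatFunc.C l) * f + v.2.eval (RatFunc.C l) * ratDeriv f)
      = (T₀.nabla v).1.eval (RatFunc.C l) * f + (T₀.nabla v).2.eval (RatFunc.C l) * ratDeriv f := by
  have hp := T₀.p_ne_zero
  have h2 : ratDeriv (ratDeriv f)
      = T₀.p⁻¹ * (RatFunc.C l - T₀.r) * f + T₀.beta * ratDeriv f := by
    rw [DiffOp2.apply] at hf
    rw [DiffOp2.beta]
    field_simp
    linear_combination hf
  simp only [DiffOp2.nabla, DiffOp2.alpha, eval_add, eval_mul, eval_sub, eval_C, eval_X,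
    eval_coeffDeriv, ratDeriv_add, ratDeriv_mul, h2]
  ring

/-- The defect measures the failure of `a f + b f'` to be an eigenfunction of `T`. -/
theorem DiffOp2.apply_sub_eq_defect {T₀ T : DiffOp2 K} {f : RatFunc K} {l : K}
    (hf : T₀.apply f = RatFunc.C l * f) (v : (RatFunc K)[X] × (RatFunc K)[X]) :
    T.apply (v.1.eval (RatFunc.C l) * f + v.2.eval (RatFunc.C l) * ratDeriv f)
        - RatFunc.C l * (v.1.eval (RatFunc.C l) * f + v.2.eval (RatFunc.C l) * ratDeriv f)
      = (intertwiningDefect T₀ T v).1.eval (RatFunc.C l) * f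
        + (intertwiningDefect T₀ T v).2.eval (RatFunc.C l) * ratDeriv f := by
  rw [DiffOp2.apply, DiffOp2.ratDeriv_eq_nabla hf, DiffOp2.ratDeriv_eq_nabla hf]
  simp only [intertwiningDefect_apply, eval_add, eval_mul, eval_sub, eval_C, eval_X]
  ring

theorem HasBoundedFractions.intertwiningDefect {X : Type*} (T₀ T : DiffOp2 K)
    {a b : X → RatFunc K} (ha : HasBoundedFractions a) (hb : HasBoundedFractions b) (l : X → K) :
    HasBoundedFractions (fun x =>
      (intertwiningDefect T₀ T (C (a x), C (b x))).1.eval (RatFunc.C (l x))) ∧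
    HasBoundedFractions (fun x =>
      (_root_.intertwiningDefect T₀ T (C (a x), C (b x))).2.eval (RatFunc.C (l x))) := by
  have hl : HasBoundedFractions fun x => RatFunc.C (l x) := .constants l
  have hα : HasBoundedFractions fun x => T₀.p⁻¹ * (RatFunc.C (l x) + -T₀.r) :=
    (HasBoundedFractions.const _).mul (hl.add (.const _))
  have h1 := ha.ratDeriv.add (hb.mul hα)
  have h2 := (ha.add hb.ratDeriv).add ((HasBoundedFractions.const T₀.beta).mul hb)
  have h3 := h1.ratDeriv.add (h2.mul hα)
  have h4 := (h1.add h2.ratDeriv).add ((HasBoundedFractions.const T₀.beta).mul h2)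
  have hrl : HasBoundedFractions fun x => T.r + (-1) * RatFunc.C (l x) :=
    (HasBoundedFractions.const _).add ((HasBoundedFractions.const (-1)).mul hl)
  have h5 := (((HasBoundedFractions.const T.p).mul h3).add
    ((HasBoundedFractions.const T.q).mul h1)).add (hrl.mul ha)
  have h6 := (((HasBoundedFractions.const T.p).mul h4).add
    ((HasBoundedFractions.const T.q).mul h2)).add (hrl.mul hb)
  constructor
  · convert h5 using 2 with x
    simp only [intertwiningDefect_apply, DiffOp2.nabla, DiffOp2.alpha, eval_add, eval_mul,
      eval_sub, eval_C, eval_X, eval_coeffDeriv, ← sub_eq_add_neg, neg_one_mul]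
  · convert h6 using 2 with x
    simp only [intertwiningDefect_apply, DiffOp2.nabla, DiffOp2.alpha, eval_add, eval_mul,
      eval_sub, eval_C, eval_X, eval_coeffDeriv, ← sub_eq_add_neg, neg_one_mul]

end Interpolation

/-! ### The classical operator is intertwined with the exceptional one -/

section Main

local notation "ι" => algebraMap ℝ[X] (RatFunc ℝ)

/-- The operator `p D² + Q D + c` with polynomial `p`, `Q` and constant `c`. -/
noncomputable def polyDiffOp {K : Type*} [Field K] (p Q : K[X]) (c : K) (hp : p ≠ 0) :
    DiffOp2 K where
  p := algebraMap K[X] (RatFunc K) p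
  q := algebraMap K[X] (RatFunc K) Q
  r := RatFunc.C c
  p_ne_zero := algebraMap_ratFunc_ne_zero hp

variable {T : DiffOp2 ℝ} {a b : EReal} {W : ℝ → ℝ} {E : Finset ℕ} {y : ℕ → ℝ[X]} {p Q η : ℝ[X]}
  {c : ℝ}

/-- Two relations with bounded fractions as coefficients between `H` and `H'`, for infinitely many
eigenpolynomials `H`, are trivial in large degree. -/
theorem HasBoundedFractions.eventually_eq_zero {L : ℝ[X] →ₗ[ℝ] ℝ} (hL : IsPearson L p Q)
    {e₁ e₂ : ℕ → RatFunc ℝ} (h₁ : HasBoundedFractions e₁) (h₂ : HasBoundedFractions e₂)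
    {H : ℕ → ℝ[X]} {N₀ : ℕ} (hH : ∀ i, H i ≠ 0)
    (horth : ∀ i, ∀ v ∈ degreeLT ℝ (i + N₀), L (H i * v) = 0)
    (h : ∀ i, e₁ i * ι (H i) + e₂ i * ι (derivative (H i)) = 0) :
    ∃ N, ∀ i ≥ N, e₁ i = 0 ∧ e₂ i = 0 := by
  obtain ⟨D₁, N₁, hD₁, h₁⟩ := h₁
  obtain ⟨D₂, N₂, hD₂, h₂⟩ := h₂
  refine ⟨D₁.natDegree + N₂ + 1, fun i hi => ?_⟩
  obtain ⟨P₁, hP₁, k₁⟩ := h₁ i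
  obtain ⟨P₂, hP₂, k₂⟩ := h₂ i
  have hd := natDegree_mul_le (p := D₁) (q := P₂)
  have hrel : D₂ * P₁ * H i + D₁ * P₂ * derivative (H i) = 0 := by
    apply RatFunc.algebraMap_injective ℝ
    rw [map_add, map_mul, map_mul, map_mul, map_mul, ← k₁, ← k₂, map_zero]
    linear_combination ι D₁ * ι D₂ * h i
  obtain ⟨z₁, z₂⟩ := hL.eq_zero_of_mul_add_mul_derivative (hH i) (horth i) (by omega) hrel
  rw [(mul_eq_zero.1 z₁).resolve_left hD₂, map_zero] at k₁
  rw [(mul_eq_zero.1 z₂).resolve_left hD₁, map_zero] at k₂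
  exact ⟨(mul_eq_zero.1 k₁).resolve_left (algebraMap_ratFunc_ne_zero hD₁),
    (mul_eq_zero.1 k₂).resolve_left (algebraMap_ratFunc_ne_zero hD₂)⟩

/-- There is a nonzero differential operator, polynomial in the spectral parameter, which maps
eigenfunctions of the classical operator `p D² + Q D + c` to eigenfunctions of `T`. -/
theorem IsSLOPS.exists_intertwines (h : IsSLOPS T a b W E y) (nf : NormalForm T p Q η c) :
    ∃ v : (RatFunc ℝ)[X] × (RatFunc ℝ)[X],
      Intertwines (polyDiffOp p Q c nf.p_ne_zero) T v ∧ (v.1 ≠ 0 ∨ v.2 ≠ 0) := by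
  set T₀ := polyDiffOp p Q c nf.p_ne_zero with hT₀
  obtain ⟨g, M, N, hg, hband⟩ := h.exists_eq_mul_add nf
  obtain ⟨N', hN'⟩ := exists_eigenvalueAt_ne nf.nonconst 0
  -- beyond `N₀` there are no exceptional degrees and the eigenvalues are distinct
  set N₀ := N + N' + E.sup id + 1 with hN₀
  have hE : ∀ i, i + N₀ + η.natDegree ∉ E := fun i hi => by
    have := Finset.le_sup (f := id) hi
    simp only [id] at this
    omega
  choose H hHd hH horth hTy A hA B hB hAB using fun i => hband (i + N₀) (by omega) (hE i)
  set l : ℕ → ℝ := fun i => eigenvalueAt p Q (i + N₀ : ℕ) + c with hl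
  have hlinj : Function.Injective l := by
    have key : ∀ i j, i < j → l i ≠ l j := fun i j hij heq =>
      hN' (j + N₀) (by omega) (i + N₀ : ℕ) (by simpa using (by positivity)) (by exact_mod_cast
        (by omega : i + N₀ < j + N₀)) (add_right_cancel heq)
    intro i j hij
    by_contra hne
    rcases lt_or_gt_of_ne hne with h1 | h1
    · exact key i j h1 hij
    · exact key j i h1 hij.symm
  have hH0 : ∀ i, H i ≠ 0 := fun i h0 =>
    WithBot.natCast_ne_bot _ ((hHd i).symm.trans (by rw [h0, degree_zero]))
  have hg' := algebraMap_ratFunc_ne_zero hg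
  set α : ℕ → RatFunc ℝ := fun i => ι (A i) / ι g with hα
  set β : ℕ → RatFunc ℝ := fun i => ι (B i * p) / ι g with hβ
  have hαB : HasBoundedFractions α := .of_mul hg (N := M)
    (fun i => Nat.lt_succ_iff.1 (natDegree_lt_of_mem_degreeLT (Nat.succ_pos M) (hA i)))
    fun i => mul_div_cancel₀ _ hg'
  have hβB : HasBoundedFractions β := .of_mul hg (N := M + 2) (A := fun i => B i * p)
    (fun i => by
      have h1 := natDegree_mul_le (p := B i) (q := p)
      have h2 := natDegree_le_of_degree_le (mem_degreeLT.1 (hB i)).le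
      have h3 := nf.natDegree_p
      omega) fun i => mul_div_cancel₀ _ hg'
  have hsol : ∀ i, T₀.apply (ι (H i)) = RatFunc.C (l i) * ι (H i) := fun i => by
    have := congrArg ι (hH i)
    rw [polyOp_apply] at this
    simp only [map_add, map_mul, map_zero, RatFunc.algebraMap_C] at this
    simp only [DiffOp2.apply, hT₀, polyDiffOp, ratDeriv_algebraMap, hl, map_add]
    linear_combination this
  have hyi : ∀ i, α i * ι (H i) + β i * ι (derivative (H i)) = ι (y (i + N₀ + η.natDegree)) :=
    fun i => by
      have := congrArg ι (hAB i)
      simp only [hα, hβ]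
      simp only [map_mul, map_add] at this ⊢
      field_simp
      linear_combination -this
  -- the defect annihilates `(H, H')` and has bounded fractions, so it vanishes for large indices
  obtain ⟨hb₁, hb₂⟩ := HasBoundedFractions.intertwiningDefect T₀ T hαB hβB l
  obtain ⟨N₁, hN₁⟩ := HasBoundedFractions.eventually_eq_zero (h.isPearson nf) hb₁ hb₂ hH0
    (N₀ := N₀) horth fun i => by
      have := DiffOp2.apply_sub_eq_defect (T := T) (hsol i) (C (α i), C (β i))
      simp only [eval_C, ratDeriv_algebraMap] at this
      rw [← this, hyi, hTy, ← C_mul_algebraMap, sub_self]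
  -- the coefficient pairs of large index lie in a finite-dimensional space
  have hdep : ¬ LinearIndependent ℝ (fun i : ℕ =>
      ((⟨A (i + N₁), hA _⟩, ⟨B (i + N₁), hB _⟩) : degreeLT ℝ (M + 1) × degreeLT ℝ M)) :=
    fun hli => by
      have := hli.finite
      exact not_finite ℕ
  obtain ⟨s, k, hsum, i₀, hi₀, hk⟩ := not_linearIndependent_iff.1 hdep
  have hsA : ∑ i ∈ s, C (k i) * A (i + N₁) = 0 := by
    have := congrArg (fun v => (v.1 : ℝ[X])) hsum
    simpa [Prod.fst_sum, smul_eq_C_mul] using this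
  have hsB : ∑ i ∈ s, C (k i) * B (i + N₁) = 0 := by
    have := congrArg (fun v => (v.2 : ℝ[X])) hsum
    simpa [Prod.snd_sum, smul_eq_C_mul] using this
  refine _root_.exists_intertwines (a := fun i => α (i + N₁)) (b := fun i => β (i + N₁))
    (l := fun i => l (i + N₁)) (hlinj.comp (add_left_injective N₁))
    (fun i => (hN₁ _ (by omega)).1) (fun i => (hN₁ _ (by omega)).2) (s := s) (c := k) ?_ ?_ hi₀ hk ?_
  · have := congrArg (fun u => ι u / ι g) hsA
    simp only [map_sum, Finset.sum_div, map_zero, zero_div] at this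
    rw [← this]
    exact Finset.sum_congr rfl fun i _ => by
      rw [map_mul, RatFunc.algebraMap_C, mul_div_assoc]
  · have := congrArg (fun u => ι (u * p) / ι g) hsB
    simp only [Finset.sum_mul, map_sum, Finset.sum_div, map_zero, zero_div, zero_mul] at this
    rw [← this]
    exact Finset.sum_congr rfl fun i _ => by
      rw [mul_assoc, map_mul, RatFunc.algebraMap_C, mul_div_assoc]
  · by_contra hcon
    push Not at hcon
    have h1 := hyi (i₀ + N₁)
    rw [hcon.1, hcon.2, zero_mul, zero_mul, add_zero] at h1
    have h2 := h.degree_eq _ (hE (i₀ + N₁))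
    rw [(map_eq_zero_iff ι (RatFunc.algebraMap_injective ℝ)).1 h1.symm, degree_zero] at h2
    exact WithBot.natCast_ne_bot _ h2.symm

theorem coeffDeriv_map_ratComplexify (v : (RatFunc ℝ)[X]) :
    coeffDeriv (v.map ratComplexify) = (coeffDeriv v).map ratComplexify := by
  ext n
  simp [ratDeriv_ratComplexify]

theorem DiffOp2.nabla_complexify (T : DiffOp2 ℝ) (v : (RatFunc ℝ)[X] × (RatFunc ℝ)[X]) :
    T.complexify.nabla (v.1.map ratComplexify, v.2.map ratComplexify)
      = ((T.nabla v).1.map ratComplexify, (T.nabla v).2.map ratComplexify) := by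
  simp [DiffOp2.nabla, DiffOp2.alpha, DiffOp2.beta, DiffOp2.complexify,
    coeffDeriv_map_ratComplexify]

theorem Intertwines.complexify {T₀ T : DiffOp2 ℝ} {v : (RatFunc ℝ)[X] × (RatFunc ℝ)[X]}
    (h : Intertwines T₀ T v) : Intertwines T₀.complexify T.complexify
      (v.1.map ratComplexify, v.2.map ratComplexify) := by
  have h1 := congrArg (Polynomial.map ratComplexify) h.1
  have h2 := congrArg (Polynomial.map ratComplexify) h.2
  simp only [Polynomial.map_add, Polynomial.map_sub, Polynomial.map_mul, map_C, map_X,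
    Polynomial.map_zero] at h1 h2
  rw [Intertwines, DiffOp2.nabla_complexify, T₀.nabla_complexify (T₀.nabla v)]
  exact ⟨h1, h2⟩

theorem polyDiffOp_complexify (p Q : ℝ[X]) (c : ℝ) (hp : p ≠ 0) :
    (polyDiffOp p Q c hp).complexify = polyDiffOp (p.map (algebraMap ℝ ℂ))
      (Q.map (algebraMap ℝ ℂ)) (c : ℂ)
      ((Polynomial.map_ne_zero_iff (algebraMap ℝ ℂ).injective).2 hp) := by
  simp [polyDiffOp, DiffOp2.complexify, ratComplexify_algebraMap, ratComplexify_C]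

/-- `p D² + Q D + c = (p D + Q) D + c`. -/
theorem factorable_polyDiffOp {K : Type*} [Field K] (p Q : K[X]) (c : K) (hp : p ≠ 0) :
    (polyDiffOp p Q c hp).Factorable := by
  refine ⟨⟨1, 0, one_ne_zero⟩, ⟨algebraMap K[X] (RatFunc K) p, algebraMap K[X] (RatFunc K) Q,
    algebraMap_ratFunc_ne_zero hp⟩, c, fun f => ?_⟩
  simp [DiffOp2.apply, DiffOp1.apply, polyDiffOp]

/-- `T` is obtained by rational Darboux transformations from the operator `p D² + Q D + c` of its
normal form. -/
theorem IsSLOPS.factorizationChain (h : IsSLOPS T a b W E y) (nf : NormalForm T p Q η c) :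
    FactorizationChain (polyDiffOp p Q c nf.p_ne_zero).complexify T.complexify := by
  obtain ⟨v, hv, hne⟩ := h.exists_intertwines nf
  have hinj : Function.Injective (Polynomial.map ratComplexify) :=
    Polynomial.map_injective _ ratComplexify.injective
  refine Intertwines.factorizationChain
    (max (2 * (v.1.map ratComplexify).natDegree) (2 * (v.2.map ratComplexify).natDegree + 1)) _ _ _
    ?_ ?_ hv.complexify ?_ (le_max_left _ _) (Or.inr (le_max_right _ _))
  · rw [polyDiffOp_complexify]
    exact factorable_polyDiffOp _ _ _ _
  · simp [DiffOp2.complexify, polyDiffOp, nf.p_eq]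
  · exact hne.imp (fun h0 h1 => h0 (hinj (by simpa using h1)))
      (fun h0 h1 => h0 (hinj (by simpa using h1)))

end Main

/-! ### Classical operators -/

section Classical

/-- One step of the shift of parameters: `(p D + Q) D ↦ D (p D + Q) = p D² + (Q + p') D + Q'`, read
backwards. -/
theorem isRationalDarboux_polyDiffOp {p Q : ℂ[X]} (hQ : Q.natDegree ≤ 1) (c : ℂ) (hp : p ≠ 0) :
    IsRationalDarboux (polyDiffOp p (Q + derivative p) (c + Q.coeff 1) hp)
      (polyDiffOp p Q c hp) := by
  have hQ' : derivative Q = C (Q.coeff 1) := by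
    conv_lhs => rw [eq_X_add_C_of_natDegree_le_one hQ]
    simp
  refine ⟨⟨algebraMap ℂ[X] (RatFunc ℂ) p, algebraMap ℂ[X] (RatFunc ℂ) Q,
    algebraMap_ratFunc_ne_zero hp⟩, ⟨1, 0, one_ne_zero⟩, c, fun f => ?_, fun f => ?_⟩
  · simp only [DiffOp2.apply, DiffOp1.apply, polyDiffOp, ratDeriv_add, ratDeriv_mul,
      ratDeriv_algebraMap, hQ', RatFunc.algebraMap_C, map_add]
    ring
  · simp [DiffOp2.apply, DiffOp1.apply, polyDiffOp]

/-- Up to a spectral shift, `p D² + Q D + c` comes from `p D² + (Q + j p') D`. -/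
theorem exists_factorizationChain_shift {p Q : ℝ[X]} (hp : p ≠ 0) (hp2 : p.natDegree ≤ 2)
    (hQ : Q.natDegree ≤ 1) (c : ℝ) (j : ℕ) :
    ∃ m : ℝ, FactorizationChain (polyDiffOp p (Q + j * derivative p) m hp).complexify
      (polyDiffOp p Q c hp).complexify := by
  induction j with
  | zero => exact ⟨c, by rw [Nat.cast_zero, zero_mul, add_zero]; exact Relation.ReflTransGen.refl⟩
  | succ j ih =>
    obtain ⟨m, hm⟩ := ih
    have hdeg : (Q + j * derivative p).natDegree ≤ 1 := by
      refine (natDegree_add_le _ _).trans (max_le hQ ?_)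
      rw [← C_eq_natCast]
      exact (natDegree_C_mul_le _ _).trans ((natDegree_derivative_le p).trans (by omega))
    refine ⟨m + (Q + j * derivative p).coeff 1, Relation.ReflTransGen.head ?_ hm⟩
    have := isRationalDarboux_polyDiffOp (p := p.map (algebraMap ℝ ℂ))
      (Q := (Q + j * derivative p).map (algebraMap ℝ ℂ)) (natDegree_map_le.trans hdeg) m
      ((Polynomial.map_ne_zero_iff (algebraMap ℝ ℂ).injective).2 hp)
    rw [polyDiffOp_complexify, polyDiffOp_complexify]
    convert this using 2
    · rw [derivative_map, ← Polynomial.map_add]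
      congr 1
      push_cast
      ring
    · rw [coeff_map]
      push_cast
      rfl

theorem IsClassicalPair.natDegree_le {p q : ℝ[X]} (h : IsClassicalPair p q) :
    p.natDegree ≤ 2 ∧ q.natDegree ≤ 1 := by
  cases h <;> constructor <;> compute_degree <;> norm_num

theorem IsClassicalPair.eigenvalueAt_ne {p q : ℝ[X]} (h : IsClassicalPair p q) {j n : ℕ}
    (hj : j < n) : eigenvalueAt p q j ≠ eigenvalueAt p q n := by
  have hlt : (j : ℝ) < n := by exact_mod_cast hj
  cases h with
  | hermite =>
    have h1 : (1 : ℝ[X]).coeff 2 = 0 := by simp [coeff_one]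
    have h2 : (-(2 * X) : ℝ[X]).coeff 1 = -2 := by
      rw [coeff_neg, show (2 : ℝ[X]) = C 2 from rfl, coeff_C_mul, coeff_X_one, mul_one]
    rw [eigenvalueAt, eigenvalueAt, h1, h2]
    intro h; linarith
  | laguerre α hα =>
    have h1 : (X : ℝ[X]).coeff 2 = 0 := by simp [coeff_X]
    have h2 : (C (1 + α) - X : ℝ[X]).coeff 1 = -1 := by simp [coeff_one]
    rw [eigenvalueAt, eigenvalueAt, h1, h2]
    intro h; linarith
  | jacobi α β hα hβ =>
    have h1 : (1 - X ^ 2 : ℝ[X]).coeff 2 = -1 := by simp [coeff_one]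
    have h2 : (C (β - α) - C (2 + α + β) * X : ℝ[X]).coeff 1 = -(2 + α + β) := by
      simp [coeff_C]
    rw [eigenvalueAt, eigenvalueAt, h1, h2]
    intro h
    have h3 : ((n : ℝ) - j) * (n + j + 1 + α + β) = 0 := by linear_combination h
    have h4 : (1 : ℝ) ≤ n := by exact_mod_cast (by omega : 1 ≤ n)
    have h5 : (0 : ℝ) ≤ j := Nat.cast_nonneg j
    rcases mul_eq_zero.1 h3 with h6 | h6 <;> linarith

/-- The classical operators have eigenpolynomials of every degree, so an operator that becomes
classical after an affine change of variable is the operator of a classical system. -/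
theorem IsClassicalPair.exists_isClassicalOPS {p₀ q₀ p q : ℝ[X]} (h : IsClassicalPair p₀ q₀)
    {s t c : ℝ} (m : ℝ) (hs : s ≠ 0) (hc : c ≠ 0) (hp0 : p ≠ 0)
    (hp : p = C (c / s ^ 2) * p₀.comp (C s * X + C t))
    (hq : q = C (c / s) * q₀.comp (C s * X + C t)) :
    ∃ P, IsClassicalOPS (polyDiffOp p q m hp0) P := by
  choose Q hQd hQ using fun n : ℕ => exists_eigenpoly (n := n) h.natDegree_le.1 h.natDegree_le.2
    fun j hj => h.eigenvalueAt_ne hj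
  refine ⟨fun n => (Q n).comp (C s * X + C t), p₀, q₀, Q, s, t, c, m, h, hs, hc,
    fun n => ⟨hQd n, eigenvalueAt p₀ q₀ n, ?_⟩, fun n => rfl, congrArg (algebraMap ℝ[X] (RatFunc ℝ)) hp,
    congrArg (algebraMap ℝ[X] (RatFunc ℝ)) hq, rfl⟩
  rw [← hQ n, polyOp_apply, zero_mul, add_zero]

/-- An operator `p D² + Q D` with constant `p` and a decaying weight is a Hermite operator. -/
theorem exists_isClassicalOPS_hermite {p Q : ℝ[X]} (hp0 : p ≠ 0) (hp : p.natDegree = 0)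
    (hQ : Q.natDegree ≤ 1) (hneg : Q.coeff 1 / p.coeff 0 < 0) (m : ℝ) :
    ∃ P, IsClassicalOPS (polyDiffOp p Q m hp0) P := by
  have hp' := eq_C_of_natDegree_eq_zero hp
  have hQ' := eq_X_add_C_of_natDegree_le_one hQ
  set k := p.coeff 0
  set u := Q.coeff 1
  set v := Q.coeff 0
  have hk : k ≠ 0 := by rintro h0; rw [h0, div_zero] at hneg; exact lt_irrefl _ hneg
  have hu : u ≠ 0 := by rintro h0; rw [h0, zero_div] at hneg; exact lt_irrefl _ hneg
  set s := √(-(u / k) / 2) with hs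
  have hpos : 0 < -(u / k) / 2 := by linarith
  have hs0 : s ≠ 0 := (Real.sqrt_pos.2 hpos).ne'
  have hs2 : s ^ 2 = -(u / k) / 2 := Real.sq_sqrt hpos.le
  refine IsClassicalPair.hermite.exists_isClassicalOPS (s := s) (t := v * s / u) (c := -u / 2) m hs0
    (div_ne_zero (neg_ne_zero.2 hu) two_ne_zero) hp0 ?_ ?_
  · rw [hp', hs2, one_comp, mul_one]
    congr 1
    field_simp
  · rw [hQ']
    apply Polynomial.funext
    intro x
    simp only [eval_add, eval_mul, eval_C, eval_X, eval_comp, eval_neg, eval_ofNat]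
    field_simp

/-- An operator with `deg p = 1` becomes a Laguerre operator after sufficiently many parameter
shifts, which make `α > -1`. -/
theorem exists_isClassicalOPS_laguerre {p Q : ℝ[X]} (hp0 : p ≠ 0) (hp : p.natDegree = 1)
    (hQ : Q.natDegree ≤ 1) (hQ1 : Q.coeff 1 ≠ 0) :
    ∃ j : ℕ, ∀ m, ∃ P, IsClassicalOPS (polyDiffOp p (Q + j * derivative p) m hp0) P := by
  have hp' := eq_X_add_C_of_natDegree_le_one hp.le
  have hQ' := eq_X_add_C_of_natDegree_le_one hQ
  have hk : p.coeff 1 ≠ 0 := by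
    rw [← hp]; exact leadingCoeff_ne_zero.2 hp0
  set k := p.coeff 1
  set w := p.coeff 0
  set u := Q.coeff 1
  set v := Q.coeff 0
  set s := -u / k with hs
  have hs0 : s ≠ 0 := div_ne_zero (neg_ne_zero.2 hQ1) hk
  set t := w * s / k with ht
  -- in the variable `x = s z + t` the parameter is `α = v / k + t + j - 1`
  obtain ⟨j, hj⟩ := exists_nat_gt (-(v / k + t))
  refine ⟨j, fun m => ?_⟩
  refine (IsClassicalPair.laguerre (v / k + j + t - 1) (by linarith)).exists_isClassicalOPS
    (s := s) (t := t) (c := k * s) m hs0 (mul_ne_zero hk hs0) hp0 ?_ ?_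
  · conv_lhs => rw [hp']
    apply Polynomial.funext
    intro x
    simp only [eval_add, eval_mul, eval_C, eval_X, eval_comp, ht]
    field_simp
  · have hd : derivative p = C k := by rw [hp']; simp
    rw [hd, hQ']
    apply Polynomial.funext
    intro x
    simp only [eval_add, eval_mul, eval_C, eval_X, eval_comp, eval_sub, eval_natCast]
    have : u = -(k * s) := by rw [hs]; field_simp
    rw [this]
    field_simp
    ring

/-- An operator with `deg p = 2` and distinct real roots becomes a Jacobi operator after
sufficiently many parameter shifts, which make `α, β > -1`. -/
theorem exists_isClassicalOPS_jacobi {p Q : ℝ[X]} (hp0 : p ≠ 0) {k r u : ℝ} (hru : r < u)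
    (hp : p = C k * ((X - C r) * (X - C u))) (hQ : Q.natDegree ≤ 1) :
    ∃ j : ℕ, ∀ m, ∃ P, IsClassicalOPS (polyDiffOp p (Q + j * derivative p) m hp0) P := by
  have hQ' := eq_X_add_C_of_natDegree_le_one hQ
  have hk : k ≠ 0 := by rintro rfl; rw [C_0, zero_mul] at hp; exact hp0 hp
  set w := Q.coeff 1
  set v := Q.coeff 0
  have hne : u - r ≠ 0 := (sub_pos.2 hru).ne'
  -- the affine map `x = s z + t` takes `r`, `u` to `-1`, `1`
  set s := 2 / (u - r) with hs
  have hs0 : s ≠ 0 := div_ne_zero two_ne_zero hne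
  obtain ⟨j, hj⟩ := exists_nat_gt
    (max (-((w * u + v) * s / (2 * k))) ((w * r + v) * s / (2 * k)))
  have hj1 := (le_max_left _ _).trans_lt hj
  have hj2 := (le_max_right _ _).trans_lt hj
  refine ⟨j, fun m => ?_⟩
  refine (IsClassicalPair.jacobi ((w * u + v) * s / (2 * k) + j - 1)
    (-((w * r + v) * s / (2 * k)) + j - 1) (by linarith) (by linarith)).exists_isClassicalOPS
    (s := s) (t := -1 - s * r) (c := -k) m hs0 (neg_ne_zero.2 hk) hp0 ?_ ?_
  · rw [hp]
    apply Polynomial.funext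
    intro x
    simp only [eval_mul, eval_C, eval_X, eval_comp, eval_sub, eval_add, eval_pow, eval_one, hs]
    field_simp
    ring
  · have hd : derivative p = C k * (2 * X - C r - C u) := by
      rw [hp]
      simp only [derivative_mul, derivative_sub, derivative_X, derivative_C]
      ring
    rw [hd, hQ']
    apply Polynomial.funext
    intro x
    simp only [eval_mul, eval_C, eval_X, eval_comp, eval_sub, eval_add, eval_natCast, eval_ofNat,
      hs]
    field_simp
    ring

end Classical

theorem mainTheorem1 (T : DiffOp2 ℝ) (a b : EReal) (W : ℝ → ℝ) (E : Finset ℕ) (y : ℕ → ℝ[X])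
    (h : IsSLOPS T a b W E y) :
    ∃ (T₀ : DiffOp2 ℝ) (P : ℕ → ℝ[X]), IsClassicalOPS T₀ P ∧
      FactorizationChain T₀.complexify T.complexify := by
  obtain ⟨p, Q, η, c, nf⟩ := exists_normalForm h.degree_eq h.eigen
  -- `j` parameter shifts bring the operator of the normal form into the range of integrable weights
  suffices hj : ∃ j : ℕ, ∀ m, ∃ P,
      IsClassicalOPS (polyDiffOp p (Q + j * derivative p) m nf.p_ne_zero) P by
    obtain ⟨j, hj⟩ := hj
    obtain ⟨m, hm⟩ := exists_factorizationChain_shift nf.p_ne_zero nf.natDegree_p nf.natDegree_Q c j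
    obtain ⟨P, hP⟩ := hj m
    exact ⟨_, P, hP, hm.trans (h.factorizationChain nf)⟩
  have hdeg := nf.natDegree_p
  obtain hp | hp | hp : p.natDegree = 0 ∨ p.natDegree = 1 ∨ p.natDegree = 2 := by omega
  · refine ⟨0, fun m => ?_⟩
    rw [Nat.cast_zero, zero_mul, add_zero]
    exact exists_isClassicalOPS_hermite nf.p_ne_zero hp nf.natDegree_Q
      (h.div_neg_of_natDegree_eq_zero nf hp) m
  · refine exists_isClassicalOPS_laguerre nf.p_ne_zero hp nf.natDegree_Q
      (nf.nonconst.resolve_left fun h2 => h2 ?_)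
    exact coeff_eq_zero_of_natDegree_lt (by omega)
  · obtain ⟨r, s, hrs, e⟩ := h.exists_roots nf hp
    exact exists_isClassicalOPS_jacobi nf.p_ne_zero hrs e nf.natDegree_Q
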